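/- Write points of the phase space as $X=(x,\xi)\in\mathbb R^{2n}=\mathbb R^n\times\mathbb R^n$, with Euclidean norm $|X|$, and put $\langle X\rangle=(1+|X|^2)^{1/2}$ and $\dot{\mathbb R}^{2n}=\mathbb R^{2n}\setminus\{0\}$. An open cone is an open subset of $\dot{\mathbb R}^{2n}$ that is invariant under multiplication by positive reals. For $m\in\mathbb R$ let $S^m_{\mathrm{iso}}(\mathbb R^n)$ be the set of all $a\in C^\infty(\mathbb R^{2n})$ such that for every $\alpha\in\mathbb N_0^{2n}$ there is $C_\alpha>0$ with $|\partial^\alpha a(X)|\le C_\alpha\langle X\rangle^{m-|\alpha|}$ for all $X$. The Weyl quantization $\mathrm{Op}^{\mathrm w}(a)$ is given on $\mathscr S(\mathbb R^n)$ by $$\mathrm{Op}^{\mathrm w}(a)\varphi(x)=(2\pi)^{-n}\int\!\!\int e^{i\langle x-y,\xi\rangle}a\big(\tfrac{x+y}2,\xi\big)\varphi(y)\,dy\,d\xi$$ and extended by duality to $\mathscr S'(\mathbb R^n)$; let $\Psi^m_{\mathrm{iso}}(\mathbb R^n)=\{\mathrm{Op}^{\mathrm w}(a):a\in S^m_{\mathrm{iso}}(\mathbb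 R^n)\}$. For $A=\mathrm{Op}^{\mathrm w}(a)\in\Psi^0_{\mathrm{iso}}(\mathbb R^n)$ let $\mathrm{Char}_{\mathrm{iso}}(A)$ be the set of those $X_0\in\dot{\mathbb R}^{2n}$ for which there do not exist an open cone $\Gamma\ni X_0$ and constants $c,C>0$ with $|a(X)|\ge c$ for all $X\in\Gamma$, $|X|\ge C$. For $s\in\mathbb R$ let $B^s(\mathbb R^n)=\{v\in\mathscr S'(\mathbb R^n):\mathrm{Op}^{\mathrm w}(\langle\cdot\rangle^s)v\in L^2(\mathbb R^n)\}$. For $u\in\mathscr S'(\mathbb R^n)$ the isotropic wave front set, and the isotropic wave front set of order $s$, are $$WF_{\mathrm{iso}}(u)=\bigcap_{A\in\Psi^0_{\mathrm{iso}},\ Au\in\mathscr S}\mathrm{Char}_{\mathrm{iso}}(A),\qquad WF^s_{\mathrm{iso}}(u)=\bigcap_{A\in\Psi^0_{\mathrm{iso}},\ Au\in B^s}\mathrm{Char}_{\mathrm{iso}}(A).$$ Let $\psi\in\mathscr S(\mathbb R^n)\setminus\{0\}$ be a window and let $V_\psi u(x,\xi)=\big(u,\,e^{i\langle\cdot,\xi\rangle}\psi(\cdot-x)\big)$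 be the short-time Fourier transform of $u\in\mathscr S'(\mathbb R^n)$, where the pairing is antilinear in the second argument. For $X_0\in\dot{\mathbb R}^{2n}$: $X_0\notin WF_G(u)$ if there is an open cone $\Gamma\ni X_0$ with $\sup_{X\in\Gamma}\langle X\rangle^N|V_\psi u(X)|<\infty$ for every $N\ge0$; and $X_0\notin WF^s_G(u)$ if there is an open cone $\Gamma\ni X_0$ with $\chi_\Gamma\langle\cdot\rangle^sV_\psi u\in L^2(\mathbb R^{2n})$, where $\chi_\Gamma$ is the characteristic function of $\Gamma$. Both are subsets of $\dot{\mathbb R}^{2n}$. Theorem. For every window $\psi\in\mathscr S(\mathbb R^n)\setminus\{0\}$ and every $u\in\mathscr S'(\mathbb R^n)$, $$WF^s_{\mathrm{iso}}(u)=WF^s_G(u)\quad\text{for all }s\in\mathbb R,\qquad\text{and}\qquad WF_G(u)=WF_{\mathrm{iso}}(u).$$ -/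

import Mathlib

open MeasureTheory
open scoped SchwartzMap ContDiff

noncomputable section

namespace IsoGabor

/-- The configuration space `ℝⁿ` with its Euclidean norm. -/
abbrev Cfg (n : ℕ) : Type := EuclideanSpace ℝ (Fin n)

/-- The phase space `ℝ²ⁿ = ℝⁿ × ℝⁿ`, with points `X = (x, ξ)`, product topology and Lebesgue measure.
The built-in norm of the product is the sup norm, so the Euclidean length is `euclNorm` below. -/
abbrev Phase (n : ℕ) : Type := Cfg n × Cfg n

variable {n : ℕ}

/-- The Euclidean length `|X|` of a phase space point. -/
def euclNorm (X : Phase n) : ℝ := Real.sqrt (‖X.1‖ ^ 2 + ‖X.2‖ ^ 2)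

/-- The Japanese bracket `⟨X⟩ = (1 + |X|²)^{1/2}`. -/
def bracket (X : Phase n) : ℝ := Real.sqrt (1 + ‖X.1‖ ^ 2 + ‖X.2‖ ^ 2)

/-- `Γ` is an open cone in the punctured phase space. -/
structure IsOpenCone (Γ : Set (Phase n)) : Prop where
  isOpen : IsOpen Γ
  zero_notMem : (0 : Phase n) ∉ Γ
  smul_mem : ∀ X ∈ Γ, ∀ t : ℝ, 0 < t → t • X ∈ Γ

/-! ### Shubin symbols and Weyl quantization -/

/-- Shubin symbols of order `m`: smooth functions all of whose derivatives of order `k` are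
`O(⟨X⟩^{m-k})`. -/
structure IsShubinSymbol (m : ℝ) (a : Phase n → ℂ) : Prop where
  contDiff : ContDiff ℝ ∞ a
  bound : ∀ k : ℕ, ∃ C : ℝ, ∀ X : Phase n,
    ‖iteratedFDeriv ℝ k a X‖ ≤ C * bracket X ^ (m - k)

/-- The Weyl quantization formula on Schwartz functions,
`(2π)⁻ⁿ ∫∫ e^{i⟨x-y,ξ⟩} a((x+y)/2, ξ) φ(y) dy dξ`.
It is an oscillatory integral, read as the iterated integral in which `y` is integrated first; for a
Shubin symbol `a` both integrals then converge absolutely, since integration by parts in `y` makes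
the inner integral rapidly decreasing in `ξ`. -/
def weylFormula (a : Phase n → ℂ) (φ : 𝓢(Cfg n, ℂ)) (x : Cfg n) : ℂ :=
  (((2 * Real.pi) ^ n)⁻¹ : ℝ) *
    ∫ ξ : Cfg n, ∫ y : Cfg n,
      Complex.exp (Complex.I * (inner ℝ (x - y) ξ : ℝ)) *
        a ((2⁻¹ : ℝ) • (x + y), ξ) * φ y

/-- The symbol `(x, ξ) ↦ a(x, -ξ)` of the transpose of the Weyl operator with symbol `a`:
`∫ (Opʷ(a) φ) χ = ∫ φ (Opʷ(aᵗ) χ)` for Schwartz functions `φ, χ`. -/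
def transposeSymbol (a : Phase n → ℂ) : Phase n → ℂ := fun X => a (X.1, -X.2)

/-- `A = Opʷ(a)` as an operator on `𝓢'(ℝⁿ)`, that is, `A` is the extension by duality of the Weyl
quantization formula: `⟨A u, φ⟩ = ⟨u, Opʷ(aᵗ) φ⟩` for all tempered distributions `u` and all Schwartz
functions `φ`, the function `Opʷ(aᵗ) φ` being Schwartz. -/
def IsWeylQuantization (a : Phase n → ℂ) (A : 𝓢'(Cfg n, ℂ) →L[ℂ] 𝓢'(Cfg n, ℂ)) : Prop :=
  ∀ φ : 𝓢(Cfg n, ℂ), ∃ χ : 𝓢(Cfg n, ℂ),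
    (∀ x, χ x = weylFormula (transposeSymbol a) φ x) ∧ ∀ u : 𝓢'(Cfg n, ℂ), A u φ = u χ

/-- The class `Ψᵐ_iso(ℝⁿ)` of Weyl quantizations of Shubin symbols of order `m`. -/
def Psi (n : ℕ) (m : ℝ) : Set (𝓢'(Cfg n, ℂ) →L[ℂ] 𝓢'(Cfg n, ℂ)) :=
  {A | ∃ a : Phase n → ℂ, IsShubinSymbol m a ∧ IsWeylQuantization a A}

/-- `A ∈ Ψᵐ_iso` is elliptic at `X₀`: its Weyl symbol satisfies `|a(X)| ≥ c|X|ᵐ` for large `X` in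
some open cone containing `X₀`. -/
def IsEllipticAt (m : ℝ) (A : 𝓢'(Cfg n, ℂ) →L[ℂ] 𝓢'(Cfg n, ℂ)) (X₀ : Phase n) : Prop :=
  ∃ a : Phase n → ℂ, IsShubinSymbol m a ∧ IsWeylQuantization a A ∧
    ∃ Γ : Set (Phase n), IsOpenCone Γ ∧ X₀ ∈ Γ ∧ ∃ c C : ℝ, 0 < c ∧ 0 < C ∧
      ∀ X ∈ Γ, C ≤ euclNorm X → c * euclNorm X ^ m ≤ ‖a X‖

/-- The characteristic set of `A ∈ Ψᵐ_iso`. -/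
def CharIso (m : ℝ) (A : 𝓢'(Cfg n, ℂ) →L[ℂ] 𝓢'(Cfg n, ℂ)) : Set (Phase n) :=
  {X₀ | X₀ ≠ 0 ∧ ¬ IsEllipticAt m A X₀}

/-! ### Shubin–Sobolev spaces and isotropic wave front sets -/

/-- The tempered distribution `u` is (given by) an `L²` function. -/
def IsL2 (u : 𝓢'(Cfg n, ℂ)) : Prop :=
  ∃ f : Cfg n → ℂ, MemLp f 2 volume ∧ ∀ φ : 𝓢(Cfg n, ℂ), u φ = ∫ x, f x * φ x

/-- The tempered distribution `u` is (given by) a Schwartz function. -/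
def IsSchwartz (u : 𝓢'(Cfg n, ℂ)) : Prop :=
  ∃ f : 𝓢(Cfg n, ℂ), ∀ φ : 𝓢(Cfg n, ℂ), u φ = ∫ x, f x * φ x

/-- The Shubin–Sobolev space `Bˢ(ℝⁿ) = {u ∈ 𝓢' : Λˢ u ∈ L²}`, where `Λˢ = Opʷ(⟨X⟩ˢ)`. -/
def ShubinSobolev (n : ℕ) (s : ℝ) : Set (𝓢'(Cfg n, ℂ)) :=
  {u | ∃ Λ : 𝓢'(Cfg n, ℂ) →L[ℂ] 𝓢'(Cfg n, ℂ),
    IsWeylQuantization (fun X => ((bracket X ^ s : ℝ) : ℂ)) Λ ∧ IsL2 (Λ u)}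

/-- The isotropic wave front set `WF_iso(u)`. -/
def WFiso (u : 𝓢'(Cfg n, ℂ)) : Set (Phase n) :=
  ⋂ A ∈ {A | A ∈ Psi n 0 ∧ IsSchwartz (A u)}, CharIso 0 A

/-- The isotropic wave front set `WFˢ_iso(u)` of order `s`. -/
def WFisoOrder (s : ℝ) (u : 𝓢'(Cfg n, ℂ)) : Set (Phase n) :=
  ⋂ A ∈ {A | A ∈ Psi n 0 ∧ A u ∈ ShubinSobolev n s}, CharIso 0 A

/-! ### Short-time Fourier transform and Gabor wave front sets -/

/-- The character `t ↦ e^{i⟨t,ξ⟩}`. -/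
def character (ξ : Cfg n) : Cfg n → ℂ := fun t => Complex.exp (Complex.I * (inner ℝ t ξ : ℝ))

/-- The time-frequency shift `Π(x, ξ) = M_ξ T_x` on Schwartz functions. -/
def timeFreqShift (X : Phase n) (ψ : 𝓢(Cfg n, ℂ)) : 𝓢(Cfg n, ℂ) :=
  SchwartzMap.smulLeftCLM ℂ (character X.2) (SchwartzMap.compSubConstCLM ℂ X.1 ψ)

/-- Complex conjugation on Schwartz functions. -/
def conjSchwartz (ψ : 𝓢(Cfg n, ℂ)) : 𝓢(Cfg n, ℂ) :=
  SchwartzMap.postcompCLM (𝕜 := ℝ) (Complex.conjCLE : ℂ →L[ℝ] ℂ) ψ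

theorem character_hasTemperateGrowth (ξ : Cfg n) : (character ξ).HasTemperateGrowth := by
  have hd : ∀ k : ℕ, iteratedDeriv k (fun r : ℝ => Complex.exp (Complex.I * (r : ℂ))) =
      fun r : ℝ => Complex.I ^ k * Complex.exp (Complex.I * (r : ℂ)) := by
    intro k
    induction k with
    | zero => simp
    | succ k ih =>
      rw [iteratedDeriv_succ, ih]
      funext r
      have h1 : HasDerivAt (fun r : ℝ => Complex.I * (r : ℂ)) Complex.I r := by
        simpa using (Complex.ofRealCLM.hasDerivAt (x := r)).const_mul Complex.I
      rw [(h1.cexp.const_mul (Complex.I ^ k)).deriv]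
      ring
  have he : (fun r : ℝ => Complex.exp (Complex.I * (r : ℂ))).HasTemperateGrowth := by
    refine ⟨(contDiff_const.mul Complex.ofRealCLM.contDiff).cexp, fun k => ⟨0, 1, fun r => ?_⟩⟩
    rw [norm_iteratedFDeriv_eq_norm_iteratedDeriv, hd]
    simp [mul_comm Complex.I, Complex.norm_exp_ofReal_mul_I]
  exact he.comp (Function.hasTemperateGrowth_inner_left ξ)

theorem timeFreqShift_apply (X : Phase n) (ψ : 𝓢(Cfg n, ℂ)) (t : Cfg n) :
    timeFreqShift X ψ t = Complex.exp (Complex.I * (inner ℝ t X.2 : ℝ)) * ψ (t - X.1) := by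
  simp [timeFreqShift, SchwartzMap.smulLeftCLM_apply_apply (character_hasTemperateGrowth X.2),
    character]

theorem conjSchwartz_apply (ψ : 𝓢(Cfg n, ℂ)) (t : Cfg n) :
    conjSchwartz ψ t = starRingEnd ℂ (ψ t) := by
  simp [conjSchwartz]

/-- The short-time Fourier transform `V_ψ u(X) = (u, Π(X)ψ)`, where `(·,·)` is the sesquilinear
pairing (antilinear in the second argument). -/
def stft (ψ : 𝓢(Cfg n, ℂ)) (u : 𝓢'(Cfg n, ℂ)) (X : Phase n) : ℂ :=
  u (conjSchwartz (timeFreqShift X ψ))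

/-- The Gabor wave front set `WF_G(u)`, computed with the window `ψ`. -/
def WFG (ψ : 𝓢(Cfg n, ℂ)) (u : 𝓢'(Cfg n, ℂ)) : Set (Phase n) :=
  {X₀ | X₀ ≠ 0 ∧ ¬ ∃ Γ : Set (Phase n), IsOpenCone Γ ∧ X₀ ∈ Γ ∧
    ∀ N : ℕ, ∃ C : ℝ, ∀ X ∈ Γ, bracket X ^ N * ‖stft ψ u X‖ ≤ C}

/-- The Sobolev–Gabor wave front set `WFˢ_G(u)` of order `s`, computed with the window `ψ`. -/
def WFGOrder (s : ℝ) (ψ : 𝓢(Cfg n, ℂ)) (u : 𝓢'(Cfg n, ℂ)) : Set (Phase n) :=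
  {X₀ | X₀ ≠ 0 ∧ ¬ ∃ Γ : Set (Phase n), IsOpenCone Γ ∧ X₀ ∈ Γ ∧
    MemLp (Γ.indicator fun X => ((bracket X ^ s : ℝ) : ℂ) * stft ψ u X) 2 volume}

end IsoGabor

end

open MeasureTheory
open scoped SchwartzMap ContDiff ComplexConjugate ENNReal Topology

noncomputable section

namespace IsoGabor

variable {n : ℕ} {ι : Type*}

/-! ### The Japanese bracket -/

/-! Both kinds of wave front set are reduced to one quantity: weighted square integrability `SqInt s
Ω (stftNorm ψ u)`, that is, ⟨X⟩ˢ V_ψ u ∈ L² on a subset Ω of phase space. No symbolic calculus and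
no parametrix is needed; everything rests on covariance, Op(a)* acting on Π(X)ψ being Π(X) applied
to the quantization of the translated symbol conj a(X + ·). Hence V_ψ(Au)(X) = V_ρ u(X) with the
window ρ = Op(conj a(X + ·))ψ depending on X (`stft_weyl`).

Two facts make this useful. Weyl operators with symbols in a bounded family `SymFam` map bounded
families of Schwartz functions to bounded families (`exists_schwartz_weylFormula`), and a change of
window within a bounded family costs only an average against ⟨X - Y⟩⁻ᴺ (`enorm_stft_le_avg`, from
the reproducing formula `integral_stft_mul_pairShift`). Three normalizations of the translated
symbol are bounded families. Since ⟨X⟩⁻ᵐ a(X + ·) is one, |V_ψ(Au)| ≤ C⟨X⟩ᵐ avg|V_ψ u|. Since a(X +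
·) - a(X) is of size ⟨X⟩ᵐ⁻¹, |a(X)||V_ψ u| ≤ |V_ψ(Au)| + C⟨X⟩ᵐ⁻¹ avg|V_ψ u|, which is elliptic
regularity with a gain of one order. If a has order zero and vanishes in balls of radius ε⟨X⟩ about
the points X of a set, V_ψ(Au) decays rapidly there relative to the average.

Averages preserve weighted square integrability when one passes to a set that is `Separated` from
the complement of the original one, for instance a narrower cone: the far contribution is negligible
because V_ψ u grows only polynomially. As every tempered u has some initial order t, the gain of one
order can be iterated until any prescribed order is reached.

Applied to the globally elliptic symbol ⟨X⟩ˢ, together with Moyal's identity, this identifies Bˢ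
with ⟨·⟩ˢ V_ψ u ∈ L² (`mem_shubinSobolev_iff`); Schwartz functions correspond to all orders s at
once (`isSchwartz_iff`). Applied in cones, it shows that if Au is regular and A is elliptic at X₀,
then V_ψ u is regular in a cone about X₀. Conversely, a conic cutoff symbol supported where V_ψ u is
regular yields an elliptic A with Au globally regular (`exists_elliptic_sqInt_iff`). This
equivalence is proved for an arbitrary set of orders, so that {s} gives the Sobolev statement and
all of ℝ the smooth one; in the latter case `exists_rapidDecay_iff` turns square integrability of
all orders into uniform rapid decay in a smaller cone. -/

theorem one_le_bracket (X : Phase n) : 1 ≤ bracket X :=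
  Real.one_le_sqrt.2 (by nlinarith [sq_nonneg ‖X.1‖, sq_nonneg ‖X.2‖])

theorem bracket_pos (X : Phase n) : 0 < bracket X := zero_lt_one.trans_le (one_le_bracket X)

theorem bracket_sq (X : Phase n) : bracket X ^ 2 = 1 + ‖X.1‖ ^ 2 + ‖X.2‖ ^ 2 :=
  Real.sq_sqrt (by positivity)

theorem continuous_bracket : Continuous (bracket : Phase n → ℝ) := by
  unfold bracket; fun_prop

theorem continuous_bracket_rpow (s : ℝ) : Continuous fun X : Phase n => bracket X ^ s :=
  continuous_bracket.rpow_const fun X => Or.inl (bracket_pos X).ne'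

@[simp] theorem bracket_neg (X : Phase n) : bracket (-X) = bracket X := by
  simp [bracket]

theorem bracket_sub_comm (X Y : Phase n) : bracket (X - Y) = bracket (Y - X) := by
  rw [← neg_sub, bracket_neg]

theorem norm_le_bracket (X : Phase n) : ‖X‖ ≤ bracket X := by
  refine max_le ?_ ?_ <;> refine Real.le_sqrt_of_sq_le ?_ <;>
    nlinarith [sq_nonneg ‖X.1‖, sq_nonneg ‖X.2‖]

theorem norm_fst_le_bracket (X : Phase n) : ‖X.1‖ ≤ bracket X :=
  (le_max_left _ _).trans (norm_le_bracket X)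

theorem norm_snd_le_bracket (X : Phase n) : ‖X.2‖ ≤ bracket X :=
  (le_max_right _ _).trans (norm_le_bracket X)

theorem bracket_le_mul (X : Phase n) : bracket X ≤ (1 + ‖X.1‖) * (1 + ‖X.2‖) := by
  refine Real.sqrt_le_iff.2 ⟨by positivity, ?_⟩
  have h1 := norm_nonneg X.1
  have h2 := norm_nonneg X.2
  nlinarith [mul_nonneg h1 h2, mul_nonneg (mul_nonneg h1 h2) h1, mul_nonneg (mul_nonneg h1 h2) h2,
    mul_nonneg (mul_nonneg h1 h2) (mul_nonneg h1 h2)]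

/-- Peetre's inequality. -/
theorem bracket_add_le (X Y : Phase n) : bracket (X + Y) ≤ 2 * bracket X * bracket Y := by
  have hX := bracket_pos X
  have hY := bracket_pos Y
  refine Real.sqrt_le_iff.2 ⟨by positivity, ?_⟩
  have e : (2 * bracket X * bracket Y) ^ 2 = 4 * bracket X ^ 2 * bracket Y ^ 2 := by ring
  rw [e, bracket_sq, bracket_sq]
  have a1 : ‖(X + Y).1‖ ≤ ‖X.1‖ + ‖Y.1‖ := norm_add_le _ _
  have a2 : ‖(X + Y).2‖ ≤ ‖X.2‖ + ‖Y.2‖ := norm_add_le _ _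
  have b1 : ‖(X + Y).1‖ ^ 2 ≤ 2 * ‖X.1‖ ^ 2 + 2 * ‖Y.1‖ ^ 2 := by
    nlinarith [norm_nonneg (X + Y).1, sq_nonneg (‖X.1‖ - ‖Y.1‖)]
  have b2 : ‖(X + Y).2‖ ^ 2 ≤ 2 * ‖X.2‖ ^ 2 + 2 * ‖Y.2‖ ^ 2 := by
    nlinarith [norm_nonneg (X + Y).2, sq_nonneg (‖X.2‖ - ‖Y.2‖)]
  have c1 := mul_nonneg (sq_nonneg ‖X.1‖) (sq_nonneg ‖Y.1‖)
  have c2 := mul_nonneg (sq_nonneg ‖X.1‖) (sq_nonneg ‖Y.2‖)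
  have c3 := mul_nonneg (sq_nonneg ‖X.2‖) (sq_nonneg ‖Y.1‖)
  have c4 := mul_nonneg (sq_nonneg ‖X.2‖) (sq_nonneg ‖Y.2‖)
  nlinarith [sq_nonneg ‖X.1‖, sq_nonneg ‖X.2‖, sq_nonneg ‖Y.1‖, sq_nonneg ‖Y.2‖]

theorem bracket_rpow_add_le (s : ℝ) (X Y : Phase n) :
    bracket (X + Y) ^ s ≤ 2 ^ |s| * bracket X ^ s * bracket Y ^ |s| := by
  have hX := bracket_pos X
  have hY := bracket_pos Y
  have hXY := bracket_pos (X + Y)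
  rcases le_total 0 s with hs | hs
  · rw [abs_of_nonneg hs, ← Real.mul_rpow (by positivity) (by positivity),
      ← Real.mul_rpow (by positivity) (by positivity)]
    exact Real.rpow_le_rpow hXY.le (bracket_add_le X Y) hs
  · rw [abs_of_nonpos hs]
    -- For negative exponents Peetre's inequality is needed in reverse, for X = (X + Y) + (-Y).
    have h : bracket X ≤ 2 * bracket (X + Y) * bracket Y := by
      simpa using bracket_add_le (X + Y) (-Y)
    have h2 := Real.rpow_le_rpow hX.le h (neg_nonneg.2 hs)
    rw [Real.mul_rpow (by positivity) (by positivity),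
      Real.mul_rpow (by positivity) (by positivity)] at h2
    have e1 : bracket X ^ (-s) * bracket X ^ s = 1 := by
      rw [← Real.rpow_add hX]; simp
    have e2 : bracket (X + Y) ^ (-s) * bracket (X + Y) ^ s = 1 := by
      rw [← Real.rpow_add hXY]; simp
    have p1 : 0 < bracket X ^ s := by positivity
    have p2 : 0 < bracket (X + Y) ^ s := by positivity
    calc bracket (X + Y) ^ s
        = (bracket X ^ (-s) * bracket X ^ s) * bracket (X + Y) ^ s := by rw [e1, one_mul]
      _ ≤ (2 ^ (-s) * bracket (X + Y) ^ (-s) * bracket Y ^ (-s) * bracket X ^ s)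
            * bracket (X + Y) ^ s := by gcongr
      _ = 2 ^ (-s) * bracket X ^ s * bracket Y ^ (-s) *
            (bracket (X + Y) ^ (-s) * bracket (X + Y) ^ s) := by ring
      _ = _ := by rw [e2, mul_one]

instance : (volume : Measure (Phase n)).IsAddHaarMeasure :=
  inferInstanceAs (((volume : Measure (Cfg n)).prod (volume : Measure (Cfg n))).IsAddHaarMeasure)

theorem integrable_bracket_rpow_neg {r : ℝ} (hr : (2 * n : ℕ) < r) :
    Integrable (fun X : Phase n => bracket X ^ (-r)) volume := by
  have h0 : 0 ≤ r := (Nat.cast_nonneg _).trans hr.le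
  have h := integrable_one_add_norm (μ := (volume : Measure (Phase n))) (r := r)
    (by simpa [Module.finrank_prod, two_mul] using hr)
  refine (h.const_mul (2 ^ r)).mono' (continuous_bracket_rpow _).aestronglyMeasurable ?_
  refine Filter.Eventually.of_forall fun X => ?_
  have hX := bracket_pos X
  rw [Real.norm_of_nonneg (by positivity), Real.rpow_neg hX.le, Real.rpow_neg (by positivity),
    ← div_eq_mul_inv, inv_eq_one_div, div_le_div_iff₀ (by positivity) (by positivity), one_mul,
    ← Real.mul_rpow (by positivity) (by positivity)]
  refine Real.rpow_le_rpow (by positivity) ?_ h0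
  linarith [norm_le_bracket X, one_le_bracket X]

theorem integrable_one_add_norm_rpow_neg {r : ℕ} (hr : n < r) :
    Integrable (fun x : Cfg n => ((1 + ‖x‖) ^ r)⁻¹) volume := by
  have h := integrable_one_add_norm (μ := (volume : Measure (Cfg n))) (r := r)
    (by simpa using hr)
  refine h.congr (Filter.Eventually.of_forall fun x => ?_)
  simp only
  rw [Real.rpow_neg (by positivity), Real.rpow_natCast]

/-! ### Bounded families of Schwartz functions -/

/-- The family `f` is bounded in the Schwartz space. -/
def SBdd (f : ι → 𝓢(Cfg n, ℂ)) : Prop :=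
  ∀ k l : ℕ, ∃ C : ℝ, ∀ i x, ‖x‖ ^ k * ‖iteratedFDeriv ℝ l (f i) x‖ ≤ C

/-- Links seminorm bounds with the topological notion of boundedness: continuous linear maps then
preserve bounded families, and conversely continuity of Weyl operators can be deduced from their
action on bounded sets. -/
theorem sBdd_iff_isVonNBounded (f : ι → 𝓢(Cfg n, ℂ)) :
    SBdd f ↔ Bornology.IsVonNBounded ℝ (Set.range f) := by
  rw [(schwartz_withSeminorms ℝ (Cfg n) ℂ).isVonNBounded_iff_seminorm_bounded]
  constructor
  · rintro h ⟨k, l⟩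
    obtain ⟨C, hC⟩ := h k l
    refine ⟨max C 0 + 1, by positivity, ?_⟩
    rintro _ ⟨i, rfl⟩
    refine lt_of_le_of_lt (SchwartzMap.seminorm_le_bound ℝ k l (f i) (M := max C 0)
      (le_max_right _ _) fun x => (hC i x).trans (le_max_left _ _)) (lt_add_one _)
  · intro h k l
    obtain ⟨r, -, hr⟩ := h (k, l)
    exact ⟨r, fun i x => (SchwartzMap.le_seminorm ℝ k l (f i) x).trans (hr _ ⟨i, rfl⟩).le⟩

theorem SBdd.comp_clm {f : ι → 𝓢(Cfg n, ℂ)} (hf : SBdd f)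
    (T : 𝓢(Cfg n, ℂ) →L[ℝ] 𝓢(Cfg n, ℂ)) : SBdd fun i => T (f i) := by
  rw [sBdd_iff_isVonNBounded] at hf ⊢
  have := hf.image T
  rwa [← Set.range_comp] at this

theorem sBdd_const (φ : 𝓢(Cfg n, ℂ)) : SBdd fun _ : ι => φ := fun k l =>
  ⟨SchwartzMap.seminorm ℝ k l φ, fun _ x => SchwartzMap.le_seminorm ℝ k l φ x⟩

theorem one_add_pow_le (k : ℕ) {r : ℝ} (hr : 0 ≤ r) : (1 + r) ^ k ≤ 2 ^ k * (1 + r ^ k) := by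
  rcases le_total r 1 with h | h
  · calc (1 + r) ^ k ≤ 2 ^ k := by gcongr; linarith
      _ ≤ 2 ^ k * (1 + r ^ k) := le_mul_of_one_le_right (by positivity)
          (by linarith [pow_nonneg hr k])
  · calc (1 + r) ^ k ≤ (2 * r) ^ k := by gcongr; linarith
      _ = 2 ^ k * r ^ k := mul_pow _ _ _
      _ ≤ 2 ^ k * (1 + r ^ k) := by gcongr; linarith

theorem SBdd.one_add_norm {f : ι → 𝓢(Cfg n, ℂ)} (hf : SBdd f) (k l : ℕ) :
    ∃ C : ℝ, 0 ≤ C ∧ ∀ i x, ‖iteratedFDeriv ℝ l (f i) x‖ ≤ C * ((1 + ‖x‖) ^ k)⁻¹ := by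
  obtain ⟨C0, h0⟩ := hf 0 l
  obtain ⟨C1, h1⟩ := hf k l
  refine ⟨max (2 ^ k * (C0 + C1)) 0, le_max_right _ _, fun i x => ?_⟩
  rw [← div_eq_mul_inv, le_div_iff₀ (by positivity)]
  refine le_trans ?_ (le_max_left _ _)
  calc ‖iteratedFDeriv ℝ l (f i) x‖ * (1 + ‖x‖) ^ k
      ≤ ‖iteratedFDeriv ℝ l (f i) x‖ * (2 ^ k * (1 + ‖x‖ ^ k)) := by
        gcongr; exact one_add_pow_le k (norm_nonneg x)
    _ = 2 ^ k * (‖x‖ ^ 0 * ‖iteratedFDeriv ℝ l (f i) x‖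
          + ‖x‖ ^ k * ‖iteratedFDeriv ℝ l (f i) x‖) := by ring
    _ ≤ 2 ^ k * (C0 + C1) := by gcongr; exacts [h0 i x, h1 i x]

theorem SBdd.comp {κ : Type*} {f : ι → 𝓢(Cfg n, ℂ)} (hf : SBdd f) (g : κ → ι) :
    SBdd fun j => f (g j) := fun k l => by
  obtain ⟨C, hC⟩ := hf k l
  exact ⟨C, fun j x => hC (g j) x⟩

/-! ### Bounded families of symbols -/

/-- A family of smooth functions on phase space whose derivatives are all `O(⟨X⟩ᴹ)`, uniformly. -/
structure SymFam (M : ℕ) (a : ι → Phase n → ℂ) : Prop where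
  contDiff : ∀ i, ContDiff ℝ ∞ (a i)
  bound : ∀ k : ℕ, ∃ C : ℝ, ∀ i X, ‖iteratedFDeriv ℝ k (a i) X‖ ≤ C * bracket X ^ M

theorem SymFam.bound_nonneg {M : ℕ} {a : ι → Phase n → ℂ} (h : SymFam M a) (k : ℕ) :
    ∃ C : ℝ, 0 ≤ C ∧ ∀ i X, ‖iteratedFDeriv ℝ k (a i) X‖ ≤ C * bracket X ^ M := by
  obtain ⟨C, hC⟩ := h.bound k
  refine ⟨max C 0, le_max_right _ _, fun i X => (hC i X).trans ?_⟩
  have := bracket_pos X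
  gcongr
  exact le_max_left _ _

/-- A uniform bound for all derivatives up to order `k`. -/
theorem SymFam.bound_le {M : ℕ} {a : ι → Phase n → ℂ} (h : SymFam M a) (k : ℕ) :
    ∃ C : ℝ, 0 ≤ C ∧ ∀ j ≤ k, ∀ i X, ‖iteratedFDeriv ℝ j (a i) X‖ ≤ C * bracket X ^ M := by
  choose C hC0 hC using h.bound_nonneg
  refine ⟨∑ j ∈ Finset.range (k + 1), C j, Finset.sum_nonneg fun j _ => hC0 j,
    fun j hj i X => (hC j i X).trans ?_⟩
  have := bracket_pos X
  gcongr
  exact Finset.single_le_sum (fun j _ => hC0 j) (Finset.mem_range.2 (by omega))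

theorem SBdd.bound_le {f : ι → 𝓢(Cfg n, ℂ)} (hf : SBdd f) (k l : ℕ) :
    ∃ C : ℝ, 0 ≤ C ∧ ∀ j ≤ l, ∀ i x,
      ‖iteratedFDeriv ℝ j (f i) x‖ ≤ C * ((1 + ‖x‖) ^ k)⁻¹ := by
  choose C hC0 hC using hf.one_add_norm k
  refine ⟨∑ j ∈ Finset.range (l + 1), C j, Finset.sum_nonneg fun j _ => hC0 j,
    fun j hj i X => (hC j i X).trans ?_⟩
  gcongr
  exact Finset.single_le_sum (fun j _ => hC0 j) (Finset.mem_range.2 (by omega))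

theorem SymFam.add {M : ℕ} {a b : ι → Phase n → ℂ} (ha : SymFam M a) (hb : SymFam M b) :
    SymFam M fun i X => a i X + b i X := by
  refine ⟨fun i => (ha.contDiff i).add (hb.contDiff i), fun k => ?_⟩
  obtain ⟨C, hC⟩ := ha.bound k
  obtain ⟨D, hD⟩ := hb.bound k
  refine ⟨C + D, fun i X => ?_⟩
  have e : iteratedFDeriv ℝ k (fun X => a i X + b i X) X
      = iteratedFDeriv ℝ k (a i) X + iteratedFDeriv ℝ k (b i) X :=
    iteratedFDeriv_add_apply ((ha.contDiff i).contDiffAt.of_le (by exact_mod_cast le_top))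
      ((hb.contDiff i).contDiffAt.of_le (by exact_mod_cast le_top))
  rw [e, add_mul]
  exact (norm_add_le _ _).trans (add_le_add (hC i X) (hD i X))

theorem SymFam.mono {M N : ℕ} (hMN : M ≤ N) {a : ι → Phase n → ℂ} (ha : SymFam M a) :
    SymFam N a := by
  refine ⟨ha.contDiff, fun k => ?_⟩
  obtain ⟨C, hC0, hC⟩ := ha.bound_nonneg k
  refine ⟨C, fun i X => (hC i X).trans ?_⟩
  gcongr
  exact one_le_bracket X

theorem SymFam.mul {M N : ℕ} {a b : ι → Phase n → ℂ} (ha : SymFam M a) (hb : SymFam N b) :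
    SymFam (M + N) fun i X => a i X * b i X := by
  refine ⟨fun i => (ha.contDiff i).mul (hb.contDiff i), fun k => ?_⟩
  obtain ⟨C, hC0, hC⟩ := ha.bound_le k
  obtain ⟨D, hD0, hD⟩ := hb.bound_le k
  refine ⟨∑ j ∈ Finset.range (k + 1), (k.choose j : ℝ) * C * D, fun i X => ?_⟩
  refine (norm_iteratedFDeriv_mul_le (ha.contDiff i) (hb.contDiff i) X (n := k)
    (by exact_mod_cast le_top)).trans ?_
  rw [Finset.sum_mul]
  refine Finset.sum_le_sum fun j hj => ?_
  have h1 := hC j (by simp at hj; omega) i X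
  have h2 := hD (k - j) (by omega) i X
  have := bracket_pos X
  calc _ ≤ (k.choose j : ℝ) * (C * bracket X ^ M) * (D * bracket X ^ N) := by gcongr
    _ = _ := by rw [pow_add]; ring

/-- The derivative of a family of symbols in a fixed direction. -/
theorem SymFam.fderiv_apply {M : ℕ} {a : ι → Phase n → ℂ} (ha : SymFam M a) (V : Phase n) :
    SymFam M fun i X => fderiv ℝ (a i) X V := by
  have hd : ∀ i, ContDiff ℝ ∞ (fderiv ℝ (a i)) := fun i =>
    (ha.contDiff i).fderiv_right (by simp)
  refine ⟨fun i => (hd i).clm_apply contDiff_const, fun k => ?_⟩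
  obtain ⟨C, hC⟩ := ha.bound (k + 1)
  refine ⟨‖V‖ * C, fun i X => ?_⟩
  refine (norm_iteratedFDeriv_clm_apply_const (hd i).contDiffAt (n := k)
    (by exact_mod_cast le_top)).trans ?_
  rw [norm_iteratedFDeriv_fderiv, mul_assoc]
  gcongr
  exact hC i X

theorem symFam_const (c : ι → ℂ) {B : ℝ} (hc : ∀ i, ‖c i‖ ≤ B) :
    SymFam 0 fun i (_ : Phase n) => c i := by
  refine ⟨fun i => contDiff_const, fun k => ⟨max B 0, fun i X => ?_⟩⟩
  rcases Nat.eq_zero_or_pos k with rfl | hk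
  · simpa using Or.inl (hc i)
  · rw [iteratedFDeriv_const_of_ne hk.ne']; simp

theorem symFam_clm (L : Phase n →L[ℝ] ℂ) : SymFam 1 fun (_ : ι) X => L X := by
  refine ⟨fun i => L.contDiff, fun k => ⟨‖L‖, fun i X => ?_⟩⟩
  have h1 := one_le_bracket X
  rcases k with _ | _ | k
  · rw [norm_iteratedFDeriv_zero, pow_one]
    exact (L.le_opNorm X).trans (by gcongr; exact norm_le_bracket X)
  · have : ‖iteratedFDeriv ℝ (0 + 1) (fun X => L X) X‖ = ‖L‖ := by
      rw [← norm_iteratedFDeriv_fderiv, norm_iteratedFDeriv_zero]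
      simp
    rw [this, pow_one]
    exact le_mul_of_one_le_right (norm_nonneg _) h1
  · have h : fderiv ℝ (fun X => L X) = fun _ => L := by ext1 Y; simp
    rw [← norm_iteratedFDeriv_fderiv, h, iteratedFDeriv_const_of_ne (by omega)]
    simp only [Pi.zero_apply, norm_zero]
    positivity

theorem SymFam.const_mul {M : ℕ} {a : ι → Phase n → ℂ} (ha : SymFam M a) (c : ℂ) :
    SymFam M fun i X => c * a i X := by
  simpa using (symFam_const (ι := ι) (fun _ => c) (fun _ => le_rfl)).mul ha

/-! ### Weyl quantization on Schwartz functions -/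

/-- The inner integral of the Weyl quantization formula. -/
def weylInner (a : Phase n → ℂ) (φ : 𝓢(Cfg n, ℂ)) (x ξ : Cfg n) : ℂ :=
  ∫ y : Cfg n, Complex.exp (Complex.I * (inner ℝ (x - y) ξ : ℝ)) *
    a ((2⁻¹ : ℝ) • (x + y), ξ) * φ y

/-- The Weyl quantization formula without its normalizing factor. -/
def weylOuter (a : Phase n → ℂ) (φ : 𝓢(Cfg n, ℂ)) (x : Cfg n) : ℂ :=
  ∫ ξ : Cfg n, weylInner a φ x ξ

theorem weylFormula_eq (a : Phase n → ℂ) (φ : 𝓢(Cfg n, ℂ)) (x : Cfg n) :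
    weylFormula a φ x = (((2 * Real.pi) ^ n)⁻¹ : ℝ) * weylOuter a φ x := rfl

theorem norm_cexp_I_mul (r : ℝ) : ‖Complex.exp (Complex.I * (r : ℂ))‖ = 1 := by
  rw [mul_comm, Complex.norm_exp_ofReal_mul_I]

theorem bracket_half_add_le (x y ξ : Cfg n) :
    bracket ((2⁻¹ : ℝ) • (x + y), ξ) ≤ (1 + ‖x‖) * (1 + ‖ξ‖) * (1 + ‖y‖) := by
  refine (bracket_le_mul _).trans ?_
  have h : ‖(2⁻¹ : ℝ) • (x + y)‖ ≤ ‖x‖ + ‖y‖ := by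
    rw [norm_smul, Real.norm_of_nonneg (by norm_num)]
    linarith [norm_add_le x y, norm_nonneg (x + y)]
  have hx := norm_nonneg x
  have hy := norm_nonneg y
  calc (1 + ‖(2⁻¹ : ℝ) • (x + y)‖) * (1 + ‖ξ‖) ≤ ((1 + ‖x‖) * (1 + ‖y‖)) * (1 + ‖ξ‖) := by
        gcongr; nlinarith [mul_nonneg hx hy]
    _ = _ := by ring

/-! ### Decay of the inner Weyl integral in the frequency variable -/

theorem norm_iteratedFDeriv_comp_half_add (b : Phase n → ℂ) (hb : ContDiff ℝ ∞ b) (k : ℕ)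
    (x ξ y : Cfg n) :
    ‖iteratedFDeriv ℝ k (fun y => b ((2⁻¹ : ℝ) • (x + y), ξ)) y‖ ≤
      ‖iteratedFDeriv ℝ k b ((2⁻¹ : ℝ) • (x + y), ξ)‖ := by
  let L : Cfg n →L[ℝ] Phase n :=
    ((2⁻¹ : ℝ) • ContinuousLinearMap.id ℝ (Cfg n)).prod (0 : Cfg n →L[ℝ] Cfg n)
  have hL : ‖L‖ ≤ 1 := by
    refine ContinuousLinearMap.opNorm_le_bound _ zero_le_one fun v => ?_
    have : ‖L v‖ = 2⁻¹ * ‖v‖ := by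
      simp [L, Prod.norm_def, norm_smul]
    rw [this]
    linarith [norm_nonneg v]
  have e : (fun y => b ((2⁻¹ : ℝ) • (x + y), ξ)) =
      (fun Z => b (((2⁻¹ : ℝ) • x, ξ) + Z)) ∘ L := by
    funext y; simp [L, smul_add]
  have hb' : ContDiff ℝ ∞ (fun Z => b (((2⁻¹ : ℝ) • x, ξ) + Z)) :=
    hb.comp (contDiff_const.add contDiff_id)
  rw [e, L.iteratedFDeriv_comp_right hb' y (by exact_mod_cast le_top),
    iteratedFDeriv_comp_add_left]
  refine (ContinuousMultilinearMap.norm_compContinuousLinearMap_le _ _).trans ?_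
  have e2 : ((2⁻¹ : ℝ) • x, ξ) + L y = ((2⁻¹ : ℝ) • (x + y), ξ) := by simp [L, smul_add]
  rw [e2]
  refine mul_le_of_le_one_right (norm_nonneg _) ?_
  exact Finset.prod_le_one (fun _ _ => norm_nonneg _) fun _ _ => hL

/-- Leibniz' rule. The decay of `φ i` is used at order `M + K`: `M` powers absorb the growth of the
symbol in y, and `K` remain. -/
theorem norm_iteratedFDeriv_amplitude {M : ℕ} {a : ι → Phase n → ℂ} (ha : SymFam M a)
    {φ : ι → 𝓢(Cfg n, ℂ)} (hφ : SBdd φ) (K k : ℕ) :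
    ∃ C : ℝ, 0 ≤ C ∧ ∀ j ≤ k, ∀ i x ξ y,
      ‖iteratedFDeriv ℝ j (fun y => a i ((2⁻¹ : ℝ) • (x + y), ξ) * φ i y) y‖ ≤
        C * ((1 + ‖x‖) * (1 + ‖ξ‖)) ^ M * ((1 + ‖y‖) ^ K)⁻¹ := by
  obtain ⟨C, hC0, hC⟩ := ha.bound_le k
  obtain ⟨D, hD0, hD⟩ := hφ.bound_le (M + K) k
  refine ⟨∑ l ∈ Finset.range (k + 1), (2 : ℝ) ^ k * (C * D), by positivity, ?_⟩
  intro j hj i x ξ y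
  have hs : ContDiff ℝ ∞ (fun y => a i ((2⁻¹ : ℝ) • (x + y), ξ)) :=
    (ha.contDiff i).comp (by fun_prop)
  refine (norm_iteratedFDeriv_mul_le hs ((φ i).smooth ⊤) y (n := j)
    (by exact_mod_cast le_top)).trans ?_
  have hx := norm_nonneg x
  have hy := norm_nonneg y
  have hξ := norm_nonneg ξ
  calc _ ≤ ∑ l ∈ Finset.range (j + 1), (2 : ℝ) ^ k * (C * D) *
        (((1 + ‖x‖) * (1 + ‖ξ‖)) ^ M * ((1 + ‖y‖) ^ K)⁻¹) := by
        refine Finset.sum_le_sum fun l hl => ?_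
        have hl' : l ≤ j := by simp at hl; omega
        have h1 : ‖iteratedFDeriv ℝ l (fun y => a i ((2⁻¹ : ℝ) • (x + y), ξ)) y‖ ≤
            C * ((1 + ‖x‖) * (1 + ‖ξ‖) * (1 + ‖y‖)) ^ M := by
          refine (norm_iteratedFDeriv_comp_half_add _ (ha.contDiff i) l x ξ y).trans
            ((hC l (by omega) i _).trans ?_)
          gcongr
          · exact (bracket_pos _).le
          · exact bracket_half_add_le x y ξ
        have h2 := hD (j - l) (by omega) i y
        have h3 : (j.choose l : ℝ) ≤ 2 ^ k := by
          have : j.choose l ≤ 2 ^ k := (Nat.choose_le_two_pow j l).trans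
            (Nat.pow_le_pow_right (by norm_num) hj)
          exact_mod_cast this
        calc _ ≤ (2 : ℝ) ^ k * (C * ((1 + ‖x‖) * (1 + ‖ξ‖) * (1 + ‖y‖)) ^ M) *
              (D * ((1 + ‖y‖) ^ (M + K))⁻¹) := by gcongr
          _ = _ := by
            rw [mul_pow _ (1 + ‖y‖), pow_add]
            field_simp
    _ ≤ ∑ l ∈ Finset.range (k + 1), (2 : ℝ) ^ k * (C * D) *
        (((1 + ‖x‖) * (1 + ‖ξ‖)) ^ M * ((1 + ‖y‖) ^ K)⁻¹) := by
        refine Finset.sum_le_sum_of_subset_of_nonneg (by gcongr) fun _ _ _ => by positivity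
    _ = _ := by rw [← Finset.sum_mul]; ring

theorem weylInner_eq_fourier (a : Phase n → ℂ) (φ : 𝓢(Cfg n, ℂ)) (x ξ : Cfg n) :
    weylInner a φ x ξ = Complex.exp (Complex.I * (inner ℝ x ξ : ℝ)) *
      FourierTransform.fourier (fun y => a ((2⁻¹ : ℝ) • (x + y), ξ) * φ y)
        ((2 * Real.pi)⁻¹ • ξ) := by
  rw [Real.fourier_eq, ← integral_const_mul, weylInner]
  refine integral_congr_ae (Filter.Eventually.of_forall fun y => ?_)
  simp only [Circle.smul_def, Real.fourierChar_apply, smul_eq_mul]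
  rw [mul_assoc, ← mul_assoc (Complex.exp _) (Complex.exp _), ← Complex.exp_add]
  congr 2
  rw [inner_sub_left, inner_smul_right]
  have : (Real.pi : ℂ) ≠ 0 := by exact_mod_cast Real.pi_ne_zero
  push_cast
  field_simp
  ring

/-- Up to a unimodular factor the inner integral is the Fourier transform of the amplitude in y, so
the y-derivatives of the amplitude give decay in ξ. This is the integration by parts that makes the
oscillatory integral converge. -/
theorem norm_weylInner_le {M : ℕ} {a : ι → Phase n → ℂ} (ha : SymFam M a)
    {φ : ι → 𝓢(Cfg n, ℂ)} (hφ : SBdd φ) (K : ℕ) :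
    ∃ C : ℝ, 0 ≤ C ∧ ∀ i x ξ,
      ‖weylInner (a i) (φ i) x ξ‖ ≤ C * (1 + ‖x‖) ^ M * ((1 + ‖ξ‖) ^ K)⁻¹ := by
  have key : ∀ k : ℕ, ∃ C : ℝ, 0 ≤ C ∧ ∀ i x ξ,
      ‖ξ‖ ^ k * ‖weylInner (a i) (φ i) x ξ‖ ≤ C * ((1 + ‖x‖) * (1 + ‖ξ‖)) ^ M := by
    intro k
    obtain ⟨C, hC0, hC⟩ := norm_iteratedFDeriv_amplitude ha hφ (n + 1) k
    have hint := integrable_one_add_norm_rpow_neg (n := n) (r := n + 1) (by omega)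
    set S := ∫ y : Cfg n, ((1 + ‖y‖) ^ (n + 1))⁻¹ with hS
    have hS0 : 0 ≤ S := integral_nonneg fun y => by positivity
    refine ⟨(2 * Real.pi) ^ k * (2 ^ k * ∑ p ∈ Finset.range 1 ×ˢ Finset.range (k + 1),
      C * S), by positivity, fun i x ξ => ?_⟩
    set h := fun y => a i ((2⁻¹ : ℝ) • (x + y), ξ) * φ i y with hh
    have hs : ContDiff ℝ ∞ h :=
      ((ha.contDiff i).comp (by fun_prop)).mul ((φ i).smooth ⊤)
    have hI : ∀ m ≤ k, Integrable (fun y => ‖iteratedFDeriv ℝ m h y‖) := fun m hm => by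
      refine (hint.const_mul (C * ((1 + ‖x‖) * (1 + ‖ξ‖)) ^ M)).mono'
        ((hs.continuous_iteratedFDeriv (by exact_mod_cast le_top)).norm.aestronglyMeasurable)
        (Filter.Eventually.of_forall fun y => ?_)
      rw [norm_norm]
      exact hC m hm i x ξ y
    have hb : ∀ m ≤ k, ∫ y, ‖iteratedFDeriv ℝ m h y‖ ≤
        C * S * ((1 + ‖x‖) * (1 + ‖ξ‖)) ^ M := fun m hm => by
      calc ∫ y, ‖iteratedFDeriv ℝ m h y‖
          ≤ ∫ y : Cfg n, C * ((1 + ‖x‖) * (1 + ‖ξ‖)) ^ M * ((1 + ‖y‖) ^ (n + 1))⁻¹ :=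
            integral_mono (hI m hm) (hint.const_mul _) fun y => hC m hm i x ξ y
        _ = _ := by rw [integral_const_mul]; ring
    have hF := Real.pow_mul_norm_iteratedFDeriv_fourier_le (f := h) (K := 0) (N := k)
      (hs.of_le (by exact_mod_cast le_top))
      (fun m l hm hl => by
        have : m = 0 := by simpa using hm
        subst this
        simpa using hI l (by exact_mod_cast hl)) (k := 0) (n := k) (by simp) le_rfl
      ((2 * Real.pi)⁻¹ • ξ)
    rw [weylInner_eq_fourier, norm_mul, norm_cexp_I_mul, one_mul]
    rw [norm_iteratedFDeriv_zero, norm_smul, norm_inv, Real.norm_of_nonneg (by positivity),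
      mul_pow] at hF
    have hpi := Real.pi_pos
    have hF2 : ((2 * Real.pi)⁻¹ ^ k * ‖ξ‖ ^ k) *
        ‖FourierTransform.fourier h ((2 * Real.pi)⁻¹ • ξ)‖ ≤
        2 ^ k * ∑ p ∈ Finset.range 1 ×ˢ Finset.range (k + 1),
          C * S * ((1 + ‖x‖) * (1 + ‖ξ‖)) ^ M := by
      refine hF.trans ?_
      simp only [pow_zero, one_mul, Nat.cast_zero, mul_zero, zero_add]
      gcongr with p hp
      obtain ⟨hp1, hp2⟩ : p.1 = 0 ∧ p.2 ≤ k := by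
        rw [Finset.mem_product, Finset.mem_range, Finset.mem_range] at hp; omega
      simpa [hp1] using hb p.2 hp2
    calc ‖ξ‖ ^ k * ‖FourierTransform.fourier h ((2 * Real.pi)⁻¹ • ξ)‖
        = (2 * Real.pi) ^ k * (((2 * Real.pi)⁻¹ ^ k * ‖ξ‖ ^ k) *
          ‖FourierTransform.fourier h ((2 * Real.pi)⁻¹ • ξ)‖) := by
          rw [inv_pow]; field_simp
      _ ≤ (2 * Real.pi) ^ k * (2 ^ k * ∑ p ∈ Finset.range 1 ×ˢ Finset.range (k + 1),
          C * S * ((1 + ‖x‖) * (1 + ‖ξ‖)) ^ M) := by gcongr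
      _ = _ := by rw [← Finset.sum_mul]; ring
  obtain ⟨C0, hC00, h0⟩ := key 0
  -- `M` of these powers of ξ compensate the growth of the symbol in frequency; `K` remain.
  obtain ⟨C1, hC10, h1⟩ := key (M + K)
  refine ⟨2 ^ (M + K) * (C0 + C1), by positivity, fun i x ξ => ?_⟩
  rw [← div_eq_mul_inv, le_div_iff₀ (by positivity)]
  have hp : 0 < (1 + ‖ξ‖) ^ M := by positivity
  refine le_of_mul_le_mul_left ?_ hp
  calc (1 + ‖ξ‖) ^ M * (‖weylInner (a i) (φ i) x ξ‖ * (1 + ‖ξ‖) ^ K)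
      = (1 + ‖ξ‖) ^ (M + K) * ‖weylInner (a i) (φ i) x ξ‖ := by rw [pow_add]; ring
    _ ≤ 2 ^ (M + K) * (1 + ‖ξ‖ ^ (M + K)) * ‖weylInner (a i) (φ i) x ξ‖ := by
        gcongr; exact one_add_pow_le _ (norm_nonneg _)
    _ = 2 ^ (M + K) * (‖ξ‖ ^ 0 * ‖weylInner (a i) (φ i) x ξ‖ +
          ‖ξ‖ ^ (M + K) * ‖weylInner (a i) (φ i) x ξ‖) := by ring
    _ ≤ 2 ^ (M + K) * (C0 * ((1 + ‖x‖) * (1 + ‖ξ‖)) ^ M +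
          C1 * ((1 + ‖x‖) * (1 + ‖ξ‖)) ^ M) := by
        refine mul_le_mul_of_nonneg_left (add_le_add (h0 i x ξ) (h1 i x ξ)) (by positivity)
    _ = _ := by rw [mul_pow]; ring

/-- Multiplication of a Schwartz function by the linear function `⟨·, w⟩`. -/
def mulInner (w : Cfg n) : 𝓢(Cfg n, ℂ) →L[ℂ] 𝓢(Cfg n, ℂ) :=
  SchwartzMap.smulLeftCLM ℂ fun y => ((inner ℝ y w : ℝ) : ℂ)

theorem mulInner_apply (w : Cfg n) (φ : 𝓢(Cfg n, ℂ)) (y : Cfg n) :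
    mulInner w φ y = (inner ℝ y w : ℝ) * φ y := by
  have h : (fun y : Cfg n => ((inner ℝ y w : ℝ) : ℂ)).HasTemperateGrowth := by
    have := (Complex.ofRealCLM.comp (innerSL ℝ w)).hasTemperateGrowth
    convert this using 2 with y
    simp [real_inner_comm]
  rw [mulInner, SchwartzMap.smulLeftCLM_apply_apply h, smul_eq_mul]

theorem SBdd.mulInner {φ : ι → 𝓢(Cfg n, ℂ)} (hφ : SBdd φ) (w : Cfg n) :
    SBdd fun i => IsoGabor.mulInner w (φ i) :=
  hφ.comp_clm ((IsoGabor.mulInner w).restrictScalars ℝ)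

/-! ### Differentiation of the inner Weyl integral -/

theorem continuous_weylInner_integrand {a : Phase n → ℂ} (ha : Continuous a)
    (φ : 𝓢(Cfg n, ℂ)) :
    Continuous fun p : Phase n × Cfg n =>
      Complex.exp (Complex.I * (inner ℝ (p.1.1 - p.2) p.1.2 : ℝ)) *
        a ((2⁻¹ : ℝ) • (p.1.1 + p.2), p.1.2) * φ p.2 := by
  have := φ.continuous
  fun_prop

theorem integrable_weylInner_integrand {M : ℕ} {a : ι → Phase n → ℂ} (ha : SymFam M a) (i : ι)
    (φ : 𝓢(Cfg n, ℂ)) (x ξ : Cfg n) :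
    Integrable fun y : Cfg n => Complex.exp (Complex.I * (inner ℝ (x - y) ξ : ℝ)) *
        a i ((2⁻¹ : ℝ) • (x + y), ξ) * φ y := by
  obtain ⟨C, hC0, hC⟩ := norm_iteratedFDeriv_amplitude ha (sBdd_const φ) (n + 1) 0
  refine ((integrable_one_add_norm_rpow_neg (n := n) (r := n + 1) (by omega)).const_mul
    (C * ((1 + ‖x‖) * (1 + ‖ξ‖)) ^ M)).mono' ?_ (Filter.Eventually.of_forall fun y => ?_)
  · exact ((continuous_weylInner_integrand (ha.contDiff i).continuous φ).comp
      (Continuous.prodMk_right (x, ξ))).aestronglyMeasurable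
  · have := hC 0 le_rfl i x ξ y
    rw [norm_iteratedFDeriv_zero] at this
    rwa [mul_assoc (Complex.exp _), norm_mul, norm_cexp_I_mul, one_mul]

/-- The symbol which arises from `a` by differentiating the Weyl formula in the direction `V`. -/
def weylDerivSymbol (V : Phase n) (a : Phase n → ℂ) : Phase n → ℂ := fun Z =>
  Complex.I * (inner ℝ V.1 Z.2 : ℝ) * a Z + fderiv ℝ a Z ((2⁻¹ : ℝ) • V.1, V.2)

theorem SymFam.weylDerivSymbol {M : ℕ} {a : ι → Phase n → ℂ} (ha : SymFam M a) (V : Phase n) :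
    SymFam (1 + M) fun i => weylDerivSymbol V (a i) := by
  let L : Phase n →L[ℝ] ℂ :=
    Complex.ofRealCLM.comp ((innerSL ℝ V.1).comp (ContinuousLinearMap.snd ℝ (Cfg n) (Cfg n)))
  have h1 : SymFam (1 + M) fun i Z => (Complex.I * L Z) * a i Z :=
    ((symFam_clm L).const_mul Complex.I).mul ha
  exact h1.add ((ha.fderiv_apply _).mono (by omega))

/-- The phase ⟨x - y, ξ⟩ contributes ⟨V.1, ξ⟩ + ⟨x - y, V.2⟩. The first term is absorbed in the
symbol, the y-part of the second in the Schwartz function, and its x-part stays outside. All terms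
are again inner Weyl integrals, so the formula can be iterated. -/
theorem hasFDerivAt_weylInner {M : ℕ} {a : ι → Phase n → ℂ} (ha : SymFam M a) (i : ι)
    (φ : 𝓢(Cfg n, ℂ)) (X₀ : Phase n) :
    ∃ T : Phase n →L[ℝ] ℂ, HasFDerivAt (fun X : Phase n => weylInner (a i) φ X.1 X.2) T X₀ ∧
      ∀ V, T V = weylInner (weylDerivSymbol V (a i)) φ X₀.1 X₀.2 +
        Complex.I * (inner ℝ X₀.1 V.2 : ℝ) * weylInner (a i) φ X₀.1 X₀.2 -
        Complex.I * weylInner (a i) (mulInner V.2 φ) X₀.1 X₀.2 := by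
  let L : Phase n →L[ℝ] Phase n :=
    ((2⁻¹ : ℝ) • ContinuousLinearMap.fst ℝ (Cfg n) (Cfg n)).prod
      (ContinuousLinearMap.snd ℝ (Cfg n) (Cfg n))
  have hL : ‖L‖ ≤ 1 := by
    refine ContinuousLinearMap.opNorm_le_bound _ zero_le_one fun v => ?_
    rw [one_mul]
    refine max_le ?_ (le_max_right _ _)
    have : ‖(L v).1‖ = 2⁻¹ * ‖v.1‖ := by simp [L, norm_smul]
    rw [this]
    linarith [norm_nonneg v.1, le_max_left ‖v.1‖ ‖v.2‖, Prod.norm_def (x := v)]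
  let q : Phase n → Cfg n → Phase n →L[ℝ] ℝ := fun X y =>
    (innerSL ℝ X.2).comp (ContinuousLinearMap.fst ℝ (Cfg n) (Cfg n)) +
    (innerSL ℝ (X.1 - y)).comp (ContinuousLinearMap.snd ℝ (Cfg n) (Cfg n))
  have hq : ∀ X y, ‖q X y‖ ≤ ‖X.2‖ + ‖X.1 - y‖ := fun X y => by
    refine ContinuousLinearMap.opNorm_le_bound _ (by positivity) fun V => ?_
    have h1 : ‖V.1‖ ≤ ‖V‖ := le_max_left _ _
    have h2 : ‖V.2‖ ≤ ‖V‖ := le_max_right _ _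
    calc ‖q X y V‖ ≤ ‖inner ℝ X.2 V.1‖ + ‖inner ℝ (X.1 - y) V.2‖ := norm_add_le _ _
      _ ≤ ‖X.2‖ * ‖V.1‖ + ‖X.1 - y‖ * ‖V.2‖ :=
        add_le_add (norm_inner_le_norm _ _) (norm_inner_le_norm _ _)
      _ ≤ ‖X.2‖ * ‖V‖ + ‖X.1 - y‖ * ‖V‖ := by gcongr
      _ = _ := by ring
  let e : Phase n → Cfg n → ℂ := fun X y =>
    Complex.exp (Complex.I * (inner ℝ (X.1 - y) X.2 : ℝ))
  let p : Phase n → Cfg n → Phase n := fun X y => ((2⁻¹ : ℝ) • (X.1 + y), X.2)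
  let F' : Phase n → Cfg n → Phase n →L[ℝ] ℂ := fun X y =>
    (e X y * a i (p X y) * φ y * Complex.I) • (Complex.ofRealCLM.comp (q X y)) +
      (e X y * φ y) • (fderiv ℝ (a i) (p X y)).comp L
  have hdiff : ∀ X y, HasFDerivAt (fun X => e X y * a i (p X y) * φ y) (F' X y) X := by
    intro X y
    have h1 : HasFDerivAt (fun X : Phase n => inner ℝ (X.1 - y) X.2) (q X y) X := by
      have := (hasFDerivAt_fst (𝕜 := ℝ) (p := X)).sub_const y |>.inner ℝ
        (hasFDerivAt_snd (𝕜 := ℝ) (p := X))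
      refine this.congr_fderiv ?_
      ext V <;> simp [q, inner_sub_left, real_inner_comm]
    have h2 : HasFDerivAt (fun X => e X y)
        (e X y • (Complex.I • (Complex.ofRealCLM.comp (q X y)))) X :=
      ((Complex.ofRealCLM.hasFDerivAt.comp X h1).const_mul Complex.I).cexp
    have h3 : HasFDerivAt (fun X => p X y) L X := by
      have := L.hasFDerivAt (x := X) |>.add_const (((2⁻¹ : ℝ) • y, 0) : Phase n)
      refine this.congr_of_eventuallyEq (Filter.Eventually.of_forall fun Z => ?_)
      simp [p, L, smul_add]
    have h4 : HasFDerivAt (fun X => a i (p X y)) ((fderiv ℝ (a i) (p X y)).comp L) X :=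
      (((ha.contDiff i).differentiable (by simp)) (p X y)).hasFDerivAt.comp X h3
    refine ((h2.mul h4).mul_const (φ y)).congr_fderiv ?_
    ext V <;> simp [F'] <;> ring
  have hcont : Continuous fun y => F' X₀ y := by
    have c1 : Continuous (fun y => e X₀ y) := by fun_prop
    have c2 : Continuous (fun y => p X₀ y) := by fun_prop
    have c3 : Continuous (fun y => q X₀ y) := by
      simp only [q]
      refine continuous_const.add (Continuous.clm_comp ?_ continuous_const)
      exact (innerSL ℝ).continuous.comp (continuous_const.sub continuous_id)
    have c4 : Continuous fun y => fderiv ℝ (a i) (p X₀ y) :=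
      ((ha.contDiff i).continuous_fderiv (by simp)).comp c2
    have c5 := (ha.contDiff i).continuous.comp c2
    have c6 := φ.continuous
    exact (((c1.mul c5).mul c6).mul continuous_const).smul (continuous_const.clm_comp c3) |>.add
      ((c1.mul c6).smul (c4.clm_comp continuous_const))
  obtain ⟨C0, hC00, hC0⟩ := ha.bound_le 1
  -- `M` powers for the symbol, one for the derivative of the phase, `n + 1` for integrability in y.
  obtain ⟨D, hD0, hD⟩ := (sBdd_const (ι := Unit) φ).bound_le (M + 1 + (n + 1)) 0
  set R := ‖X₀‖ + 1 with hR
  have hRn : 0 ≤ R := by positivity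
  let bd : Cfg n → ℝ := fun y =>
    (C0 * ((1 + R) * (1 + R)) ^ M * D * (2 * R + 2)) * ((1 + ‖y‖) ^ (n + 1))⁻¹
  have hbound : ∀ y, ∀ X ∈ Metric.ball X₀ 1, ‖F' X y‖ ≤ bd y := by
    intro y X hX
    have hXR : ‖X‖ ≤ R := by
      have : ‖X - X₀‖ < 1 := by simpa [dist_eq_norm] using hX
      have := norm_add_le (X - X₀) X₀
      rw [sub_add_cancel] at this
      linarith
    have hX1 : ‖X.1‖ ≤ R := (le_max_left _ _).trans hXR
    have hX2 : ‖X.2‖ ≤ R := (le_max_right _ _).trans hXR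
    have hy := norm_nonneg y
    have hbr : bracket (p X y) ^ M ≤ ((1 + R) * (1 + R) * (1 + ‖y‖)) ^ M := by
      refine pow_le_pow_left₀ (bracket_pos _).le ?_ M
      refine (bracket_half_add_le X.1 y X.2).trans ?_
      gcongr
    have ha0 : ‖a i (p X y)‖ ≤ C0 * ((1 + R) * (1 + R) * (1 + ‖y‖)) ^ M := by
      have := hC0 0 (by omega) i (p X y)
      rw [norm_iteratedFDeriv_zero] at this
      exact this.trans (by gcongr)
    have ha1 : ‖fderiv ℝ (a i) (p X y)‖ ≤ C0 * ((1 + R) * (1 + R) * (1 + ‖y‖)) ^ M := by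
      have := hC0 1 le_rfl i (p X y)
      rw [← zero_add 1, ← norm_iteratedFDeriv_fderiv, norm_iteratedFDeriv_zero] at this
      exact this.trans (by gcongr)
    have hph : ‖φ y‖ ≤ D * ((1 + ‖y‖) ^ (M + 1 + (n + 1)))⁻¹ := by
      have := hD 0 le_rfl () y
      rwa [norm_iteratedFDeriv_zero] at this
    have hqq : ‖q X y‖ ≤ 2 * R + ‖y‖ := by
      have := norm_sub_le X.1 y
      linarith [hq X y]
    have he : ‖e X y‖ = 1 := norm_cexp_I_mul _
    calc ‖F' X y‖ ≤ ‖(e X y * a i (p X y) * φ y * Complex.I)‖ * ‖Complex.ofRealCLM.comp (q X y)‖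
          + ‖e X y * φ y‖ * ‖(fderiv ℝ (a i) (p X y)).comp L‖ := by
          refine (norm_add_le _ _).trans ?_
          rw [norm_smul, norm_smul]
      _ ≤ (‖a i (p X y)‖ * ‖φ y‖) * ‖q X y‖ + ‖φ y‖ * ‖fderiv ℝ (a i) (p X y)‖ := by
          rw [norm_mul, norm_mul, norm_mul, norm_mul, he, Complex.norm_I, one_mul, one_mul, mul_one]
          gcongr
          · refine (ContinuousLinearMap.opNorm_comp_le _ _).trans ?_
            simp
          · exact (ContinuousLinearMap.opNorm_comp_le _ _).trans
              (mul_le_of_le_one_right (norm_nonneg _) hL)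
      _ ≤ (C0 * ((1 + R) * (1 + R) * (1 + ‖y‖)) ^ M * (D * ((1 + ‖y‖) ^ (M + 1 + (n + 1)))⁻¹))
          * (2 * R + ‖y‖) + (D * ((1 + ‖y‖) ^ (M + 1 + (n + 1)))⁻¹) *
            (C0 * ((1 + R) * (1 + R) * (1 + ‖y‖)) ^ M) := by gcongr
      _ = (C0 * ((1 + R) * (1 + R)) ^ M * D * (2 * R + ‖y‖ + 1) * (1 + ‖y‖) ^ M) *
            ((1 + ‖y‖) ^ (M + 1 + (n + 1)))⁻¹ := by rw [mul_pow _ (1 + ‖y‖)]; ring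
      _ ≤ (C0 * ((1 + R) * (1 + R)) ^ M * D * ((2 * R + 2) * (1 + ‖y‖)) * (1 + ‖y‖) ^ M) *
            ((1 + ‖y‖) ^ (M + 1 + (n + 1)))⁻¹ := by
          gcongr
          nlinarith [mul_nonneg hRn hy]
      _ = bd y := by
          simp only [bd]
          rw [pow_add _ (M + 1), pow_succ]
          field_simp
  have hbdint : Integrable bd :=
    (integrable_one_add_norm_rpow_neg (n := n) (r := n + 1) (by omega)).const_mul _
  have hFint : Integrable (F' X₀) := hbdint.mono' hcont.aestronglyMeasurable
    (Filter.Eventually.of_forall fun y => hbound y X₀ (Metric.mem_ball_self one_pos))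
  refine ⟨∫ y, F' X₀ y, ?_, fun V => ?_⟩
  · refine hasFDerivAt_integral_of_dominated_of_fderiv_le
      (F := fun X y => e X y * a i (p X y) * φ y) (bound := bd)
      (Metric.ball_mem_nhds X₀ one_pos) ?_ (integrable_weylInner_integrand ha i φ X₀.1 X₀.2)
      hcont.aestronglyMeasurable (Filter.Eventually.of_forall hbound) hbdint
      (Filter.Eventually.of_forall fun y X _ => hdiff X y)
    exact Filter.Eventually.of_forall fun X =>
      (integrable_weylInner_integrand ha i φ X.1 X.2).aestronglyMeasurable
  · rw [ContinuousLinearMap.integral_apply hFint, weylInner, weylInner, weylInner,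
      ← integral_const_mul, ← integral_const_mul, ← integral_add, ← integral_sub]
    · refine integral_congr_ae (Filter.Eventually.of_forall fun y => ?_)
      simp only [F', q, e, p, L, weylDerivSymbol, mulInner_apply, inner_sub_left]
      simp [real_inner_comm]
      ring
    · exact (integrable_weylInner_integrand (ha.weylDerivSymbol V) i φ _ _).add
        ((integrable_weylInner_integrand ha i φ _ _).const_mul _)
    · exact (integrable_weylInner_integrand ha i _ _ _).const_mul _
    · exact integrable_weylInner_integrand (ha.weylDerivSymbol V) i φ _ _
    · exact (integrable_weylInner_integrand ha i φ _ _).const_mul _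

theorem continuous_weylInner {M : ℕ} {a : ι → Phase n → ℂ} (ha : SymFam M a) (i : ι)
    (φ : 𝓢(Cfg n, ℂ)) : Continuous fun X : Phase n => weylInner (a i) φ X.1 X.2 :=
  continuous_iff_continuousAt.2 fun X =>
    (hasFDerivAt_weylInner ha i φ X).choose_spec.1.continuousAt

theorem integrable_weylInner {M : ℕ} {a : ι → Phase n → ℂ} (ha : SymFam M a) (i : ι)
    (φ : 𝓢(Cfg n, ℂ)) (x : Cfg n) : Integrable fun ξ => weylInner (a i) φ x ξ := by
  obtain ⟨C, hC0, hC⟩ := norm_weylInner_le ha (sBdd_const φ) (n + 1)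
  refine ((integrable_one_add_norm_rpow_neg (n := n) (r := n + 1) (by omega)).const_mul
    (C * (1 + ‖x‖) ^ M)).mono' ?_ (Filter.Eventually.of_forall fun ξ => hC i x ξ)
  exact ((continuous_weylInner ha i φ).comp (Continuous.prodMk_right x)).aestronglyMeasurable

/-! ### The outer Weyl integral as a Schwartz function -/

theorem norm_weylOuter_le {M : ℕ} {a : ι → Phase n → ℂ} (ha : SymFam M a)
    {φ : ι → 𝓢(Cfg n, ℂ)} (hφ : SBdd φ) :
    ∃ C : ℝ, ∀ i x, ‖weylOuter (a i) (φ i) x‖ ≤ C * (1 + ‖x‖) ^ M := by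
  obtain ⟨C, hC0, hC⟩ := norm_weylInner_le ha hφ (n + 1)
  have hint := integrable_one_add_norm_rpow_neg (n := n) (r := n + 1) (by omega)
  refine ⟨C * ∫ ξ : Cfg n, ((1 + ‖ξ‖) ^ (n + 1))⁻¹, fun i x => ?_⟩
  refine (norm_integral_le_of_norm_le (hint.const_mul (C * (1 + ‖x‖) ^ M))
    (Filter.Eventually.of_forall fun ξ => hC i x ξ)).trans (le_of_eq ?_)
  rw [integral_const_mul]; ring

theorem integral_fderiv_apply_eq_zero {g : Cfg n → ℂ} {g' : Cfg n → ℂ} {w : Cfg n}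
    (hg : ∀ x, DifferentiableAt ℝ g x) (hw : ∀ x, fderiv ℝ g x w = g' x) (hi : Integrable g)
    (hi' : Integrable g') : ∫ x, g' x = 0 := by
  have h := integral_mul_fderiv_eq_neg_fderiv_mul_of_integrable (μ := (volume : Measure (Cfg n)))
    (f := fun _ => (1 : ℂ)) (g := g) (v := w) (by simp) (by simpa [hw] using hi')
    (by simpa using hi) (fun x _ => by simp) (fun x _ => hg x)
  simpa [hw] using h

/-- The derivative of the inner integral in the direction (0, w) has zero integral over ξ. Solving
for the term with ⟨x, w⟩ commutes multiplication by a linear function past the operator. -/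
theorem inner_mul_weylOuter {M : ℕ} {a : ι → Phase n → ℂ} (ha : SymFam M a) (i : ι)
    (φ : 𝓢(Cfg n, ℂ)) (x w : Cfg n) :
    (inner ℝ x w : ℝ) * weylOuter (a i) φ x = weylOuter (a i) (mulInner w φ) x +
      Complex.I * weylOuter (fun Z => fderiv ℝ (a i) Z (0, w)) φ x := by
  have hd : ∀ ξ, ∃ T : Cfg n →L[ℝ] ℂ, HasFDerivAt (fun ξ => weylInner (a i) φ x ξ) T ξ ∧
      T w = weylInner (fun Z => fderiv ℝ (a i) Z (0, w)) φ x ξ +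
        Complex.I * (inner ℝ x w : ℝ) * weylInner (a i) φ x ξ -
        Complex.I * weylInner (a i) (mulInner w φ) x ξ := fun ξ => by
    obtain ⟨T, hT, hV⟩ := hasFDerivAt_weylInner ha i φ (x, ξ)
    refine ⟨T.comp (ContinuousLinearMap.inr ℝ (Cfg n) (Cfg n)),
      hT.comp ξ (hasFDerivAt_prodMk_right x ξ), ?_⟩
    have := hV (0, w)
    have e : weylDerivSymbol (0, w) (a i) = fun Z => fderiv ℝ (a i) Z (0, w) := by
      funext Z; simp [weylDerivSymbol]
    rw [e] at this
    simpa using this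
  have h1 := integrable_weylInner (ha.fderiv_apply (0, w)) i φ x
  have h2 := (integrable_weylInner ha i φ x).const_mul (Complex.I * (inner ℝ x w : ℝ))
  have h3 := (integrable_weylInner ha i (mulInner w φ) x).const_mul Complex.I
  have key := integral_fderiv_apply_eq_zero (g := fun ξ => weylInner (a i) φ x ξ) (w := w)
    (g' := fun ξ => weylInner (fun Z => fderiv ℝ (a i) Z (0, w)) φ x ξ +
        Complex.I * (inner ℝ x w : ℝ) * weylInner (a i) φ x ξ -
        Complex.I * weylInner (a i) (mulInner w φ) x ξ)
    (fun ξ => (hd ξ).choose_spec.1.differentiableAt)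
    (fun ξ => by
      rw [(hd ξ).choose_spec.1.fderiv]
      exact (hd ξ).choose_spec.2) (integrable_weylInner ha i φ x) ((h1.add h2).sub h3)
  rw [integral_sub (by exact h1.add h2) h3, integral_add h1 h2, integral_const_mul,
    integral_const_mul] at key
  simp only [weylOuter]
  linear_combination (-Complex.I) * key + (((inner ℝ x w : ℝ) : ℂ) *
    (∫ ξ, weylInner (a i) φ x ξ) - (∫ ξ, weylInner (a i) (mulInner w φ) x ξ)) * Complex.I_sq

theorem clm_eq_sum_proj (T : Cfg n →L[ℝ] ℂ) :
    T = ∑ j, (EuclideanSpace.proj j : Cfg n →L[ℝ] ℝ).smulRight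
      (T (EuclideanSpace.single j 1)) := by
  ext x
  have : x = ∑ j, x j • EuclideanSpace.single j (1 : ℝ) := by
    ext k; simp [Finset.sum_apply, Pi.single_apply]
  conv_lhs => rw [this]
  simp

theorem norm_proj_le (j : Fin n) : ‖(EuclideanSpace.proj j : Cfg n →L[ℝ] ℝ)‖ ≤ 1 :=
  ContinuousLinearMap.opNorm_le_bound _ zero_le_one fun x => by
    simpa using PiLp.norm_apply_le x j

/-- Only directions (v, 0) occur, so nothing falls on φ: an x-derivative merely replaces the symbol
by one whose growth exponent is larger by one. -/
theorem hasFDerivAt_weylOuter {M : ℕ} {a : ι → Phase n → ℂ} (ha : SymFam M a) (i : ι)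
    (φ : 𝓢(Cfg n, ℂ)) (x : Cfg n) :
    HasFDerivAt (weylOuter (a i) φ) (∑ j, (EuclideanSpace.proj j : Cfg n →L[ℝ] ℝ).smulRight
      (weylOuter (weylDerivSymbol (EuclideanSpace.single j 1, 0) (a i)) φ x)) x := by
  let b : Fin n → Phase n → ℂ := fun j => weylDerivSymbol (EuclideanSpace.single j 1, 0) (a i)
  have hb : ∀ j, SymFam (1 + M) fun _ : Unit => b j := fun j =>
    ⟨fun _ => (ha.weylDerivSymbol _).contDiff i, fun k =>
      ((ha.weylDerivSymbol (EuclideanSpace.single j 1, 0)).bound k).imp fun C hC _ X => hC i X⟩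
  let F' : Cfg n → Cfg n → Cfg n →L[ℝ] ℂ := fun x ξ =>
    ∑ j, (EuclideanSpace.proj j : Cfg n →L[ℝ] ℝ).smulRight (weylInner (b j) φ x ξ)
  have hF' : ∀ x ξ, HasFDerivAt (fun x => weylInner (a i) φ x ξ) (F' x ξ) x := fun x ξ => by
    obtain ⟨T, hT, hV⟩ := hasFDerivAt_weylInner ha i φ (x, ξ)
    have h : HasFDerivAt (fun x => weylInner (a i) φ x ξ)
        (T.comp (ContinuousLinearMap.inl ℝ (Cfg n) (Cfg n))) x :=
      HasFDerivAt.comp (g := fun X : Phase n => weylInner (a i) φ X.1 X.2)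
        (f := fun e : Cfg n => ((e, ξ) : Phase n)) x hT
        (hasFDerivAt_prodMk_left (𝕜 := ℝ) x ξ)
    refine h.congr_fderiv ?_
    rw [clm_eq_sum_proj (T.comp (ContinuousLinearMap.inl ℝ (Cfg n) (Cfg n)))]
    refine Finset.sum_congr rfl fun j _ => ?_
    congr 1
    have hz : weylInner (a i) (mulInner 0 φ) x ξ = 0 := by
      simp [weylInner, mulInner_apply]
    have := hV (EuclideanSpace.single j 1, 0)
    simpa [hz] using this
  have hI : ∀ j, Integrable fun ξ =>
      (EuclideanSpace.proj j : Cfg n →L[ℝ] ℝ).smulRight (weylInner (b j) φ x ξ) := fun j =>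
    (ContinuousLinearMap.smulRightL ℝ (Cfg n) ℂ (EuclideanSpace.proj j)).integrable_comp
      (integrable_weylInner (hb j) () φ x)
  have hFm : AEStronglyMeasurable (fun ξ => F' x ξ) volume :=
    Finset.aestronglyMeasurable_fun_sum Finset.univ fun j _ => (hI j).aestronglyMeasurable
  have e : ∑ j, (EuclideanSpace.proj j : Cfg n →L[ℝ] ℝ).smulRight (weylOuter (b j) φ x) =
      ∫ ξ, F' x ξ := by
    rw [integral_finsetSum _ fun j _ => hI j]
    refine Finset.sum_congr rfl fun j _ => ?_
    exact ((ContinuousLinearMap.smulRightL ℝ (Cfg n) ℂ (EuclideanSpace.proj j)).integral_comp_comm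
      (integrable_weylInner (hb j) () φ x)).symm
  change HasFDerivAt _ (∑ j, (EuclideanSpace.proj j : Cfg n →L[ℝ] ℝ).smulRight
    (weylOuter (b j) φ x)) x
  rw [e]
  choose C hC0 hC using fun j => norm_weylInner_le (hb j) (sBdd_const φ) (n + 1)
  refine hasFDerivAt_integral_of_dominated_of_fderiv_le
    (F := fun x ξ => weylInner (a i) φ x ξ) (F' := F')
    (bound := fun ξ => (∑ j, C j * (1 + (‖x‖ + 1)) ^ (1 + M)) * ((1 + ‖ξ‖) ^ (n + 1))⁻¹)
    (Metric.ball_mem_nhds x one_pos)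
    (Filter.Eventually.of_forall fun x => (integrable_weylInner ha i φ x).aestronglyMeasurable)
    (integrable_weylInner ha i φ x) ?_ (Filter.Eventually.of_forall fun ξ x' hx' => ?_)
    ((integrable_one_add_norm_rpow_neg (n := n) (r := n + 1) (by omega)).const_mul _)
    (Filter.Eventually.of_forall fun ξ x' _ => hF' x' ξ)
  · exact hFm
  · have hx : ‖x'‖ ≤ ‖x‖ + 1 := by
      have h1 : ‖x' - x‖ < 1 := by simpa [dist_eq_norm] using hx'
      have := norm_add_le (x' - x) x
      rw [sub_add_cancel] at this
      linarith
    rw [Finset.sum_mul]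
    refine (norm_sum_le _ _).trans (Finset.sum_le_sum fun j _ => ?_)
    rw [ContinuousLinearMap.norm_smulRight_apply]
    have h0 := hC0 j
    calc _ ≤ 1 * ‖weylInner (b j) φ x' ξ‖ := by gcongr; exact norm_proj_le j
      _ ≤ C j * (1 + ‖x'‖) ^ (1 + M) * ((1 + ‖ξ‖) ^ (n + 1))⁻¹ := by
        rw [one_mul]; exact hC j () x' ξ
      _ ≤ _ := by gcongr

theorem norm_le_sum_inner_single (x : Cfg n) :
    ‖x‖ ≤ ∑ j, |inner ℝ x (EuclideanSpace.single j (1 : ℝ))| := by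
  have : x = ∑ j, x j • EuclideanSpace.single j (1 : ℝ) := by
    ext k; simp [Finset.sum_apply, Pi.single_apply]
  conv_lhs => rw [this]
  refine (norm_sum_le _ _).trans (Finset.sum_le_sum fun j _ => ?_)
  simp [norm_smul, EuclideanSpace.inner_single_right]

/-- Each power of ‖x‖ is distributed over the coordinates and then moved, by `inner_mul_weylOuter`,
onto φ or into a ξ-derivative of the symbol. Neither raises `M`, so the weight on the right does not
depend on `N`. Both families change in the induction step, hence the quantifiers inside the
statement. -/
theorem norm_pow_mul_weylOuter_le (N : ℕ) : ∀ {M : ℕ} {a : ι → Phase n → ℂ} (_ : SymFam M a)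
    {φ : ι → 𝓢(Cfg n, ℂ)} (_ : SBdd φ),
    ∃ C : ℝ, ∀ i x, ‖x‖ ^ N * ‖weylOuter (a i) (φ i) x‖ ≤ C * (1 + ‖x‖) ^ M := by
  induction N with
  | zero =>
    intro M a ha φ hφ
    simpa using norm_weylOuter_le ha hφ
  | succ N ih =>
    intro M a ha φ hφ
    choose C hC using fun j : Fin n => ih ha (hφ.mulInner (EuclideanSpace.single j 1))
    choose D hD using fun j : Fin n => ih (ha.fderiv_apply (0, EuclideanSpace.single j 1)) hφ
    refine ⟨∑ j, (C j + D j), fun i x => ?_⟩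
    calc ‖x‖ ^ (N + 1) * ‖weylOuter (a i) (φ i) x‖
        = ‖x‖ ^ N * (‖x‖ * ‖weylOuter (a i) (φ i) x‖) := by ring
      _ ≤ ‖x‖ ^ N * ((∑ j, |inner ℝ x (EuclideanSpace.single j (1 : ℝ))|) *
          ‖weylOuter (a i) (φ i) x‖) := by gcongr; exact norm_le_sum_inner_single x
      _ = ∑ j, ‖x‖ ^ N * ‖((inner ℝ x (EuclideanSpace.single j (1 : ℝ)) : ℝ) : ℂ) *
          weylOuter (a i) (φ i) x‖ := by
          rw [Finset.sum_mul, Finset.mul_sum]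
          simp only [norm_mul, Complex.norm_real, Real.norm_eq_abs]
      _ ≤ ∑ j, (C j + D j) * (1 + ‖x‖) ^ M := by
          refine Finset.sum_le_sum fun j _ => ?_
          rw [inner_mul_weylOuter ha i, add_mul]
          refine le_trans ?_ (add_le_add (hC j i x) (hD j i x))
          rw [← mul_add]
          gcongr
          refine (norm_add_le _ _).trans (le_of_eq ?_)
          simp
      _ = _ := by rw [Finset.sum_mul]

/-- Every derivative raises the growth exponent of the symbol by one. This is harmless, since the
resulting factor (1 + ‖x‖)ᴹ is beaten in the base case by `M` additional powers of ‖x‖, of which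
arbitrarily many are available. -/
theorem weylOuter_bound (l : ℕ) : ∀ (k : ℕ) {M : ℕ} {a : ι → Phase n → ℂ} (_ : SymFam M a)
    {φ : ι → 𝓢(Cfg n, ℂ)} (_ : SBdd φ),
    (∀ i, ContDiff ℝ l (weylOuter (a i) (φ i))) ∧
    ∃ C : ℝ, ∀ i x, ‖x‖ ^ k * ‖iteratedFDeriv ℝ l (weylOuter (a i) (φ i)) x‖ ≤ C := by
  induction l with
  | zero =>
    intro k M a ha φ hφ
    constructor
    · intro i
      exact contDiff_zero.2 (continuous_iff_continuousAt.2 fun x =>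
        (hasFDerivAt_weylOuter ha i (φ i) x).continuousAt)
    · obtain ⟨C0, h0⟩ := norm_pow_mul_weylOuter_le k ha hφ
      obtain ⟨C1, h1⟩ := norm_pow_mul_weylOuter_le (M + k) ha hφ
      refine ⟨2 ^ M * (C0 + C1), fun i x => ?_⟩
      rw [norm_iteratedFDeriv_zero]
      have hp : 0 < (1 + ‖x‖) ^ M := by positivity
      refine le_of_mul_le_mul_left ?_ hp
      calc (1 + ‖x‖) ^ M * (‖x‖ ^ k * ‖weylOuter (a i) (φ i) x‖)
          ≤ (2 ^ M * (1 + ‖x‖ ^ M)) * (‖x‖ ^ k * ‖weylOuter (a i) (φ i) x‖) := by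
            gcongr; exact one_add_pow_le _ (norm_nonneg _)
        _ = 2 ^ M * (‖x‖ ^ k * ‖weylOuter (a i) (φ i) x‖ +
            ‖x‖ ^ (M + k) * ‖weylOuter (a i) (φ i) x‖) := by rw [pow_add]; ring
        _ ≤ 2 ^ M * (C0 * (1 + ‖x‖) ^ M + C1 * (1 + ‖x‖) ^ M) :=
            mul_le_mul_of_nonneg_left (add_le_add (h0 i x) (h1 i x)) (by positivity)
        _ = _ := by ring
  | succ l ih =>
    intro k M a ha φ hφ
    have hb := fun j : Fin n => ha.weylDerivSymbol (EuclideanSpace.single j 1, 0)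
    have hfd : ∀ i, fderiv ℝ (weylOuter (a i) (φ i)) = fun x =>
        ∑ j, (ContinuousLinearMap.smulRightL ℝ (Cfg n) ℂ (EuclideanSpace.proj j))
        (weylOuter (weylDerivSymbol (EuclideanSpace.single j 1, 0) (a i)) (φ i) x) := fun i => by
      ext1 x
      exact (hasFDerivAt_weylOuter ha i (φ i) x).fderiv
    have hcd : ∀ i (j : Fin n), ContDiff ℝ l fun x =>
        (ContinuousLinearMap.smulRightL ℝ (Cfg n) ℂ (EuclideanSpace.proj j))
        (weylOuter (weylDerivSymbol (EuclideanSpace.single j 1, 0) (a i)) (φ i) x) := fun i j =>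
      (ContinuousLinearMap.contDiff _).comp ((ih 0 (hb j) hφ).1 i)
    constructor
    · intro i
      push_cast
      rw [contDiff_succ_iff_fderiv]
      refine ⟨fun x => (hasFDerivAt_weylOuter ha i (φ i) x).differentiableAt, by simp, ?_⟩
      rw [hfd]
      exact ContDiff.sum fun j _ => hcd i j
    · choose C hC using fun j => (ih k (hb j) hφ).2
      refine ⟨∑ j, C j, fun i x => ?_⟩
      rw [← norm_iteratedFDeriv_fderiv, hfd, iteratedFDeriv_fun_sum_apply fun j _ => (hcd i j).contDiffAt]
      calc _ ≤ ‖x‖ ^ k * ∑ j, ‖iteratedFDeriv ℝ l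
            (weylOuter (weylDerivSymbol (EuclideanSpace.single j 1, 0) (a i)) (φ i)) x‖ := by
            gcongr
            refine (norm_sum_le _ _).trans (Finset.sum_le_sum fun j _ => ?_)
            have := ContinuousLinearMap.iteratedFDeriv_comp_left
              (ContinuousLinearMap.smulRightL ℝ (Cfg n) ℂ (EuclideanSpace.proj j))
              (f := weylOuter (weylDerivSymbol (EuclideanSpace.single j 1, 0) (a i)) (φ i))
              (x := x) ((ih 0 (hb j) hφ).1 i).contDiffAt (i := l) le_rfl
            simp only [Function.comp_def] at this
            rw [this]
            refine (ContinuousLinearMap.norm_compContinuousMultilinearMap_le _ _).trans ?_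
            refine mul_le_of_le_one_left (norm_nonneg _) ?_
            refine ContinuousLinearMap.opNorm_le_bound _ zero_le_one fun c => ?_
            rw [ContinuousLinearMap.smulRightL_apply_apply, ContinuousLinearMap.norm_smulRight_apply]
            gcongr
            exact norm_proj_le j
        _ ≤ ∑ j, C j := by
            rw [Finset.mul_sum]
            exact Finset.sum_le_sum fun j _ => hC j i x

/-- The Weyl quantization of a bounded family of symbols maps a bounded family of Schwartz functions
to a bounded family of Schwartz functions. -/
theorem exists_schwartz_weylFormula {M : ℕ} {a : ι → Phase n → ℂ} (ha : SymFam M a)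
    {φ : ι → 𝓢(Cfg n, ℂ)} (hφ : SBdd φ) :
    ∃ χ : ι → 𝓢(Cfg n, ℂ), (∀ i x, χ i x = weylFormula (a i) (φ i) x) ∧ SBdd χ := by
  let c : ℂ := (((2 * Real.pi) ^ n)⁻¹ : ℝ)
  have hs : ∀ i, ContDiff ℝ ∞ (weylOuter (a i) (φ i)) := fun i =>
    contDiff_infty.2 fun l => (weylOuter_bound l 0 ha hφ).1 i
  let χ₀ : ι → 𝓢(Cfg n, ℂ) := fun i =>
    ⟨weylOuter (a i) (φ i), hs i, fun k l =>
      ((weylOuter_bound l k ha hφ).2).imp fun C hC x => hC i x⟩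
  refine ⟨fun i => c • χ₀ i, fun i x => rfl, ?_⟩
  have h0 : SBdd χ₀ := fun k l => (weylOuter_bound l k ha hφ).2
  exact h0.comp_clm ((c • ContinuousLinearMap.id ℂ 𝓢(Cfg n, ℂ)).restrictScalars ℝ)

/-! ### Weyl operators on tempered distributions -/

theorem weylFormula_add {M : ℕ} {a : ι → Phase n → ℂ} (ha : SymFam M a) (i : ι)
    (φ ψ : 𝓢(Cfg n, ℂ)) (x : Cfg n) :
    weylFormula (a i) (φ + ψ) x = weylFormula (a i) φ x + weylFormula (a i) ψ x := by
  rw [weylFormula_eq, weylFormula_eq, weylFormula_eq, ← mul_add]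
  congr 1
  rw [weylOuter, weylOuter, weylOuter, ← integral_add (integrable_weylInner ha i φ x)
    (integrable_weylInner ha i ψ x)]
  refine integral_congr_ae (Filter.Eventually.of_forall fun ξ => ?_)
  simp only [weylInner]
  rw [← integral_add (integrable_weylInner_integrand ha i φ x ξ)
    (integrable_weylInner_integrand ha i ψ x ξ)]
  simp [mul_add]

theorem weylFormula_symbol_add {M N : ℕ} {a b : ι → Phase n → ℂ} (ha : SymFam M a)
    (hb : SymFam N b) (i : ι) (φ : 𝓢(Cfg n, ℂ)) (x : Cfg n) :
    weylFormula (fun Z => a i Z + b i Z) φ x = weylFormula (a i) φ x + weylFormula (b i) φ x := by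
  rw [weylFormula_eq, weylFormula_eq, weylFormula_eq, ← mul_add]
  congr 1
  rw [weylOuter, weylOuter, weylOuter, ← integral_add (integrable_weylInner ha i φ x)
    (integrable_weylInner hb i φ x)]
  refine integral_congr_ae (Filter.Eventually.of_forall fun ξ => ?_)
  simp only [weylInner]
  rw [← integral_add (integrable_weylInner_integrand ha i φ x ξ)
    (integrable_weylInner_integrand hb i φ x ξ)]
  simp [mul_add, add_mul]

theorem weylFormula_smul (a : Phase n → ℂ) (c : ℂ) (φ : 𝓢(Cfg n, ℂ)) (x : Cfg n) :
    weylFormula a (c • φ) x = c * weylFormula a φ x := by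
  rw [weylFormula_eq, weylFormula_eq, ← mul_assoc, mul_comm c, mul_assoc]
  congr 1
  simp only [weylOuter, weylInner, ← integral_const_mul]
  refine integral_congr_ae (Filter.Eventually.of_forall fun ξ => integral_congr_ae
    (Filter.Eventually.of_forall fun y => ?_))
  simp only [smul_apply, smul_eq_mul]
  ring

theorem weylFormula_symbol_const_mul (a : Phase n → ℂ) (c : ℂ) (φ : 𝓢(Cfg n, ℂ)) (x : Cfg n) :
    weylFormula (fun Z => c * a Z) φ x = c * weylFormula a φ x := by
  rw [weylFormula_eq, weylFormula_eq, ← mul_assoc, mul_comm c, mul_assoc]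
  congr 1
  simp only [weylOuter, weylInner, ← integral_const_mul]
  refine integral_congr_ae (Filter.Eventually.of_forall fun ξ => integral_congr_ae
    (Filter.Eventually.of_forall fun y => ?_))
  simp only
  ring

/-- Fourier inversion in the normalization `(2π)⁻ⁿ ∫ e^{i⟨x,ξ⟩} f̂(ξ) dξ`. -/
theorem integral_cexp_mul_fourier (f : 𝓢(Cfg n, ℂ)) (x : Cfg n) :
    ∫ ξ : Cfg n, Complex.exp (Complex.I * (inner ℝ x ξ : ℝ)) *
      FourierTransform.fourier (f : Cfg n → ℂ) ((2 * Real.pi)⁻¹ • ξ) =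
      ((2 * Real.pi) ^ n : ℝ) * f x := by
  have h1 : ∀ ξ : Cfg n, Complex.exp (Complex.I * (inner ℝ x ξ : ℝ)) *
      FourierTransform.fourier (f : Cfg n → ℂ) ((2 * Real.pi)⁻¹ • ξ) =
      (fun η : Cfg n => Complex.exp (Complex.I * (inner ℝ x ((2 * Real.pi) • η) : ℝ)) *
        FourierTransform.fourier (f : Cfg n → ℂ) η) ((2 * Real.pi)⁻¹ • ξ) := fun ξ => by
    simp only
    rw [smul_inv_smul₀ (by positivity)]
  rw [integral_congr_ae (Filter.Eventually.of_forall h1),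
    Measure.integral_comp_inv_smul_of_nonneg volume (fun η : Cfg n =>
      Complex.exp (Complex.I * (inner ℝ x ((2 * Real.pi) • η) : ℝ)) *
        FourierTransform.fourier (f : Cfg n → ℂ) η) (R := 2 * Real.pi) (by positivity), finrank_euclideanSpace_fin,
    Complex.real_smul]
  congr 1
  have h2 := congrArg (fun g : 𝓢(Cfg n, ℂ) => g x) (FourierTransform.fourierInv_fourier_eq (F := 𝓢(Cfg n, ℂ)) f)
  rw [SchwartzMap.fourierInv_coe, SchwartzMap.fourier_coe, Real.fourierInv_eq'] at h2
  rw [← h2]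
  refine integral_congr_ae (Filter.Eventually.of_forall fun η => ?_)
  simp only [smul_eq_mul]
  congr 2
  rw [inner_smul_right, real_inner_comm]
  push_cast
  ring

/-- Fourier inversion. It is what allows the frozen value a(X) to be split off from a translated
symbol. -/
theorem weylFormula_const (c : ℂ) (φ : 𝓢(Cfg n, ℂ)) (x : Cfg n) :
    weylFormula (fun _ => c) φ x = c * φ x := by
  have h := weylFormula_symbol_const_mul (fun _ => 1) c φ x
  simp only [mul_one] at h
  rw [h, weylFormula_eq, weylOuter]
  congr 1
  simp_rw [weylInner_eq_fourier, one_mul]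
  rw [integral_cexp_mul_fourier, ← mul_assoc, ← Complex.ofReal_mul,
    inv_mul_cancel₀ (by positivity), Complex.ofReal_one, one_mul]

theorem exists_weylCLM {M : ℕ} {a : Phase n → ℂ} (ha : SymFam M fun _ : Unit => a) :
    ∃ T : 𝓢(Cfg n, ℂ) →L[ℂ] 𝓢(Cfg n, ℂ), ∀ φ x, T φ x = weylFormula a φ x := by
  have h : ∀ φ : 𝓢(Cfg n, ℂ), ∃ χ : 𝓢(Cfg n, ℂ), ∀ x, χ x = weylFormula a φ x := fun φ => by
    obtain ⟨χ, hχ, -⟩ := exists_schwartz_weylFormula ha (sBdd_const φ)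
    exact ⟨χ (), fun x => hχ () x⟩
  choose χ hχ using h
  let T : 𝓢(Cfg n, ℂ) →ₗ[ℂ] 𝓢(Cfg n, ℂ) :=
    { toFun := χ
      map_add' := fun φ ψ => by
        ext x
        rw [hχ, weylFormula_add ha (), add_apply, hχ, hχ]
      map_smul' := fun c φ => by
        ext x
        rw [hχ, weylFormula_smul, smul_apply, hχ]; rfl }
  have hT : Continuous (T.restrictScalars ℝ) := by
    -- It suffices that bounded sets are mapped to bounded sets, which `exists_schwartz_weylFormula`
    -- gives with the bounded set `s` itself as the index set of the family.
    refine LinearMap.continuous_of_locally_bounded _ fun s hs => ?_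
    have ha' : SymFam M fun _ : s => a :=
      ⟨fun _ => ha.contDiff (), fun k => (ha.bound k).imp fun C hC _ X => hC () X⟩
    have hs' : SBdd fun φ : s => (φ : 𝓢(Cfg n, ℂ)) := by
      rw [sBdd_iff_isVonNBounded]; simpa using hs
    obtain ⟨ζ, hζ, hb⟩ := exists_schwartz_weylFormula ha' hs'
    rw [sBdd_iff_isVonNBounded] at hb
    refine hb.subset ?_
    rintro _ ⟨φ, hφ, rfl⟩
    refine ⟨⟨φ, hφ⟩, ?_⟩
    ext x
    rw [hζ]
    exact (hχ φ x).symm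
  exact ⟨⟨T, hT⟩, hχ⟩

theorem bracket_rpow_le_pow (X : Phase n) {s : ℝ} {M : ℕ} (h : s ≤ M) :
    bracket X ^ s ≤ bracket X ^ M := by
  rw [← Real.rpow_natCast]
  exact Real.rpow_le_rpow_of_exponent_le (one_le_bracket X) h

theorem IsShubinSymbol.bound_nonneg {m : ℝ} {a : Phase n → ℂ} (ha : IsShubinSymbol m a) (k : ℕ) :
    ∃ C : ℝ, 0 ≤ C ∧ ∀ X, ‖iteratedFDeriv ℝ k a X‖ ≤ C * bracket X ^ (m - k) := by
  obtain ⟨C, hC⟩ := ha.bound k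
  refine ⟨max C 0, le_max_right _ _, fun X => (hC X).trans ?_⟩
  have := bracket_pos X
  gcongr
  exact le_max_left _ _

theorem IsShubinSymbol.symFam {m : ℝ} {a : Phase n → ℂ} (ha : IsShubinSymbol m a) :
    SymFam ⌈m⌉₊ fun _ : ι => a := by
  refine ⟨fun _ => ha.contDiff, fun k => ?_⟩
  obtain ⟨C, hC0, hC⟩ := ha.bound_nonneg k
  refine ⟨C, fun _ X => (hC X).trans ?_⟩
  gcongr
  exact bracket_rpow_le_pow X ((sub_le_self m (Nat.cast_nonneg k)).trans (Nat.le_ceil m))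

theorem IsShubinSymbol.transposeSymbol {m : ℝ} {a : Phase n → ℂ} (ha : IsShubinSymbol m a) :
    IsShubinSymbol m (transposeSymbol a) := by
  let g : Phase n ≃ₗᵢ[ℝ] Phase n :=
    { (LinearEquiv.refl ℝ (Cfg n)).prodCongr (LinearEquiv.neg ℝ) with
      norm_map' := fun X => by simp [Prod.norm_def] }
  have hg : IsoGabor.transposeSymbol a = a ∘ g := rfl
  refine ⟨hg ▸ ha.contDiff.comp g.contDiff, fun k => ?_⟩
  obtain ⟨C, hC⟩ := ha.bound k
  refine ⟨C, fun X => ?_⟩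
  rw [hg, g.norm_iteratedFDeriv_comp_right]
  have e : bracket (g X) = bracket X := by
    change bracket (X.1, -X.2) = _
    simp [bracket]
  exact e ▸ hC (g X)

theorem exists_isWeylQuantization {m : ℝ} {a : Phase n → ℂ} (ha : IsShubinSymbol m a) :
    ∃ A : 𝓢'(Cfg n, ℂ) →L[ℂ] 𝓢'(Cfg n, ℂ), IsWeylQuantization a A := by
  obtain ⟨T, hT⟩ := exists_weylCLM (ha.transposeSymbol.symFam (ι := Unit))
  exact ⟨PointwiseConvergenceCLM.precomp ℂ T, fun φ => ⟨T φ, hT φ, fun u => rfl⟩⟩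

/-! ### Covariance under time-frequency shifts -/

/-- The symbol `Z ↦ conj (a (X + Z))`. -/
def shiftConj (a : Phase n → ℂ) (X : Phase n) : Phase n → ℂ := fun Z => conj (a (X + Z))

/-- The substitutions ξ ↦ -X.2 - ξ and y ↦ y + X.1 absorb the time-frequency shift. The frequency
reflection in `transposeSymbol` cancels the sign coming from conjugating the character, so the
symbol ends up evaluated at X + Z. -/
theorem weylFormula_conj_timeFreqShift (a : Phase n → ℂ) (X : Phase n) (ψ : 𝓢(Cfg n, ℂ))
    (x : Cfg n) :
    weylFormula (transposeSymbol a) (conjSchwartz (timeFreqShift X ψ)) x =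
      conj (Complex.exp (Complex.I * (inner ℝ x X.2 : ℝ)) *
        weylFormula (shiftConj a X) ψ (x - X.1)) := by
  rw [weylFormula, weylFormula, map_mul, map_mul, Complex.conj_ofReal, mul_left_comm]
  congr 1
  rw [← integral_conj, ← integral_const_mul,
    ← integral_sub_left_eq_self _ volume (-X.2)]
  refine integral_congr_ae (Filter.Eventually.of_forall fun ξ => ?_)
  simp only
  rw [← integral_conj, ← integral_const_mul, ← integral_add_right_eq_self _ X.1]
  refine integral_congr_ae (Filter.Eventually.of_forall fun y => ?_)
  simp only [conjSchwartz_apply, timeFreqShift_apply, transposeSymbol, shiftConj, map_mul,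
    ← Complex.exp_conj, Complex.conj_I, Complex.conj_ofReal, Complex.conj_conj, add_sub_cancel_right]
  have e : ((2⁻¹ : ℝ) • (x + (y + X.1)), -(-X.2 - ξ)) =
      X + ((2⁻¹ : ℝ) • (x - X.1 + y), ξ) := by
    refine Prod.ext ?_ ?_
    · simp only [Prod.fst_add]
      module
    · simp only [Prod.snd_add]
      abel
  rw [e]
  have e2 : Complex.exp (Complex.I * (inner ℝ (x - (y + X.1)) (-X.2 - ξ) : ℝ)) *
      Complex.exp (-Complex.I * (inner ℝ (y + X.1) X.2 : ℝ)) =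
      Complex.exp (-Complex.I * (inner ℝ x X.2 : ℝ)) *
      Complex.exp (-Complex.I * (inner ℝ (x - X.1 - y) ξ : ℝ)) := by
    rw [← Complex.exp_add, ← Complex.exp_add]
    congr 1
    simp only [inner_sub_left, inner_sub_right, inner_add_left, inner_neg_right]
    push_cast
    ring
  linear_combination (a (X + ((2⁻¹ : ℝ) • (x - X.1 + y), ξ)) * conj (ψ y)) * e2

/-- The operator is moved from the distribution onto the window, which thereby becomes dependent on
X. Estimates for `A u` thus become estimates for `u` with a varying window. -/
theorem stft_weyl {a : Phase n → ℂ} {A : 𝓢'(Cfg n, ℂ) →L[ℂ] 𝓢'(Cfg n, ℂ)}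
    (hA : IsWeylQuantization a A) (ψ ρ : 𝓢(Cfg n, ℂ)) (X : Phase n)
    (hρ : ∀ x, ρ x = weylFormula (shiftConj a X) ψ x) (u : 𝓢'(Cfg n, ℂ)) :
    stft ψ (A u) X = stft ρ u X := by
  obtain ⟨χ, hχ, h⟩ := hA (conjSchwartz (timeFreqShift X ψ))
  rw [stft, h u, stft]
  congr 1
  ext x
  rw [hχ, weylFormula_conj_timeFreqShift, conjSchwartz_apply, timeFreqShift_apply, hρ]

theorem stft_add (ρ₁ ρ₂ : 𝓢(Cfg n, ℂ)) (u : 𝓢'(Cfg n, ℂ)) (X : Phase n) :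
    stft (ρ₁ + ρ₂) u X = stft ρ₁ u X + stft ρ₂ u X := by
  simp only [stft]
  rw [← map_add]
  congr 1
  ext x
  simp [conjSchwartz_apply, timeFreqShift_apply, mul_add]

theorem stft_smul (c : ℂ) (ρ : 𝓢(Cfg n, ℂ)) (u : 𝓢'(Cfg n, ℂ)) (X : Phase n) :
    stft (c • ρ) u X = conj c * stft ρ u X := by
  simp only [stft]
  rw [← smul_eq_mul, ← map_smul]
  congr 1
  ext x
  simp [conjSchwartz_apply, timeFreqShift_apply]
  ring

/-! ### Families of translated symbols -/

theorem contDiff_shiftConj {a : Phase n → ℂ} (ha : ContDiff ℝ ∞ a) (X : Phase n) :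
    ContDiff ℝ ∞ (shiftConj a X) :=
  Complex.conjCLE.contDiff.comp (ha.comp (contDiff_const.add contDiff_id))

theorem norm_iteratedFDeriv_shiftConj (a : Phase n → ℂ) (k : ℕ) (X Z : Phase n) :
    ‖iteratedFDeriv ℝ k (shiftConj a X) Z‖ = ‖iteratedFDeriv ℝ k a (X + Z)‖ := by
  have : shiftConj a X = Complex.conjLIE ∘ (fun Z => a (X + Z)) := rfl
  rw [this, Complex.conjLIE.norm_iteratedFDeriv_comp_left, iteratedFDeriv_comp_add_left]

theorem symFam_mul_of_bound {M : ℕ} {b : ι → Phase n → ℂ} (hs : ∀ i, ContDiff ℝ ∞ (b i))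
    (w : ι → ℝ) (hw : ∀ i, 0 ≤ w i)
    (h : ∀ k : ℕ, ∃ C : ℝ, ∀ i Z, w i * ‖iteratedFDeriv ℝ k (b i) Z‖ ≤ C * bracket Z ^ M) :
    SymFam M fun i Z => (w i : ℂ) * b i Z := by
  refine ⟨fun i => contDiff_const.mul (hs i), fun k => (h k).imp fun C hC i Z => ?_⟩
  have e : iteratedFDeriv ℝ k (fun Z => (w i : ℂ) * b i Z) Z =
      (w i : ℂ) • iteratedFDeriv ℝ k (b i) Z :=
    iteratedFDeriv_const_smul_apply' (a := (w i : ℂ)) (f := b i)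
      ((hs i).contDiffAt.of_le (by exact_mod_cast le_top))
  rw [e, norm_smul, Complex.norm_real, Real.norm_of_nonneg (hw i)]
  exact hC i Z

/-- By Peetre's inequality ⟨X + Z⟩ᵐ is at most a constant times ⟨X⟩ᵐ⟨Z⟩^|m|. The decay gained by
differentiating the symbol is discarded here. -/
theorem IsShubinSymbol.symFam_shiftConj {m : ℝ} {a : Phase n → ℂ} (ha : IsShubinSymbol m a) :
    SymFam ⌈|m|⌉₊ fun X Z => ((bracket X ^ (-m) : ℝ) : ℂ) * shiftConj a X Z := by
  refine symFam_mul_of_bound (fun X => contDiff_shiftConj ha.contDiff X) _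
    (fun X => Real.rpow_nonneg (bracket_pos X).le _) fun k => ?_
  obtain ⟨C, hC0, hC⟩ := ha.bound_nonneg k
  refine ⟨2 ^ |m| * C, fun X Z => ?_⟩
  rw [norm_iteratedFDeriv_shiftConj]
  have hX := bracket_pos X
  have hZ := bracket_pos Z
  calc bracket X ^ (-m) * ‖iteratedFDeriv ℝ k a (X + Z)‖
      ≤ bracket X ^ (-m) * (C * bracket (X + Z) ^ m) := by
        gcongr
        refine (hC _).trans ?_
        gcongr
        · exact one_le_bracket _
        · linarith [(Nat.cast_nonneg k : (0 : ℝ) ≤ k)]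
    _ ≤ bracket X ^ (-m) * (C * (2 ^ |m| * bracket X ^ m * bracket Z ^ |m|)) := by
        gcongr; exact bracket_rpow_add_le m X Z
    _ = 2 ^ |m| * C * bracket Z ^ |m| * (bracket X ^ (-m) * bracket X ^ m) := by ring
    _ = 2 ^ |m| * C * bracket Z ^ |m| := by
        rw [← Real.rpow_add hX, neg_add_cancel, Real.rpow_zero, mul_one]
    _ ≤ _ := by
        gcongr
        exact bracket_rpow_le_pow Z (Nat.le_ceil _)

theorem bracket_smul_le {θ : ℝ} (h0 : 0 ≤ θ) (h1 : θ ≤ 1) (Z : Phase n) :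
    bracket (θ • Z) ≤ bracket Z := by
  refine Real.sqrt_le_sqrt ?_
  have h2 : θ ^ 2 ≤ 1 := pow_le_one₀ h0 h1
  have e1 : ‖(θ • Z).1‖ ^ 2 = θ ^ 2 * ‖Z.1‖ ^ 2 := by
    rw [Prod.smul_fst, norm_smul, mul_pow, Real.norm_eq_abs, sq_abs]
  have e2 : ‖(θ • Z).2‖ ^ 2 = θ ^ 2 * ‖Z.2‖ ^ 2 := by
    rw [Prod.smul_snd, norm_smul, mul_pow, Real.norm_eq_abs, sq_abs]
  rw [e1, e2]
  have := mul_le_mul_of_nonneg_right h2 (sq_nonneg ‖Z.1‖)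
  have := mul_le_mul_of_nonneg_right h2 (sq_nonneg ‖Z.2‖)
  linarith

/-- Mean value inequality on the segment from X to X + Z, with Peetre's inequality for the gradient;
the extra power of ⟨Z⟩ is the length of the segment. -/
theorem IsShubinSymbol.norm_sub_le {m : ℝ} {a : Phase n → ℂ} (ha : IsShubinSymbol m a) :
    ∃ C : ℝ, 0 ≤ C ∧ ∀ X Z, ‖a (X + Z) - a X‖ ≤
      C * bracket X ^ (m - 1) * bracket Z ^ (|m - 1| + 1) := by
  obtain ⟨C, hC0, hC⟩ := ha.bound_nonneg 1
  refine ⟨C * 2 ^ |m - 1|, by positivity, fun X Z => ?_⟩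
  have hX := bracket_pos X
  have hZ := bracket_pos Z
  have hb : ∀ Y ∈ segment ℝ X (X + Z), ‖fderiv ℝ a Y‖ ≤
      C * (2 ^ |m - 1| * bracket X ^ (m - 1) * bracket Z ^ |m - 1|) := by
    rw [segment_eq_image']
    rintro _ ⟨θ, ⟨h0, h1⟩, rfl⟩
    have h := hC (X + θ • (X + Z - X))
    rw [← zero_add 1, ← norm_iteratedFDeriv_fderiv, norm_iteratedFDeriv_zero, zero_add,
      Nat.cast_one, add_sub_cancel_left] at h
    simp only [add_sub_cancel_left]
    refine h.trans ?_
    gcongr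
    refine (bracket_rpow_add_le (m - 1) X (θ • Z)).trans ?_
    gcongr
    · exact (bracket_pos _).le
    · exact bracket_smul_le h0 h1 Z
  have := Convex.norm_image_sub_le_of_norm_fderiv_le (𝕜 := ℝ)
    (fun Y _ => ha.contDiff.differentiable (by simp) Y) hb (convex_segment X (X + Z))
    (left_mem_segment ℝ X (X + Z)) (right_mem_segment ℝ X (X + Z))
  refine this.trans ?_
  rw [add_sub_cancel_left, Real.rpow_add hZ, Real.rpow_one]
  calc _ ≤ C * (2 ^ |m - 1| * bracket X ^ (m - 1) * bracket Z ^ |m - 1|) * bracket Z := by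
        gcongr; exact norm_le_bracket Z
    _ = _ := by ring

/-- Freezing the symbol at X gains one order: derivatives of order at least one do not see the
constant and are O(⟨X + Z⟩ᵐ⁻¹), while the function itself is controlled by
`IsShubinSymbol.norm_sub_le`. -/
theorem IsShubinSymbol.symFam_shiftConj_sub {m : ℝ} {a : Phase n → ℂ} (ha : IsShubinSymbol m a) :
    SymFam ⌈|m - 1| + 1⌉₊ fun X Z =>
      ((bracket X ^ (-(m - 1)) : ℝ) : ℂ) * (shiftConj a X Z + -conj (a X)) := by
  refine symFam_mul_of_bound (fun X => (contDiff_shiftConj ha.contDiff X).add contDiff_const) _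
    (fun X => Real.rpow_nonneg (bracket_pos X).le _) fun k => ?_
  have fin : ∀ D : ℝ, 0 ≤ D → ∀ (X Z : Phase n) (r : ℝ),
      r ≤ D * bracket X ^ (m - 1) * bracket Z ^ (|m - 1| + 1) →
      bracket X ^ (-(m - 1)) * r ≤ D * bracket Z ^ ⌈|m - 1| + 1⌉₊ := by
    intro D hD X Z r hr
    have hX := bracket_pos X
    calc bracket X ^ (-(m - 1)) * r
        ≤ bracket X ^ (-(m - 1)) * (D * bracket X ^ (m - 1) * bracket Z ^ (|m - 1| + 1)) := by
          gcongr
      _ = D * bracket Z ^ (|m - 1| + 1) * (bracket X ^ (-(m - 1)) * bracket X ^ (m - 1)) := by ring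
      _ = D * bracket Z ^ (|m - 1| + 1) := by
          rw [← Real.rpow_add hX, neg_add_cancel, Real.rpow_zero, mul_one]
      _ ≤ _ := by gcongr; exact bracket_rpow_le_pow Z (Nat.le_ceil _)
  rcases Nat.eq_zero_or_pos k with rfl | hk
  · obtain ⟨C, hC0, hC⟩ := ha.norm_sub_le
    refine ⟨C, fun X Z => fin C hC0 X Z _ ?_⟩
    rw [norm_iteratedFDeriv_zero]
    refine le_trans (le_of_eq ?_) (hC X Z)
    rw [shiftConj, ← map_neg, ← map_add, ← sub_eq_add_neg]
    exact Complex.norm_conj _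
  · obtain ⟨C, hC0, hC⟩ := ha.bound_nonneg k
    refine ⟨C * 2 ^ |m - 1|, fun X Z => fin _ (by positivity) X Z _ ?_⟩
    have e : iteratedFDeriv ℝ k (fun Z => shiftConj a X Z + -conj (a X)) Z =
        iteratedFDeriv ℝ k (shiftConj a X) Z := by
      have := iteratedFDeriv_add_apply (𝕜 := ℝ) (i := k) (f := shiftConj a X)
        (g := fun _ => -conj (a X)) (x := Z)
        ((contDiff_shiftConj ha.contDiff X).contDiffAt.of_le (by exact_mod_cast le_top))
        contDiff_const.contDiffAt
      rw [iteratedFDeriv_const_of_ne hk.ne'] at this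
      simpa [Pi.add_def] using this
    rw [e, norm_iteratedFDeriv_shiftConj]
    have hX := bracket_pos X
    have hZ := bracket_pos Z
    calc ‖iteratedFDeriv ℝ k a (X + Z)‖ ≤ C * bracket (X + Z) ^ (m - 1) := by
          refine (hC _).trans ?_
          gcongr
          · exact one_le_bracket _
          · exact_mod_cast hk
      _ ≤ C * (2 ^ |m - 1| * bracket X ^ (m - 1) * bracket Z ^ |m - 1|) := by
          gcongr; exact bracket_rpow_add_le _ X Z
      _ ≤ C * (2 ^ |m - 1| * bracket X ^ (m - 1) * bracket Z ^ (|m - 1| + 1)) := by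
          gcongr
          · exact one_le_bracket Z
          · linarith
      _ = _ := by ring

/-- If a symbol of order zero vanishes in the balls `|Z - X| < ε⟨X⟩`, `X ∈ Ω`, then its translates
are rapidly decreasing in `X ∈ Ω`. -/
theorem IsShubinSymbol.symFam_shiftConj_of_vanish {a : Phase n → ℂ} (ha : IsShubinSymbol 0 a)
    {Ω : Set (Phase n)} {ε : ℝ} (hε : 0 < ε)
    (h : ∀ X ∈ Ω, ∀ Z, ‖Z‖ < ε * bracket X → a (X + Z) = 0) (K : ℕ) :
    SymFam K fun (X : Ω) Z => ((bracket (X : Phase n) ^ K : ℝ) : ℂ) * shiftConj a X Z := by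
  refine symFam_mul_of_bound (fun X : Ω => contDiff_shiftConj ha.contDiff X)
    (fun X => bracket (X : Phase n) ^ K) (fun X => pow_nonneg (bracket_pos _).le _) fun k => ?_
  obtain ⟨C, hC0, hC⟩ := ha.bound_nonneg k
  refine ⟨C * (ε⁻¹) ^ K, fun X Z => ?_⟩
  have hX := bracket_pos (X : Phase n)
  have hZ := bracket_pos Z
  -- Inside the ball the translate vanishes with all derivatives; outside it ⟨X⟩ ≤ ε⁻¹⟨Z⟩, so the
  -- growth allowed in Z pays for ⟨X⟩ᴷ.
  by_cases hlt : ‖Z‖ < ε * bracket (X : Phase n)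
  · have hev : shiftConj a X =ᶠ[nhds Z] fun _ => 0 := by
      have ho : IsOpen {Z : Phase n | ‖Z‖ < ε * bracket (X : Phase n)} :=
        isOpen_lt continuous_norm continuous_const
      filter_upwards [ho.mem_nhds hlt] with W hW
      rw [shiftConj, h X X.2 W hW, map_zero]
    rw [(Filter.EventuallyEq.iteratedFDeriv ℝ hev k).eq_of_nhds]
    rw [iteratedFDeriv_fun_zero, Pi.zero_apply, norm_zero, mul_zero]
    positivity
  · rw [norm_iteratedFDeriv_shiftConj]
    have h1 : bracket (X : Phase n) ≤ ε⁻¹ * bracket Z := by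
      rw [inv_mul_eq_div, le_div_iff₀ hε]
      linarith [not_lt.1 hlt, norm_le_bracket Z]
    have h2 : ‖iteratedFDeriv ℝ k a (X + Z)‖ ≤ C := by
      refine (hC _).trans (mul_le_of_le_one_right hC0 ?_)
      refine Real.rpow_le_one_of_one_le_of_nonpos (one_le_bracket _) ?_
      simp
    calc bracket (X : Phase n) ^ K * ‖iteratedFDeriv ℝ k a (X + Z)‖
        ≤ (ε⁻¹ * bracket Z) ^ K * C := by gcongr
      _ = _ := by rw [mul_pow]; ring

/-! ### The short-time Fourier transform of Schwartz functions -/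

/-- The short-time Fourier transform `(f, Π(X)g)` of a Schwartz function. -/
def ambig (f g : 𝓢(Cfg n, ℂ)) (X : Phase n) : ℂ := ∫ t, f t * conj (timeFreqShift X g t)

theorem norm_timeFreqShift (X : Phase n) (g : 𝓢(Cfg n, ℂ)) (t : Cfg n) :
    ‖timeFreqShift X g t‖ = ‖g (t - X.1)‖ := by
  rw [timeFreqShift_apply, norm_mul, norm_cexp_I_mul, one_mul]

theorem continuous_timeFreqShift (g : 𝓢(Cfg n, ℂ)) :
    Continuous fun p : Phase n × Cfg n => timeFreqShift p.1 g p.2 := by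
  have := g.continuous
  simp_rw [timeFreqShift_apply]
  fun_prop

theorem continuous_timeFreqShift_left (g : 𝓢(Cfg n, ℂ)) (t : Cfg n) :
    Continuous fun X : Phase n => timeFreqShift X g t := by
  have := g.continuous
  simp_rw [timeFreqShift_apply]
  fun_prop

theorem SBdd.norm_le {f : ι → 𝓢(Cfg n, ℂ)} (hf : SBdd f) : ∃ C : ℝ, 0 ≤ C ∧ ∀ i x, ‖f i x‖ ≤ C := by
  obtain ⟨C, hC0, hC⟩ := hf.one_add_norm 0 0
  exact ⟨C, hC0, fun i x => by simpa using hC i x⟩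

theorem continuous_ambig (f g : 𝓢(Cfg n, ℂ)) : Continuous (ambig f g) := by
  obtain ⟨C, hC0, hC⟩ := (sBdd_const (ι := Unit) g).norm_le
  refine continuous_of_dominated (bound := fun t => ‖f t‖ * C) (fun X => ?_) (fun X => ?_)
    (f.integrable.norm.mul_const C) (Filter.Eventually.of_forall fun t => ?_)
  · exact (f.continuous.mul (Complex.continuous_conj.comp
      (timeFreqShift X g).continuous)).aestronglyMeasurable
  · refine Filter.Eventually.of_forall fun t => ?_
    rw [norm_mul, Complex.norm_conj, norm_timeFreqShift]
    gcongr
    exact hC () _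
  · exact continuous_const.mul (Complex.continuous_conj.comp (continuous_timeFreqShift_left g t))

theorem conj_timeFreqShift_apply (X : Phase n) (g : 𝓢(Cfg n, ℂ)) (t : Cfg n) :
    conj (timeFreqShift X g t) =
      Complex.exp (-(Complex.I * (inner ℝ t X.2 : ℝ))) * conj (g (t - X.1)) := by
  rw [timeFreqShift_apply, map_mul, ← Complex.exp_conj, map_mul, Complex.conj_I,
    Complex.conj_ofReal, neg_mul]

/-- At x = 0 the midpoint is t/2, whence the factor 2 in the symbol. In this form the decay in
frequency can be read off from `norm_weylInner_le`. -/
theorem ambig_eq_weylInner (f g : 𝓢(Cfg n, ℂ)) (X : Phase n) :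
    ambig f g X = weylInner (fun Z => conj (g ((2 : ℝ) • Z.1 - X.1))) f 0 X.2 := by
  refine integral_congr_ae (Filter.Eventually.of_forall fun t => ?_)
  simp only [conj_timeFreqShift_apply, zero_sub, zero_add, inner_neg_left]
  rw [smul_inv_smul₀ (by norm_num)]
  push_cast
  ring_nf

theorem ambig_covariance (f g : 𝓢(Cfg n, ℂ)) (X Y : Phase n) :
    ambig (timeFreqShift Y f) g X =
      Complex.exp (Complex.I * (inner ℝ Y.1 (Y.2 - X.2) : ℝ)) * ambig f g (X - Y) := by
  rw [ambig, ambig, ← integral_const_mul, ← integral_add_right_eq_self _ Y.1]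
  refine integral_congr_ae (Filter.Eventually.of_forall fun t => ?_)
  simp only [conj_timeFreqShift_apply]
  simp only [timeFreqShift_apply, add_sub_cancel_right]
  have e1 : t + Y.1 - X.1 = t - (X - Y).1 := by simp only [Prod.fst_sub]; abel
  have e2 : Complex.exp (Complex.I * (inner ℝ (t + Y.1) Y.2 : ℝ)) *
      Complex.exp (-(Complex.I * (inner ℝ (t + Y.1) X.2 : ℝ))) =
      Complex.exp (Complex.I * (inner ℝ Y.1 (Y.2 - X.2) : ℝ)) *
      Complex.exp (-(Complex.I * (inner ℝ t (X - Y).2 : ℝ))) := by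
    rw [← Complex.exp_add, ← Complex.exp_add]
    congr 1
    simp only [Prod.snd_sub, inner_sub_right, inner_add_left]
    push_cast
    ring
  rw [e1]
  linear_combination (f t * conj (g (t - (X - Y).1))) * e2

theorem norm_ambig_timeFreqShift (f g : 𝓢(Cfg n, ℂ)) (X Y : Phase n) :
    ‖ambig (timeFreqShift Y f) g X‖ = ‖ambig f g (X - Y)‖ := by
  rw [ambig_covariance, norm_mul, norm_cexp_I_mul, one_mul]

theorem continuous_ambig_timeFreqShift (f g : 𝓢(Cfg n, ℂ)) :
    Continuous fun p : Phase n × Phase n => ambig (timeFreqShift p.2 f) g p.1 := by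
  simp_rw [ambig_covariance]
  have := continuous_ambig f g
  fun_prop

/-- Since 1 + ‖p‖ ≤ 4⟨Z⟩(1 + ‖2Z.1 - p‖), the weight in the position p is paid partly by the decay
of the window and partly by growth in Z. -/
theorem symFam_window {g : ι → 𝓢(Cfg n, ℂ)} (hg : SBdd g) (N : ℕ) :
    SymFam N fun (p : ι × Cfg n) (Z : Phase n) =>
      (((1 + ‖p.2‖) ^ N : ℝ) : ℂ) * conj (g p.1 ((2 : ℝ) • Z.1 - p.2)) := by
  let L : Phase n →L[ℝ] Cfg n := (2 : ℝ) • ContinuousLinearMap.fst ℝ (Cfg n) (Cfg n)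
  have hL : ‖L‖ ≤ 2 := by
    refine ContinuousLinearMap.opNorm_le_bound _ (by norm_num) fun Z => ?_
    have : ‖L Z‖ = 2 * ‖Z.1‖ := by simp [L, norm_smul]
    rw [this]
    gcongr
    exact le_max_left _ _
  have hs : ∀ p : ι × Cfg n, ContDiff ℝ ∞ (fun x => g p.1 (x - p.2)) := fun p =>
    ((g p.1).smooth ⊤).comp (contDiff_id.sub contDiff_const)
  refine symFam_mul_of_bound (b := fun (p : ι × Cfg n) (Z : Phase n) =>
    conj (g p.1 ((2 : ℝ) • Z.1 - p.2))) (fun p => ?_) (fun p => (1 + ‖p.2‖) ^ N)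
    (fun p => by positivity) fun k => ?_
  · exact Complex.conjCLE.contDiff.comp ((hs p).comp L.contDiff)
  · obtain ⟨C, hC0, hC⟩ := hg.one_add_norm N k
    refine ⟨4 ^ N * (C * 2 ^ k), fun p Z => ?_⟩
    have e : (fun Z : Phase n => conj (g p.1 ((2 : ℝ) • Z.1 - p.2))) =
      Complex.conjLIE ∘ ((fun x => g p.1 (x - p.2)) ∘ L) := rfl
    rw [e, Complex.conjLIE.norm_iteratedFDeriv_comp_left,
      L.iteratedFDeriv_comp_right (hs p) Z (by exact_mod_cast le_top)]
    have h1 : ‖(iteratedFDeriv ℝ k (fun x => g p.1 (x - p.2)) (L Z)).compContinuousLinearMap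
        fun _ => L‖ ≤ C * ((1 + ‖L Z - p.2‖) ^ N)⁻¹ * 2 ^ k := by
      refine (ContinuousMultilinearMap.norm_compContinuousLinearMap_le _ _).trans ?_
      rw [Finset.prod_const, Finset.card_univ, Fintype.card_fin, iteratedFDeriv_comp_sub]
      gcongr
      exact hC _ _
    have h2 : 1 + ‖p.2‖ ≤ 4 * bracket Z * (1 + ‖L Z - p.2‖) := by
      have a1 : ‖p.2‖ ≤ ‖L Z‖ + ‖L Z - p.2‖ := by
        have := norm_sub_le (L Z) (L Z - p.2)
        rwa [sub_sub_cancel] at this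
      have a2 : ‖L Z‖ ≤ 2 * bracket Z := by
        refine (L.le_opNorm Z).trans ?_
        gcongr
        exact norm_le_bracket Z
      have a3 := one_le_bracket Z
      nlinarith [norm_nonneg (L Z - p.2)]
    have hZ := bracket_pos Z
    calc _ ≤ (4 * bracket Z * (1 + ‖L Z - p.2‖)) ^ N *
          (C * ((1 + ‖L Z - p.2‖) ^ N)⁻¹ * 2 ^ k) := by gcongr
      _ = _ := by
        rw [mul_pow, mul_pow]
        field_simp

/-- The position X.1 is made part of the index of the symbol family, so the uniform bound of
`norm_weylInner_le` yields decay in X.1 (through the weight in `symFam_window`) and in X.2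
simultaneously. Evaluation at x = 0 removes the growth factor in x. -/
theorem norm_ambig_le {f g : ι → 𝓢(Cfg n, ℂ)} (hf : SBdd f) (hg : SBdd g) (N : ℕ) :
    ∃ C : ℝ, 0 ≤ C ∧ ∀ i X, ‖ambig (f i) (g i) X‖ ≤ C * bracket X ^ (-(N : ℝ)) := by
  obtain ⟨C, hC0, hC⟩ := norm_weylInner_le (symFam_window hg N)
    (hf.comp (fun p : ι × Cfg n => p.1)) N
  refine ⟨C, hC0, fun i X => ?_⟩
  have h := hC (i, X.1) 0 X.2
  have e : weylInner (fun Z : Phase n => (((1 + ‖X.1‖) ^ N : ℝ) : ℂ) *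
      conj (g i ((2 : ℝ) • Z.1 - X.1))) (f i) 0 X.2 =
      (((1 + ‖X.1‖) ^ N : ℝ) : ℂ) * ambig (f i) (g i) X := by
    rw [ambig_eq_weylInner, weylInner, weylInner, ← integral_const_mul]
    refine integral_congr_ae (Filter.Eventually.of_forall fun t => ?_)
    simp only
    ring
  simp only [e, norm_mul, Complex.norm_real, norm_zero, add_zero, one_pow, mul_one] at h
  rw [Real.norm_of_nonneg (by positivity)] at h
  have hX := bracket_pos X
  rw [Real.rpow_neg hX.le, Real.rpow_natCast, ← div_eq_mul_inv, le_div_iff₀ (by positivity)]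
  rw [← div_eq_mul_inv, le_div_iff₀ (by positivity)] at h
  calc ‖ambig (f i) (g i) X‖ * bracket X ^ N
      ≤ ‖ambig (f i) (g i) X‖ * ((1 + ‖X.1‖) * (1 + ‖X.2‖)) ^ N := by
        gcongr; exact bracket_le_mul X
    _ = (1 + ‖X.1‖) ^ N * ‖ambig (f i) (g i) X‖ * (1 + ‖X.2‖) ^ N := by rw [mul_pow]; ring
    _ ≤ C := h

theorem integrable_bracket_mul_ambig (f g : 𝓢(Cfg n, ℂ)) (K : ℕ) :
    Integrable fun Y => bracket Y ^ K * ‖ambig f g Y‖ := by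
  obtain ⟨C, hC0, hC⟩ := norm_ambig_le (sBdd_const (ι := Unit) f) (sBdd_const g) (K + (2 * n + 1))
  have hi : Integrable (fun X : Phase n => bracket X ^ (-((2 * n + 1 : ℕ) : ℝ))) :=
    integrable_bracket_rpow_neg (by exact_mod_cast Nat.lt_succ_self _)
  refine (hi.const_mul C).mono' ?_ (Filter.Eventually.of_forall fun Y => ?_)
  · exact ((continuous_bracket.pow K).mul (continuous_ambig f g).norm).aestronglyMeasurable
  · have hY := bracket_pos Y
    rw [norm_mul, norm_norm, Real.norm_of_nonneg (by positivity)]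
    calc bracket Y ^ K * ‖ambig f g Y‖
        ≤ bracket Y ^ K * (C * bracket Y ^ (-((K + (2 * n + 1) : ℕ) : ℝ))) := by
          gcongr; exact hC () Y
      _ = _ := by
          rw [Real.rpow_neg hY.le, Real.rpow_neg hY.le, Real.rpow_natCast, Real.rpow_natCast,
            pow_add]
          field_simp

theorem integrable_ambig (f g : 𝓢(Cfg n, ℂ)) : Integrable (ambig f g) :=
  (integrable_norm_iff (continuous_ambig f g).aestronglyMeasurable).1
    (by simpa using integrable_bracket_mul_ambig f g 0)

/-- The constant in the inversion formula for the short-time Fourier transform. -/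
def inversionConst (ψ : 𝓢(Cfg n, ℂ)) : ℂ := ((2 * Real.pi) ^ n : ℝ) * (∫ t, ψ t * conj (ψ t))

theorem inversionConst_ne_zero {ψ : 𝓢(Cfg n, ℂ)} (hψ : ψ ≠ 0) : inversionConst ψ ≠ 0 := by
  refine mul_ne_zero (by exact_mod_cast (by positivity : ((2 * Real.pi) ^ n : ℝ) ≠ 0)) ?_
  have e : (∫ t, ψ t * conj (ψ t)) = ((∫ t, ‖ψ t‖ ^ 2 : ℝ) : ℂ) := by
    rw [← integral_complex_ofReal]
    refine integral_congr_ae (Filter.Eventually.of_forall fun t => ?_)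
    simp [Complex.mul_conj, Complex.normSq_eq_norm_sq]
  rw [e, Complex.ofReal_ne_zero]
  obtain ⟨t₀, ht₀⟩ : ∃ t, ψ t ≠ 0 := by
    by_contra! h
    exact hψ (by ext t; simpa using h t)
  have hc : Continuous fun t => ‖ψ t‖ ^ 2 := ψ.continuous.norm.pow 2
  have hi : Integrable fun t => ‖ψ t‖ ^ 2 := (ψ.memLp 2).integrable_norm_pow (by norm_num)
  refine ((integral_pos_iff_support_of_nonneg (fun t => by positivity) hi).2 ?_).ne'
  exact hc.isOpen_support.measure_pos _ ⟨t₀, by simpa using ht₀⟩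

/-- The inversion formula for the short-time Fourier transform of Schwartz functions. -/
theorem integral_ambig_mul_timeFreqShift (f ψ : 𝓢(Cfg n, ℂ)) (t : Cfg n) :
    ∫ Y, ambig f ψ Y * timeFreqShift Y ψ t = inversionConst ψ * f t := by
  obtain ⟨C, hC0, hC⟩ := (sBdd_const (ι := Unit) ψ).norm_le
  have hint : Integrable (fun Y => ambig f ψ Y * timeFreqShift Y ψ t) := by
    refine ((integrable_ambig f ψ).norm.mul_const C).mono'
      ((continuous_ambig f ψ).mul (continuous_timeFreqShift_left ψ t)).aestronglyMeasurable
      (Filter.Eventually.of_forall fun Y => ?_)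
    rw [norm_mul, norm_timeFreqShift]
    gcongr
    exact hC () _
  rw [Measure.volume_eq_prod, integral_prod _ (by rwa [Measure.volume_eq_prod] at hint)]
  -- For a fixed position x, the frequency integral is Fourier inversion for s ↦ conj(ψ(s - x))
  -- f(s).
  have key : ∀ x : Cfg n, ∫ ξ, ambig f ψ (x, ξ) * timeFreqShift (x, ξ) ψ t =
      (((2 * Real.pi) ^ n : ℝ) * f t) * (ψ (t - x) * conj (ψ (t - x))) := fun x => by
    let g : 𝓢(Cfg n, ℂ) := conjSchwartz (SchwartzMap.compSubConstCLM ℂ x ψ)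
    let h : 𝓢(Cfg n, ℂ) := SchwartzMap.smulLeftCLM ℂ g f
    have hh : ∀ s, h s = conj (ψ (s - x)) * f s := fun s => by
      simp only [h, SchwartzMap.smulLeftCLM_apply_apply g.hasTemperateGrowth, smul_eq_mul, g,
        conjSchwartz_apply, SchwartzMap.compSubConstCLM_apply]
    have ha : ∀ ξ, ambig f ψ (x, ξ) = FourierTransform.fourier (h : Cfg n → ℂ)
        ((2 * Real.pi)⁻¹ • ξ) := fun ξ => by
      rw [ambig_eq_weylInner, weylInner_eq_fourier]
      simp only [inner_zero_left, Complex.ofReal_zero, mul_zero, Complex.exp_zero, one_mul,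
        zero_add]
      have e : (fun y => conj (ψ ((2 : ℝ) • (2⁻¹ : ℝ) • y - x)) * f y) = h := by
        funext s
        rw [hh, smul_inv_smul₀ (by norm_num)]
      rw [e]
    have := integral_cexp_mul_fourier h t
    calc ∫ ξ, ambig f ψ (x, ξ) * timeFreqShift (x, ξ) ψ t
        = ∫ ξ, (Complex.exp (Complex.I * (inner ℝ t ξ : ℝ)) *
          FourierTransform.fourier (h : Cfg n → ℂ) ((2 * Real.pi)⁻¹ • ξ)) * ψ (t - x) := by
          refine integral_congr_ae (Filter.Eventually.of_forall fun ξ => ?_)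
          simp only [ha, timeFreqShift_apply]
          ring
      _ = _ := by
          rw [integral_mul_const, this, hh]
          ring
  simp_rw [key]
  rw [integral_const_mul, integral_sub_left_eq_self (fun s => ψ s * conj (ψ s)) volume t,
    inversionConst]
  ring

/-- The bilinear pairing of `Π(Y)ψ` with a Schwartz function. -/
def pairShift (ψ φ : 𝓢(Cfg n, ℂ)) (Y : Phase n) : ℂ := ∫ t, timeFreqShift Y ψ t * φ t

theorem pairShift_eq_conj (ψ φ : 𝓢(Cfg n, ℂ)) (Y : Phase n) :
    pairShift ψ φ Y = conj (ambig (conjSchwartz φ) ψ Y) := by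
  rw [ambig, ← integral_conj]
  refine integral_congr_ae (Filter.Eventually.of_forall fun t => ?_)
  simp only [conjSchwartz_apply, map_mul, Complex.conj_conj]
  ring

theorem conjSchwartz_conjSchwartz (φ : 𝓢(Cfg n, ℂ)) : conjSchwartz (conjSchwartz φ) = φ := by
  ext t; simp [conjSchwartz_apply]

theorem pairShift_conj_timeFreqShift (ψ ρ : 𝓢(Cfg n, ℂ)) (X Y : Phase n) :
    pairShift ψ (conjSchwartz (timeFreqShift X ρ)) Y = ambig (timeFreqShift Y ψ) ρ X := by
  rw [pairShift, ambig]
  simp only [conjSchwartz_apply]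

theorem continuous_pairShift (ψ φ : 𝓢(Cfg n, ℂ)) : Continuous (pairShift ψ φ) := by
  have := continuous_ambig (conjSchwartz φ) ψ
  rw [funext (pairShift_eq_conj ψ φ)]
  exact Complex.continuous_conj.comp this

theorem norm_pairShift (ψ φ : 𝓢(Cfg n, ℂ)) (Y : Phase n) :
    ‖pairShift ψ φ Y‖ = ‖ambig (conjSchwartz φ) ψ Y‖ := by
  rw [pairShift_eq_conj, Complex.norm_conj]

/-- Fubini's theorem for superpositions of time-frequency shifts. -/
theorem integral_superposition_mul (ψ φ : 𝓢(Cfg n, ℂ)) {F : Phase n → ℂ} (hF : Integrable F) :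
    ∫ t, (∫ Y, F Y * timeFreqShift Y ψ t) * φ t = ∫ Y, F Y * pairShift ψ φ Y := by
  obtain ⟨C, hC0, hC⟩ := (sBdd_const (ι := Unit) ψ).norm_le
  have hint : Integrable (fun p : Phase n × Cfg n => F p.1 * timeFreqShift p.1 ψ p.2 * φ p.2)
      (volume.prod volume) := by
    refine ((hF.norm.mul_prod φ.integrable.norm).mul_const C).mono' ?_
      (Filter.Eventually.of_forall fun p => ?_)
    · exact (hF.aestronglyMeasurable.comp_fst.mul
        (continuous_timeFreqShift ψ).aestronglyMeasurable).mul
        φ.continuous.aestronglyMeasurable.comp_snd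
    · rw [norm_mul, norm_mul, norm_timeFreqShift]
      have := hC () (p.2 - p.1.1)
      calc _ ≤ ‖F p.1‖ * C * ‖φ p.2‖ := by gcongr
        _ = _ := by ring
  have := integral_integral_swap (f := fun Y t => F Y * timeFreqShift Y ψ t * φ t) hint
  calc _ = ∫ t, ∫ Y, F Y * timeFreqShift Y ψ t * φ t := by
        simp_rw [integral_mul_const]
    _ = ∫ Y, ∫ t, F Y * timeFreqShift Y ψ t * φ t := this.symm
    _ = _ := by
        simp_rw [mul_assoc, integral_const_mul]
        rfl

theorem integral_ambig_mul_pairShift (f ψ φ : 𝓢(Cfg n, ℂ)) :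
    ∫ Y, ambig f ψ Y * pairShift ψ φ Y = inversionConst ψ * ∫ t, f t * φ t := by
  rw [← integral_superposition_mul ψ φ (integrable_ambig f ψ), ← integral_const_mul]
  simp_rw [integral_ambig_mul_timeFreqShift, mul_assoc]

/-! ### Superpositions of time-frequency shifts -/

/-- The superposition `∫ F(Y) Π(Y)ψ dY`. -/
def superpos (ψ : 𝓢(Cfg n, ℂ)) (F : Phase n → ℂ) (t : Cfg n) : ℂ :=
  ∫ Y, F Y * timeFreqShift Y ψ t

/-- All polynomial moments of `F` are integrable. -/
structure RapidInt (F : Phase n → ℂ) : Prop where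
  meas : AEStronglyMeasurable F volume
  moment : ∀ K : ℕ, Integrable fun Y => bracket Y ^ K * ‖F Y‖

theorem RapidInt.integrable {F : Phase n → ℂ} (hF : RapidInt F) : Integrable F :=
  (integrable_norm_iff hF.meas).1 (by simpa using hF.moment 0)

theorem RapidInt.mul {F : Phase n → ℂ} (hF : RapidInt F) {p : Phase n → ℂ} (hp : Continuous p)
    (hb : ∀ Y, ‖p Y‖ ≤ bracket Y) :
    RapidInt (fun Y => p Y * F Y) ∧ ∀ K : ℕ,
      ∫ Y, bracket Y ^ K * ‖p Y * F Y‖ ≤ ∫ Y, bracket Y ^ (K + 1) * ‖F Y‖ := by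
  have hm : AEStronglyMeasurable (fun Y => p Y * F Y) volume :=
    hp.aestronglyMeasurable.mul hF.meas
  have hle : ∀ (K : ℕ) Y, bracket Y ^ K * ‖p Y * F Y‖ ≤ bracket Y ^ (K + 1) * ‖F Y‖ :=
    fun K Y => by
      have hY := bracket_pos Y
      rw [norm_mul, pow_succ, mul_assoc]
      gcongr
      exact hb Y
  have hi : ∀ K : ℕ, Integrable fun Y => bracket Y ^ K * ‖p Y * F Y‖ := fun K => by
    refine (hF.moment (K + 1)).mono'
      ((continuous_bracket.pow K).aestronglyMeasurable.mul hm.norm)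
      (Filter.Eventually.of_forall fun Y => ?_)
    have hY := bracket_pos Y
    rw [Real.norm_of_nonneg (by positivity)]
    exact hle K Y
  exact ⟨⟨hm, hi⟩, fun K => integral_mono (hi K) (hF.moment (K + 1)) (hle K)⟩

theorem rapidInt_ambig (f g : 𝓢(Cfg n, ℂ)) : RapidInt (ambig f g) :=
  ⟨(continuous_ambig f g).aestronglyMeasurable, integrable_bracket_mul_ambig f g⟩

theorem norm_pow_mul_timeFreqShift_le (ψ : 𝓢(Cfg n, ℂ)) (k : ℕ) :
    ∃ C : ℝ, 0 ≤ C ∧ ∀ Y t, ‖t‖ ^ k * ‖timeFreqShift Y ψ t‖ ≤ C * bracket Y ^ k := by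
  obtain ⟨C, hC0, hC⟩ := (sBdd_const (ι := Unit) ψ).one_add_norm k 0
  refine ⟨2 ^ k * C, by positivity, fun Y t => ?_⟩
  have h := hC () (t - Y.1)
  rw [norm_iteratedFDeriv_zero] at h
  rw [norm_timeFreqShift]
  have hY := one_le_bracket Y
  have h1 : ‖t‖ ≤ 2 * bracket Y * (1 + ‖t - Y.1‖) := by
    have a := norm_add_le (t - Y.1) Y.1
    rw [sub_add_cancel] at a
    nlinarith [norm_fst_le_bracket Y, norm_nonneg (t - Y.1)]
  calc ‖t‖ ^ k * ‖ψ (t - Y.1)‖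
      ≤ (2 * bracket Y * (1 + ‖t - Y.1‖)) ^ k * (C * ((1 + ‖t - Y.1‖) ^ k)⁻¹) := by gcongr
    _ = _ := by
      rw [mul_pow, mul_pow]
      field_simp

theorem integrable_superpos_integrand (ψ : 𝓢(Cfg n, ℂ)) {F : Phase n → ℂ} (hF : Integrable F)
    (t : Cfg n) : Integrable fun Y => F Y * timeFreqShift Y ψ t := by
  obtain ⟨C, hC0, hC⟩ := norm_pow_mul_timeFreqShift_le ψ 0
  refine (hF.norm.mul_const C).mono' (hF.aestronglyMeasurable.mul
    (continuous_timeFreqShift_left ψ t).aestronglyMeasurable)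
    (Filter.Eventually.of_forall fun Y => ?_)
  rw [norm_mul]
  gcongr
  simpa using hC Y t

theorem hasFDerivAt_timeFreqShift (ψ : 𝓢(Cfg n, ℂ)) (Y : Phase n) (t : Cfg n) :
    HasFDerivAt (fun t => timeFreqShift Y ψ t)
      (∑ j, (EuclideanSpace.proj j : Cfg n →L[ℝ] ℝ).smulRight
        (Complex.I * (inner ℝ (EuclideanSpace.single j (1 : ℝ)) Y.2 : ℝ) * timeFreqShift Y ψ t +
          timeFreqShift Y (LineDeriv.lineDerivOp (EuclideanSpace.single j (1 : ℝ)) ψ) t)) t := by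
  have h1 : HasFDerivAt (fun t : Cfg n => inner ℝ t Y.2) (innerSL ℝ Y.2) t := by
    refine (innerSL ℝ Y.2).hasFDerivAt.congr_of_eventuallyEq
      (Filter.Eventually.of_forall fun s => ?_)
    simp [real_inner_comm]
  have h2 := ((Complex.ofRealCLM.hasFDerivAt.comp t h1).const_mul Complex.I).cexp
  have h3 : HasFDerivAt (fun t => ψ (t - Y.1)) (fderiv ℝ ψ (t - Y.1)) t := by
    have := (ψ.hasFDerivAt (t - Y.1)).comp t ((hasFDerivAt_id t).sub_const Y.1)
    simpa [Function.comp_def] using this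
  have h4 := h2.mul h3
  have e : (fun t => timeFreqShift Y ψ t) = fun t =>
      Complex.exp (Complex.I * (inner ℝ t Y.2 : ℝ)) * ψ (t - Y.1) :=
    funext (timeFreqShift_apply Y ψ)
  rw [e]
  refine h4.congr_fderiv ((clm_eq_sum_proj _).trans ?_)
  refine Finset.sum_congr rfl fun j _ => ?_
  congr 1
  simp only [timeFreqShift_apply, SchwartzMap.lineDerivOp_apply_eq_fderiv]
  simp [real_inner_comm]
  ring

theorem hasFDerivAt_superpos (ψ : 𝓢(Cfg n, ℂ)) {F : Phase n → ℂ} (hF : RapidInt F) (t : Cfg n) :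
    HasFDerivAt (superpos ψ F) (∑ j, (EuclideanSpace.proj j : Cfg n →L[ℝ] ℝ).smulRight
      (superpos ψ (fun Y => Complex.I * (inner ℝ (EuclideanSpace.single j (1 : ℝ)) Y.2 : ℝ) * F Y) t
        + superpos (LineDeriv.lineDerivOp (EuclideanSpace.single j (1 : ℝ)) ψ) F t)) t := by
  let e : Fin n → Cfg n := fun j => EuclideanSpace.single j 1
  let p : Fin n → Phase n → ℂ := fun j Y => Complex.I * (inner ℝ (e j) Y.2 : ℝ)
  have hpc : ∀ j, Continuous (p j) := fun j => by fun_prop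
  have hpb : ∀ j Y, ‖p j Y‖ ≤ bracket Y := fun j Y => by
    rw [norm_mul, Complex.norm_I, one_mul, Complex.norm_real]
    refine (norm_inner_le_norm _ _).trans ?_
    simpa [e] using norm_snd_le_bracket Y
  let d : Fin n → 𝓢(Cfg n, ℂ) := fun j => LineDeriv.lineDerivOp (e j) ψ
  have hI1 : ∀ j, Integrable fun Y => (p j Y * F Y) * timeFreqShift Y ψ t := fun j =>
    integrable_superpos_integrand ψ (hF.mul (hpc j) (hpb j)).1.integrable t
  have hI2 : ∀ j, Integrable fun Y => F Y * timeFreqShift Y (d j) t := fun j =>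
    integrable_superpos_integrand (d j) hF.integrable t
  let F' : Cfg n → Phase n → Cfg n →L[ℝ] ℂ := fun t Y =>
    ∑ j, ContinuousLinearMap.smulRightL ℝ (Cfg n) ℂ (EuclideanSpace.proj j)
      ((p j Y * F Y) * timeFreqShift Y ψ t + F Y * timeFreqShift Y (d j) t)
  have hI : ∀ j, Integrable fun Y =>
      ContinuousLinearMap.smulRightL ℝ (Cfg n) ℂ (EuclideanSpace.proj j)
      ((p j Y * F Y) * timeFreqShift Y ψ t + F Y * timeFreqShift Y (d j) t) := fun j =>
    ContinuousLinearMap.integrable_comp _ ((hI1 j).add (hI2 j))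
  have hFm : AEStronglyMeasurable (fun Y => F' t Y) volume :=
    Finset.aestronglyMeasurable_fun_sum Finset.univ fun j _ => (hI j).aestronglyMeasurable
  have eq : ∑ j, (EuclideanSpace.proj j : Cfg n →L[ℝ] ℝ).smulRight
      (superpos ψ (fun Y => p j Y * F Y) t + superpos (d j) F t) = ∫ Y, F' t Y := by
    rw [integral_finsetSum _ fun j _ => hI j]
    refine Finset.sum_congr rfl fun j _ => ?_
    rw [ContinuousLinearMap.integral_comp_comm _ (by exact (hI1 j).add (hI2 j)),
      integral_add (hI1 j) (hI2 j)]
    rfl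
  change HasFDerivAt _ (∑ j, (EuclideanSpace.proj j : Cfg n →L[ℝ] ℝ).smulRight
      (superpos ψ (fun Y => p j Y * F Y) t + superpos (d j) F t)) t
  rw [eq]
  obtain ⟨C, hC0, hC⟩ := norm_pow_mul_timeFreqShift_le ψ 0
  choose D hD0 hD using fun j => norm_pow_mul_timeFreqShift_le (d j) 0
  refine hasFDerivAt_integral_of_dominated_of_fderiv_le
    (F := fun t Y => F Y * timeFreqShift Y ψ t) (F' := F')
    (bound := fun Y => ∑ j, (bracket Y ^ 1 * ‖F Y‖ * C + ‖F Y‖ * D j))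
    (s := Set.univ) Filter.univ_mem
    (Filter.Eventually.of_forall fun t =>
      (integrable_superpos_integrand ψ hF.integrable t).aestronglyMeasurable)
    (integrable_superpos_integrand ψ hF.integrable t) hFm
    (Filter.Eventually.of_forall fun Y t _ => ?_)
    (integrable_finsetSum _ fun j _ => ((hF.moment 1).mul_const C).add
      (hF.integrable.norm.mul_const (D j)))
    (Filter.Eventually.of_forall fun Y t _ => ?_)
  · refine (norm_sum_le _ _).trans (Finset.sum_le_sum fun j _ => ?_)
    rw [ContinuousLinearMap.smulRightL_apply_apply, ContinuousLinearMap.norm_smulRight_apply]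
    have h1 : ‖timeFreqShift Y ψ t‖ ≤ C := by simpa using hC Y t
    have h2 : ‖timeFreqShift Y (d j) t‖ ≤ D j := by simpa using hD j Y t
    have hY := bracket_pos Y
    calc _ ≤ 1 * ‖p j Y * F Y * timeFreqShift Y ψ t + F Y * timeFreqShift Y (d j) t‖ := by
          gcongr; exact norm_proj_le j
      _ ≤ ‖p j Y‖ * ‖F Y‖ * ‖timeFreqShift Y ψ t‖ + ‖F Y‖ * ‖timeFreqShift Y (d j) t‖ := by
          rw [one_mul]
          refine (norm_add_le _ _).trans (le_of_eq ?_)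
          simp only [norm_mul]
      _ ≤ _ := by
          rw [pow_one]
          gcongr
          exact hpb j Y
  · refine ((hasFDerivAt_timeFreqShift ψ Y t).const_mul (F Y)).congr_fderiv ?_
    simp only [F']
    rw [Finset.smul_sum]
    refine Finset.sum_congr rfl fun j _ => ?_
    ext v
    simp only [ContinuousLinearMap.smulRightL_apply_apply, ContinuousLinearMap.smulRight_apply,
      smul_apply, Complex.real_smul, smul_eq_mul, p, d, e]
    ring

/-- A derivative in t falls either on the modulation, producing a factor i⟨·, Y.2⟩ that costs one
moment of F, or on ψ. The constant does not depend on F, which is essential for bounding seminorms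
by integrals. -/
theorem superpos_bound (l : ℕ) : ∀ (k : ℕ) (ψ : 𝓢(Cfg n, ℂ)),
    ∃ C : ℝ, 0 ≤ C ∧ ∀ F : Phase n → ℂ, RapidInt F → ContDiff ℝ l (superpos ψ F) ∧
      ∀ t, ‖t‖ ^ k * ‖iteratedFDeriv ℝ l (superpos ψ F) t‖ ≤
        C * ∫ Y, bracket Y ^ (k + l) * ‖F Y‖ := by
  induction l with
  | zero =>
    intro k ψ
    obtain ⟨C, hC0, hC⟩ := norm_pow_mul_timeFreqShift_le ψ k
    refine ⟨C, hC0, fun F hF => ⟨?_, fun t => ?_⟩⟩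
    · exact contDiff_zero.2 (continuous_iff_continuousAt.2 fun t =>
        (hasFDerivAt_superpos ψ hF t).continuousAt)
    · rw [norm_iteratedFDeriv_zero, add_zero, ← integral_const_mul]
      calc ‖t‖ ^ k * ‖superpos ψ F t‖ = ‖∫ Y, ((‖t‖ ^ k : ℝ) : ℂ) * (F Y * timeFreqShift Y ψ t)‖ := by
            rw [integral_const_mul, norm_mul, Complex.norm_real,
              Real.norm_of_nonneg (by positivity)]
            rfl
        _ ≤ _ := by
            refine norm_integral_le_of_norm_le ((hF.moment k).const_mul C)
              (Filter.Eventually.of_forall fun Y => ?_)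
            rw [norm_mul, norm_mul, Complex.norm_real, Real.norm_of_nonneg (by positivity)]
            calc _ = ‖F Y‖ * (‖t‖ ^ k * ‖timeFreqShift Y ψ t‖) := by ring
              _ ≤ ‖F Y‖ * (C * bracket Y ^ k) :=
                mul_le_mul_of_nonneg_left (hC Y t) (norm_nonneg _)
              _ = _ := by ring
  | succ l ih =>
    intro k ψ
    let e : Fin n → Cfg n := fun j => EuclideanSpace.single j 1
    let p : Fin n → Phase n → ℂ := fun j Y => Complex.I * (inner ℝ (e j) Y.2 : ℝ)
    have hpc : ∀ j, Continuous (p j) := fun j => by fun_prop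
    have hpb : ∀ j Y, ‖p j Y‖ ≤ bracket Y := fun j Y => by
      rw [norm_mul, Complex.norm_I, one_mul, Complex.norm_real]
      refine (norm_inner_le_norm _ _).trans ?_
      simpa [e] using norm_snd_le_bracket Y
    let d : Fin n → 𝓢(Cfg n, ℂ) := fun j => LineDeriv.lineDerivOp (e j) ψ
    obtain ⟨C, hC0, hC⟩ := ih k ψ
    choose D hD0 hD using fun j => ih k (d j)
    refine ⟨∑ j, (C + D j), Finset.sum_nonneg fun j _ => add_nonneg hC0 (hD0 j), fun F hF => ?_⟩
    have hG := fun j => hF.mul (hpc j) (hpb j)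
    let Φ : Fin n → Cfg n → ℂ := fun j t =>
      superpos ψ (fun Y => p j Y * F Y) t + superpos (d j) F t
    have hΦ : ∀ j, ContDiff ℝ l (Φ j) := fun j => (hC _ (hG j).1).1.add (hD j F hF).1
    have hfd : fderiv ℝ (superpos ψ F) = fun t =>
        ∑ j, (ContinuousLinearMap.smulRightL ℝ (Cfg n) ℂ (EuclideanSpace.proj j)) (Φ j t) := by
      ext1 t
      exact (hasFDerivAt_superpos ψ hF t).fderiv
    have hcd : ∀ j : Fin n, ContDiff ℝ l fun t =>
        (ContinuousLinearMap.smulRightL ℝ (Cfg n) ℂ (EuclideanSpace.proj j)) (Φ j t) := fun j =>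
      (ContinuousLinearMap.contDiff _).comp (hΦ j)
    constructor
    · push_cast
      rw [contDiff_succ_iff_fderiv]
      refine ⟨fun t => (hasFDerivAt_superpos ψ hF t).differentiableAt, by simp, ?_⟩
      rw [hfd]
      exact ContDiff.sum fun j _ => hcd j
    · intro t
      rw [← norm_iteratedFDeriv_fderiv, hfd,
        iteratedFDeriv_fun_sum_apply fun j _ => (hcd j).contDiffAt]
      have hF1 : 0 ≤ ∫ Y, bracket Y ^ (k + l) * ‖F Y‖ := integral_nonneg fun Y => by
        have := bracket_pos Y
        positivity
      have hmono : ∫ Y, bracket Y ^ (k + l) * ‖F Y‖ ≤ ∫ Y, bracket Y ^ (k + (l + 1)) * ‖F Y‖ := by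
        refine integral_mono (hF.moment _) (hF.moment _) fun Y => ?_
        have h1 := one_le_bracket Y
        simp only
        gcongr
        omega
      calc _ ≤ ‖t‖ ^ k * ∑ j, (‖iteratedFDeriv ℝ l (superpos ψ (fun Y => p j Y * F Y)) t‖ +
            ‖iteratedFDeriv ℝ l (superpos (d j) F) t‖) := by
            gcongr
            refine (norm_sum_le _ _).trans (Finset.sum_le_sum fun j _ => ?_)
            have h1 := ContinuousLinearMap.iteratedFDeriv_comp_left
              (ContinuousLinearMap.smulRightL ℝ (Cfg n) ℂ (EuclideanSpace.proj j))
              (f := Φ j) (x := t) (hΦ j).contDiffAt (i := l) le_rfl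
            simp only [Function.comp_def] at h1
            rw [h1]
            refine (ContinuousLinearMap.norm_compContinuousMultilinearMap_le _ _).trans ?_
            refine (mul_le_of_le_one_left (norm_nonneg _) ?_).trans ?_
            · refine ContinuousLinearMap.opNorm_le_bound _ zero_le_one fun c => ?_
              rw [ContinuousLinearMap.smulRightL_apply_apply,
                ContinuousLinearMap.norm_smulRight_apply]
              gcongr
              exact norm_proj_le j
            · have h2 := iteratedFDeriv_add_apply (𝕜 := ℝ) (i := l) (x := t)
                (hC _ (hG j).1).1.contDiffAt (hD j F hF).1.contDiffAt
              have h3 : Φ j = superpos ψ (fun Y => p j Y * F Y) + superpos (d j) F := rfl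
              rw [h3, h2]
              exact norm_add_le _ _
        _ ≤ ∑ j, (C + D j) * ∫ Y, bracket Y ^ (k + (l + 1)) * ‖F Y‖ := by
            rw [Finset.mul_sum]
            refine Finset.sum_le_sum fun j _ => ?_
            rw [mul_add, add_mul]
            have hD0' := hD0 j
            refine add_le_add (((hC _ (hG j).1).2 t).trans ?_) (((hD j F hF).2 t).trans ?_)
            · exact mul_le_mul_of_nonneg_left ((hG j).2 (k + l)) hC0
            · gcongr
        _ = _ := by rw [Finset.sum_mul]

theorem exists_schwartz_superpos (ψ : 𝓢(Cfg n, ℂ)) {F : Phase n → ℂ} (hF : RapidInt F) :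
    ∃ Φ : 𝓢(Cfg n, ℂ), ∀ t, Φ t = superpos ψ F t := by
  refine ⟨⟨superpos ψ F, contDiff_infty.2 fun l =>
    ((superpos_bound l 0 ψ).choose_spec.2 F hF).1, fun k l => ?_⟩, fun t => rfl⟩
  obtain ⟨C, -, hC⟩ := superpos_bound l k ψ
  exact ⟨_, (hC F hF).2⟩

/-- By the inversion formula f is itself a superposition with density `ambig f ψ`, so
`superpos_bound` applies. -/
theorem seminorm_le_integral_ambig {ψ : 𝓢(Cfg n, ℂ)} (hψ : ψ ≠ 0) (k l : ℕ) :
    ∃ C : ℝ, 0 ≤ C ∧ ∀ f : 𝓢(Cfg n, ℂ), SchwartzMap.seminorm ℂ k l f ≤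
      C * ∫ Y, bracket Y ^ (k + l) * ‖ambig f ψ Y‖ := by
  obtain ⟨C, hC0, hC⟩ := superpos_bound l k ψ
  have hc := inversionConst_ne_zero hψ
  refine ⟨‖inversionConst ψ‖⁻¹ * C, by positivity, fun f => ?_⟩
  have hI : 0 ≤ ∫ Y, bracket Y ^ (k + l) * ‖ambig f ψ Y‖ := integral_nonneg fun Y => by
    have := bracket_pos Y
    positivity
  refine SchwartzMap.seminorm_le_bound ℂ k l f (by positivity) fun t => ?_
  have e : (f : Cfg n → ℂ) = fun t => (inversionConst ψ)⁻¹ • superpos ψ (ambig f ψ) t := by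
    funext s
    rw [superpos, integral_ambig_mul_timeFreqShift, smul_eq_mul, inv_mul_cancel_left₀ hc]
  have h := hC _ (rapidInt_ambig f ψ)
  have e2 : iteratedFDeriv ℝ l f t =
      (inversionConst ψ)⁻¹ • iteratedFDeriv ℝ l (superpos ψ (ambig f ψ)) t := by
    conv_lhs => rw [e]
    exact iteratedFDeriv_const_smul_apply' (a := (inversionConst ψ)⁻¹) h.1.contDiffAt
  rw [e2, norm_smul, norm_inv, mul_left_comm, mul_assoc]
  exact mul_le_mul_of_nonneg_left (h.2 t) (by positivity)

/-! ### Tempered distributions as superpositions of time-frequency shifts -/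

/-- A linear functional dominated by the norm of a linear map into a Hilbert space is represented by
a vector of that space. -/
theorem exists_inner_representation {V H : Type*} [AddCommGroup V] [Module ℂ V]
    [NormedAddCommGroup H] [InnerProductSpace ℂ H] [CompleteSpace H] (L : V →ₗ[ℂ] H)
    (u : V →ₗ[ℂ] ℂ) (C : ℝ) (h : ∀ v, ‖u v‖ ≤ C * ‖L v‖) :
    ∃ w : H, ∀ v, u v = inner ℂ w (L v) := by
  -- The bound makes u factor through the range of L, which need be neither closed nor dense;
  -- Hahn–Banach extends the functional and Riesz represents it.
  have hker : LinearMap.ker L ≤ LinearMap.ker u := fun v hv => by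
    have := h v
    rw [LinearMap.mem_ker.1 hv, norm_zero, mul_zero] at this
    exact LinearMap.mem_ker.2 (norm_le_zero_iff.1 this)
  let f₀ : LinearMap.range L →ₗ[ℂ] ℂ :=
    ((LinearMap.ker L).liftQ u hker).comp L.quotKerEquivRange.symm.toLinearMap
  have hf₀ : ∀ v, f₀ ⟨L v, LinearMap.mem_range_self L v⟩ = u v := fun v => by
    have := L.quotKerEquivRange_symm_apply_image v (LinearMap.mem_range_self L v)
    simp [f₀, this]
  let f : StrongDual ℂ (LinearMap.range L) := f₀.mkContinuous C fun y => by
    obtain ⟨y, v, rfl⟩ := y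
    rw [hf₀]
    exact h v
  obtain ⟨g, hg, -⟩ := exists_extension_norm_eq (LinearMap.range L) f
  refine ⟨(InnerProductSpace.toDual ℂ H).symm g, fun v => ?_⟩
  rw [InnerProductSpace.toDual_symm_apply, ← hf₀ v]
  exact (hg ⟨L v, LinearMap.mem_range_self L v⟩).symm

theorem integral_norm_mul_norm_le {α : Type*} [MeasurableSpace α] {μ : Measure α} {f g : α → ℂ}
    (hf : MemLp f 2 μ) (hg : MemLp g 2 μ) :
    ∫ x, ‖f x‖ * ‖g x‖ ∂μ ≤ ‖hf.toLp f‖ * ‖hg.toLp g‖ := by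
  have h := real_inner_le_norm (hf.norm.toLp _) (hg.norm.toLp _)
  rw [L2.inner_def] at h
  have e : ∫ x, ‖f x‖ * ‖g x‖ ∂μ =
      ∫ x, inner ℝ (hf.norm.toLp _ x) (hg.norm.toLp _ x) ∂μ := by
    refine integral_congr_ae ?_
    filter_upwards [hf.norm.coeFn_toLp, hg.norm.coeFn_toLp] with x h1 h2
    rw [h1, h2]
    simp [mul_comm]
  rw [e]
  refine h.trans (le_of_eq ?_)
  rw [Lp.norm_toLp, Lp.norm_toLp, Lp.norm_toLp, Lp.norm_toLp, eLpNorm_norm, eLpNorm_norm]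

theorem integrable_bracket_rpow_neg_nat (n : ℕ) :
    Integrable fun X : Phase n => bracket X ^ (-((2 * n + 1 : ℕ) : ℝ)) :=
  integrable_bracket_rpow_neg (by exact_mod_cast Nat.lt_succ_self _)

theorem memLp_bracket_rpow_neg (n : ℕ) :
    MemLp (fun X : Phase n => bracket X ^ (-((n + 1 : ℕ) : ℝ))) 2 volume := by
  refine (memLp_two_iff_integrable_sq (continuous_bracket_rpow _).aestronglyMeasurable).2 ?_
  have : ∀ X : Phase n, (bracket X ^ (-((n + 1 : ℕ) : ℝ))) ^ 2 =
      bracket X ^ (-((2 * n + 2 : ℕ) : ℝ)) := fun X => by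
    rw [← Real.rpow_natCast, ← Real.rpow_mul (bracket_pos X).le]
    congr 1
    push_cast
    ring
  simp_rw [this]
  exact integrable_bracket_rpow_neg (by push_cast; linarith)

theorem memLp_of_norm_le_bracket {g : Phase n → ℂ} (hg : AEStronglyMeasurable g volume) {C : ℝ}
    (h : ∀ X, ‖g X‖ ≤ C * bracket X ^ (-((n + 1 : ℕ) : ℝ))) : MemLp g 2 volume :=
  ((memLp_bracket_rpow_neg n).const_mul C).of_le hg (Filter.Eventually.of_forall fun X =>
    (h X).trans (le_abs_self _))

theorem bracket_pow_mul_rpow_neg (X : Phase n) (K N : ℕ) :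
    bracket X ^ K * bracket X ^ (-((K + N : ℕ) : ℝ)) = bracket X ^ (-(N : ℝ)) := by
  rw [← Real.rpow_natCast, ← Real.rpow_add (bracket_pos X)]
  congr 1
  push_cast
  ring

theorem norm_pairShift_le (ψ φ : 𝓢(Cfg n, ℂ)) (N : ℕ) :
    ∃ C : ℝ, 0 ≤ C ∧ ∀ Y, ‖pairShift ψ φ Y‖ ≤ C * bracket Y ^ (-(N : ℝ)) := by
  obtain ⟨C, hC0, hC⟩ := norm_ambig_le (sBdd_const (ι := Unit) (conjSchwartz φ)) (sBdd_const ψ) N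
  exact ⟨C, hC0, fun Y => by rw [norm_pairShift]; exact hC () Y⟩

theorem memLp_bracket_mul_pairShift (ψ φ : 𝓢(Cfg n, ℂ)) (K : ℕ) :
    MemLp (fun Y => ((bracket Y ^ K : ℝ) : ℂ) * pairShift ψ φ Y) 2 volume := by
  obtain ⟨C, hC0, hC⟩ := norm_pairShift_le ψ φ (K + (n + 1))
  refine memLp_of_norm_le_bracket (C := C) ?_ fun Y => ?_
  · exact ((Complex.continuous_ofReal.comp (continuous_bracket.pow K)).mul
      (continuous_pairShift ψ φ)).aestronglyMeasurable
  · have hY := bracket_pos Y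
    rw [norm_mul, Complex.norm_real, Real.norm_of_nonneg (by positivity),
      ← bracket_pow_mul_rpow_neg Y K]
    calc _ ≤ bracket Y ^ K * (C * bracket Y ^ (-((K + (n + 1) : ℕ) : ℝ))) := by
          gcongr; exact hC Y
      _ = _ := by ring

theorem pairShift_add (ψ φ₁ φ₂ : 𝓢(Cfg n, ℂ)) (Y : Phase n) :
    pairShift ψ (φ₁ + φ₂) Y = pairShift ψ φ₁ Y + pairShift ψ φ₂ Y := by
  have hi : ∀ φ : 𝓢(Cfg n, ℂ), Integrable fun t => timeFreqShift Y ψ t * φ t := fun φ => by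
    obtain ⟨C, hC0, hC⟩ := (sBdd_const (ι := Unit) φ).norm_le
    refine (((timeFreqShift Y ψ).integrable (μ := volume)).norm.mul_const C).mono'
      ((timeFreqShift Y ψ).continuous.mul φ.continuous).aestronglyMeasurable
      (Filter.Eventually.of_forall fun t => ?_)
    rw [norm_mul]
    gcongr
    exact hC () t
  rw [pairShift, pairShift, pairShift, ← integral_add (hi φ₁) (hi φ₂)]
  simp [mul_add]

theorem pairShift_smul (ψ : 𝓢(Cfg n, ℂ)) (c : ℂ) (φ : 𝓢(Cfg n, ℂ)) (Y : Phase n) :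
    pairShift ψ (c • φ) Y = c * pairShift ψ φ Y := by
  rw [pairShift, pairShift, ← integral_const_mul]
  refine integral_congr_ae (Filter.Eventually.of_forall fun t => ?_)
  simp only [smul_apply, smul_eq_mul]
  ring

/-- The map `φ ↦ ⟨·⟩ᴷ ∫ Π(·)ψ φ` into `L²`. -/
def weightedPairing (ψ : 𝓢(Cfg n, ℂ)) (K : ℕ) :
    𝓢(Cfg n, ℂ) →ₗ[ℂ] Lp ℂ 2 (volume : Measure (Phase n)) where
  toFun φ := (memLp_bracket_mul_pairShift ψ φ K).toLp _
  map_add' φ₁ φ₂ := by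
    rw [← MemLp.toLp_add]
    refine MemLp.toLp_congr _ _ (Filter.Eventually.of_forall fun Y => ?_)
    simp [pairShift_add, mul_add]
  map_smul' c φ := by
    rw [RingHom.id_apply, ← MemLp.toLp_const_smul]
    refine MemLp.toLp_congr _ _ (Filter.Eventually.of_forall fun Y => ?_)
    simp only [pairShift_smul, Pi.smul_apply, smul_eq_mul]
    ring

theorem seminorm_conjSchwartz_le (k l : ℕ) (φ : 𝓢(Cfg n, ℂ)) :
    SchwartzMap.seminorm ℂ k l φ ≤ SchwartzMap.seminorm ℂ k l (conjSchwartz φ) := by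
  refine SchwartzMap.seminorm_le_bound ℂ k l φ (by positivity) fun t => ?_
  have e : (φ : Cfg n → ℂ) = Complex.conjLIE ∘ (conjSchwartz φ) := by
    funext s; simp [conjSchwartz_apply]
  rw [e, Complex.conjLIE.norm_iteratedFDeriv_comp_left]
  exact SchwartzMap.le_seminorm ℂ k l (conjSchwartz φ) t

/-- A tempered distribution is bounded by finitely many seminorms, and each of these by a weighted
L¹ norm of the pairing with the shifts of ψ. By Cauchy–Schwarz, `n + 1` further powers of the
bracket turn L¹ into L², where representation by a vector is available. -/
theorem norm_apply_le_weightedPairing {ψ : 𝓢(Cfg n, ℂ)} (hψ : ψ ≠ 0) (u : 𝓢'(Cfg n, ℂ)) :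
    ∃ (K : ℕ) (C : ℝ), ∀ φ, ‖u φ‖ ≤ C * ‖weightedPairing ψ K φ‖ := by
  let uL : 𝓢(Cfg n, ℂ) →L[ℂ] ℂ := u
  have hcont : Continuous ((normSeminorm ℂ ℂ).comp uL.toLinearMap) :=
    continuous_norm.comp uL.continuous
  obtain ⟨s, C, -, hC⟩ := Seminorm.bound_of_continuous (schwartz_withSeminorms ℂ (Cfg n) ℂ) _ hcont
  choose D hD0 hD using fun p : ℕ × ℕ => seminorm_le_integral_ambig hψ p.1 p.2
  let K₀ : ℕ := ∑ p ∈ s, (p.1 + p.2)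
  let B : ℝ := ‖(memLp_bracket_rpow_neg n).ofReal (K := ℂ) |>.toLp _‖
  refine ⟨K₀ + (n + 1), C * (∑ p ∈ s, D p) * B, fun φ => ?_⟩
  have hI : ∀ K : ℕ, Integrable fun Y => bracket Y ^ K * ‖pairShift ψ φ Y‖ := fun K => by
    simp_rw [norm_pairShift]
    exact integrable_bracket_mul_ambig _ _ K
  have h1 : ∀ p ∈ s, SchwartzMap.seminorm ℂ p.1 p.2 φ ≤
      D p * ∫ Y, bracket Y ^ K₀ * ‖pairShift ψ φ Y‖ := fun p hp => by
    refine (seminorm_conjSchwartz_le _ _ φ).trans ((hD p _).trans ?_)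
    simp_rw [← norm_pairShift]
    refine mul_le_mul_of_nonneg_left (integral_mono (hI _) (hI _) fun Y => ?_) (hD0 p)
    have hY := one_le_bracket Y
    have hpK : p.1 + p.2 ≤ K₀ :=
      Finset.single_le_sum (f := fun p : ℕ × ℕ => p.1 + p.2) (fun _ _ => Nat.zero_le _) hp
    simp only
    gcongr
  have h2 : ∫ Y, bracket Y ^ K₀ * ‖pairShift ψ φ Y‖ ≤ B * ‖weightedPairing ψ (K₀ + (n + 1)) φ‖ := by
    refine le_trans (le_of_eq (integral_congr_ae (Filter.Eventually.of_forall fun Y => ?_)))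
      (integral_norm_mul_norm_le ((memLp_bracket_rpow_neg n).ofReal (K := ℂ))
        (memLp_bracket_mul_pairShift ψ φ (K₀ + (n + 1))))
    have hY := bracket_pos Y
    simp only [norm_mul]
    rw [RCLike.norm_ofReal, abs_of_nonneg (by positivity), Complex.norm_real,
      Real.norm_of_nonneg (by positivity), Real.rpow_neg hY.le, Real.rpow_natCast, pow_add _ K₀]
    field_simp
  have h3 : ‖u φ‖ ≤ C * ∑ p ∈ s, SchwartzMap.seminorm ℂ p.1 p.2 φ := by
    refine (hC φ).trans ?_
    rw [smul_apply, NNReal.smul_def, smul_eq_mul]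
    refine mul_le_mul_of_nonneg_left ?_ C.2
    exact Seminorm.finset_sup_apply_le (Finset.sum_nonneg fun p _ => apply_nonneg _ _) fun p hp =>
      Finset.single_le_sum (f := fun p : ℕ × ℕ => SchwartzMap.seminorm ℂ p.1 p.2 φ)
        (fun p _ => apply_nonneg _ _) hp
  calc ‖u φ‖ ≤ C * ∑ p ∈ s, SchwartzMap.seminorm ℂ p.1 p.2 φ := h3
    _ ≤ C * ∑ p ∈ s, D p * ∫ Y, bracket Y ^ K₀ * ‖pairShift ψ φ Y‖ :=
        mul_le_mul_of_nonneg_left (Finset.sum_le_sum h1) C.2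
    _ = C * (∑ p ∈ s, D p) * ∫ Y, bracket Y ^ K₀ * ‖pairShift ψ φ Y‖ := by
        rw [← Finset.sum_mul]; ring
    _ ≤ C * (∑ p ∈ s, D p) * (B * ‖weightedPairing ψ (K₀ + (n + 1)) φ‖) :=
        mul_le_mul_of_nonneg_left h2 (mul_nonneg C.2 (Finset.sum_nonneg fun p _ => hD0 p))
    _ = _ := by ring

/-- Every tempered distribution is a superposition `∫ h(Y)⟨Y⟩ᴷ Π(Y)ψ dY` with `h ∈ L²`. -/
theorem exists_superposition {ψ : 𝓢(Cfg n, ℂ)} (hψ : ψ ≠ 0) (u : 𝓢'(Cfg n, ℂ)) :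
    ∃ (K : ℕ) (h : Phase n → ℂ), StronglyMeasurable h ∧ MemLp h 2 volume ∧
      ∀ φ, u φ = ∫ Y, h Y * (((bracket Y ^ K : ℝ) : ℂ) * pairShift ψ φ Y) := by
  obtain ⟨K, C, hC⟩ := norm_apply_le_weightedPairing hψ u
  let uL : 𝓢(Cfg n, ℂ) →L[ℂ] ℂ := u
  obtain ⟨w, hw⟩ := exists_inner_representation (weightedPairing ψ K) uL.toLinearMap C hC
  refine ⟨K, fun Y => conj (w Y),
    Complex.continuous_conj.comp_stronglyMeasurable (Lp.stronglyMeasurable w),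
    (Lp.memLp w).star, fun φ => ?_⟩
  refine (hw φ).trans ?_
  rw [L2.inner_def]
  refine integral_congr_ae ?_
  filter_upwards [(memLp_bracket_mul_pairShift ψ φ K).coeFn_toLp] with Y hY
  change inner ℂ (w Y) ((memLp_bracket_mul_pairShift ψ φ K).toLp _ Y) = _
  rw [hY, RCLike.inner_apply]
  ring

/-! ### Measurability, growth and reproducing formula -/

theorem bracket_pow_le (K : ℕ) (Y Z : Phase n) :
    bracket Y ^ K ≤ 2 ^ K * bracket Z ^ K * bracket (Z - Y) ^ K := by
  have h := bracket_add_le Z (Y - Z)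
  rw [add_sub_cancel, bracket_sub_comm] at h
  rw [← mul_pow, ← mul_pow]
  have := bracket_pos Y
  gcongr

/-- The superposition formula exhibits the transform as a parameter integral with jointly measurable
integrand. The nonzero auxiliary window ψ serves only to represent u. -/
theorem stronglyMeasurable_stft {ψ : 𝓢(Cfg n, ℂ)} (hψ : ψ ≠ 0) (ρ : 𝓢(Cfg n, ℂ))
    (u : 𝓢'(Cfg n, ℂ)) : StronglyMeasurable (stft ρ u) := by
  obtain ⟨K, h, hm, -, hu⟩ := exists_superposition hψ u
  have e : stft ρ u = fun X => ∫ Y, h Y * (((bracket Y ^ K : ℝ) : ℂ) *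
      ambig (timeFreqShift Y ψ) ρ X) := by
    funext X
    rw [stft, hu]
    simp_rw [pairShift_conj_timeFreqShift]
  rw [e]
  refine StronglyMeasurable.integral_prod_right' (f := fun p : Phase n × Phase n =>
    h p.2 * (((bracket p.2 ^ K : ℝ) : ℂ) * ambig (timeFreqShift p.2 ψ) ρ p.1)) ?_
  refine (hm.comp_measurable measurable_snd).mul (Continuous.stronglyMeasurable ?_)
  exact (Complex.continuous_ofReal.comp ((continuous_bracket.comp continuous_snd).pow K)).mul
    (continuous_ambig_timeFreqShift ψ ρ)

theorem exists_norm_stft_le {ψ : 𝓢(Cfg n, ℂ)} (hψ : ψ ≠ 0) (u : 𝓢'(Cfg n, ℂ)) :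
    ∃ (M : ℕ) (C : ℝ), 0 ≤ C ∧ ∀ X, ‖stft ψ u X‖ ≤ C * bracket X ^ M := by
  obtain ⟨K, h, hm, hL, hu⟩ := exists_superposition hψ u
  obtain ⟨C, hC0, hC⟩ := norm_ambig_le (sBdd_const (ι := Unit) ψ) (sBdd_const ψ) (K + (n + 1))
  have hh := hL.integrable_norm_pow (p := 2) (by norm_num)
  have hb := (memLp_bracket_rpow_neg n).integrable_sq
  refine ⟨K, (C * 2 ^ K) * ((∫ Y, ‖h Y‖ ^ 2) + ∫ Y : Phase n,
    (bracket Y ^ (-((n + 1 : ℕ) : ℝ))) ^ 2), ?_, fun X => ?_⟩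
  · have h1 : 0 ≤ ∫ Y, ‖h Y‖ ^ 2 := integral_nonneg fun Y => by positivity
    have h2 : 0 ≤ ∫ Y : Phase n, (bracket Y ^ (-((n + 1 : ℕ) : ℝ))) ^ 2 :=
      integral_nonneg fun Y => by positivity
    positivity
  · have hs : Integrable fun Y => (bracket (X - Y) ^ (-((n + 1 : ℕ) : ℝ))) ^ 2 := by
      simp_rw [bracket_sub_comm X]
      exact hb.comp_sub_right X
    have hs2 : ∫ Y, (bracket (X - Y) ^ (-((n + 1 : ℕ) : ℝ))) ^ 2 =
        ∫ Y : Phase n, (bracket Y ^ (-((n + 1 : ℕ) : ℝ))) ^ 2 := by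
      simp_rw [bracket_sub_comm X]
      exact integral_sub_right_eq_self
        (fun Y : Phase n => (bracket Y ^ (-((n + 1 : ℕ) : ℝ))) ^ 2) X
    rw [stft, hu]
    simp_rw [pairShift_conj_timeFreqShift]
    refine (norm_integral_le_of_norm_le ((hh.add hs).const_mul (C * 2 ^ K * bracket X ^ K))
      (Filter.Eventually.of_forall fun Y => ?_)).trans (le_of_eq ?_)
    · have hX := bracket_pos X
      have hY := bracket_pos Y
      have hXY := bracket_pos (X - Y)
      rw [norm_mul, norm_mul, Complex.norm_real, Real.norm_of_nonneg (by positivity),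
        norm_ambig_timeFreqShift]
      have hcu := hC () (X - Y)
      calc ‖h Y‖ * (bracket Y ^ K * ‖ambig ψ ψ (X - Y)‖)
          ≤ ‖h Y‖ * ((2 ^ K * bracket X ^ K * bracket (X - Y) ^ K) *
            (C * bracket (X - Y) ^ (-((K + (n + 1) : ℕ) : ℝ)))) := by
            gcongr
            exact bracket_pow_le K Y X
        _ = C * 2 ^ K * bracket X ^ K * (‖h Y‖ * (bracket (X - Y) ^ K *
            bracket (X - Y) ^ (-((K + (n + 1) : ℕ) : ℝ)))) := by ring
        _ = C * 2 ^ K * bracket X ^ K * (‖h Y‖ * bracket (X - Y) ^ (-((n + 1 : ℕ) : ℝ))) := by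
            rw [bracket_pow_mul_rpow_neg]
        _ ≤ _ := by
            simp only [Pi.add_apply]
            gcongr
            nlinarith [sq_nonneg (‖h Y‖ - bracket (X - Y) ^ (-((n + 1 : ℕ) : ℝ))),
              sq_nonneg ‖h Y‖, sq_nonneg (bracket (X - Y) ^ (-((n + 1 : ℕ) : ℝ)))]
    · rw [integral_const_mul, integral_add' hh hs, hs2]
      ring

/-- The reproducing formula for the short-time Fourier transform of a tempered distribution. -/
theorem integral_stft_mul_pairShift {ψ : 𝓢(Cfg n, ℂ)} (hψ : ψ ≠ 0) (u : 𝓢'(Cfg n, ℂ))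
    (φ : 𝓢(Cfg n, ℂ)) :
    ∫ Z, stft ψ u Z * pairShift ψ φ Z = inversionConst ψ * u φ := by
  obtain ⟨K, h, hm, hL, hu⟩ := exists_superposition hψ u
  obtain ⟨C, hC0, hC⟩ := norm_ambig_le (sBdd_const (ι := Unit) ψ) (sBdd_const ψ) (K + (n + 1))
  -- In the bound below ⟨Y⟩ᴷ is written as ⟨Y⟩^(K+n+1) times an L² weight that is paired with h.
  -- Peetre's inequality moves the first factor to Z and Z - Y; `K + (n + 1)` powers of decay in Z
  -- cancel the growth and `2 * n + 1` give integrability.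
  obtain ⟨D, hD0, hD⟩ := norm_pairShift_le ψ φ (K + (n + 1) + (2 * n + 1))
  let G : Phase n → Phase n → ℂ := fun Z Y => (h Y * (((bracket Y ^ K : ℝ) : ℂ) *
      ambig (timeFreqShift Y ψ) ψ Z)) * pairShift ψ φ Z
  have hint : Integrable (Function.uncurry G) (volume.prod volume) := by
    have hb : Integrable (fun Y => ‖h Y‖ * bracket Y ^ (-((n + 1 : ℕ) : ℝ))) :=
      hL.norm.integrable_mul (memLp_bracket_rpow_neg n)
    refine (((integrable_bracket_rpow_neg_nat n).mul_prod hb).const_mul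
      (C * D * 2 ^ (K + (n + 1)))).mono' ?_ (Filter.Eventually.of_forall fun p => ?_)
    · refine ((hm.comp_measurable measurable_snd).mul (Continuous.stronglyMeasurable ?_)).mul
        (Continuous.stronglyMeasurable ?_) |>.aestronglyMeasurable
      · exact (Complex.continuous_ofReal.comp ((continuous_bracket.comp continuous_snd).pow K)).mul
          (continuous_ambig_timeFreqShift ψ ψ)
      · exact (continuous_pairShift ψ φ).comp continuous_fst
    · obtain ⟨Z, Y⟩ := p
      have hZ := bracket_pos Z
      have hY := bracket_pos Y
      have hXY := bracket_pos (Z - Y)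
      have hc := hC () (Z - Y)
      have hd := hD Z
      simp only [Function.uncurry, G]
      rw [norm_mul, norm_mul, norm_mul, Complex.norm_real, Real.norm_of_nonneg (by positivity),
        norm_ambig_timeFreqShift]
      have e1 : bracket Y ^ K = bracket Y ^ (K + (n + 1)) * bracket Y ^ (-((n + 1 : ℕ) : ℝ)) := by
        rw [Real.rpow_neg hY.le, Real.rpow_natCast, pow_add]
        field_simp
      rw [e1]
      calc _ ≤ (‖h Y‖ * (((2 ^ (K + (n + 1)) * bracket Z ^ (K + (n + 1)) *
            bracket (Z - Y) ^ (K + (n + 1))) * bracket Y ^ (-((n + 1 : ℕ) : ℝ))) *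
            (C * bracket (Z - Y) ^ (-((K + (n + 1) : ℕ) : ℝ))))) *
            (D * bracket Z ^ (-((K + (n + 1) + (2 * n + 1) : ℕ) : ℝ))) := by
            gcongr
            exact bracket_pow_le _ Y Z
        _ = C * D * 2 ^ (K + (n + 1)) *
            ((bracket Z ^ (K + (n + 1)) * bracket Z ^ (-((K + (n + 1) + (2 * n + 1) : ℕ) : ℝ))) *
            (‖h Y‖ * bracket Y ^ (-((n + 1 : ℕ) : ℝ)))) *
            (bracket (Z - Y) ^ (K + (n + 1)) * bracket (Z - Y) ^ (-((K + (n + 1) : ℕ) : ℝ))) := by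
            ring
        _ = _ := by
            have e2 := bracket_pow_mul_rpow_neg (Z - Y) (K + (n + 1)) 0
            rw [add_zero, Nat.cast_zero, neg_zero, Real.rpow_zero] at e2
            rw [bracket_pow_mul_rpow_neg, e2, mul_one]
  calc ∫ Z, stft ψ u Z * pairShift ψ φ Z = ∫ Z, ∫ Y, G Z Y := by
        refine integral_congr_ae (Filter.Eventually.of_forall fun Z => ?_)
        simp only [G]
        rw [integral_mul_const, stft, hu]
        simp_rw [pairShift_conj_timeFreqShift]
    _ = ∫ Y, ∫ Z, G Z Y := integral_integral_swap hint
    _ = ∫ Y, inversionConst ψ * (h Y * (((bracket Y ^ K : ℝ) : ℂ) * pairShift ψ φ Y)) := by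
        refine integral_congr_ae (Filter.Eventually.of_forall fun Y => ?_)
        simp only [G, mul_assoc, integral_const_mul]
        rw [integral_ambig_mul_pairShift (timeFreqShift Y ψ) ψ φ, pairShift]
        ring
    _ = _ := by rw [integral_const_mul, hu]

/-! ### Weighted square integrability on subsets of phase space -/

/-- The weight `⟨X⟩ˢ` as an extended nonnegative real. -/
def wt (s : ℝ) (X : Phase n) : ℝ≥0∞ := ENNReal.ofReal (bracket X ^ s)

theorem wt_add (s t : ℝ) (X : Phase n) : wt (s + t) X = wt s X * wt t X := by
  have := bracket_pos X
  rw [wt, wt, wt, ← ENNReal.ofReal_mul (by positivity), Real.rpow_add this]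

theorem wt_zero (X : Phase n) : wt 0 X = 1 := by simp [wt]

theorem wt_ne_top (s : ℝ) (X : Phase n) : wt s X ≠ ⊤ := ENNReal.ofReal_ne_top

theorem measurable_wt (s : ℝ) : Measurable (wt (n := n) s) :=
  (continuous_bracket_rpow s).measurable.ennreal_ofReal

theorem wt_mono {s t : ℝ} (h : s ≤ t) (X : Phase n) : wt s X ≤ wt t X :=
  ENNReal.ofReal_le_ofReal (Real.rpow_le_rpow_of_exponent_le (one_le_bracket X) h)

theorem enorm_bracket_rpow (s : ℝ) (X : Phase n) : ‖((bracket X ^ s : ℝ) : ℂ)‖ₑ = wt s X := by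
  have := bracket_pos X
  rw [← ofReal_norm, Complex.norm_real, Real.norm_of_nonneg (by positivity), wt]

theorem wt_mul_wt_neg (s : ℝ) (X : Phase n) : wt s X * wt (-s) X = 1 := by
  rw [← wt_add, add_neg_cancel, wt_zero]

theorem wt_le_mul (s : ℝ) (X Y : Phase n) :
    wt s X ≤ ENNReal.ofReal (2 ^ |s|) * (wt s Y * wt |s| (X - Y)) := by
  have h := bracket_rpow_add_le s Y (X - Y)
  rw [add_sub_cancel] at h
  have h1 := bracket_pos Y
  have h2 := bracket_pos (X - Y)
  rw [wt, wt, wt, ← ENNReal.ofReal_mul (by positivity), ← ENNReal.ofReal_mul (by positivity)]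
  exact ENNReal.ofReal_le_ofReal (by linarith)

theorem lintegral_wt_neg_lt_top (n : ℕ) : ∫⁻ X : Phase n, wt (-(2 * n + 1 : ℝ)) X < ⊤ := by
  have h := (integrable_bracket_rpow_neg_nat n).lintegral_lt_top
  push_cast at h
  exact h

theorem lintegral_wt_sub (s : ℝ) (Y : Phase n) : ∫⁻ X, wt s (X - Y) = ∫⁻ X, wt (n := n) s X :=
  lintegral_sub_right_eq_self (fun X => wt s X) Y

theorem wt_sub_comm (s : ℝ) (X Y : Phase n) : wt s (X - Y) = wt s (Y - X) := by
  rw [wt, wt, bracket_sub_comm]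

theorem sq_lintegral_mul_le {α : Type*} [MeasurableSpace α] {μ : Measure α} {f g : α → ℝ≥0∞}
    (hf : AEMeasurable f μ) (hg : AEMeasurable g μ) :
    (∫⁻ x, f x * g x ∂μ) ^ 2 ≤ (∫⁻ x, f x ^ 2 ∂μ) * ∫⁻ x, g x ^ 2 ∂μ := by
  have h := ENNReal.lintegral_mul_le_Lp_mul_Lq μ Real.HolderConjugate.two_two hf hg
  simp only [Pi.mul_apply, ENNReal.rpow_two] at h
  calc _ ≤ _ := pow_le_pow_left' h 2
    _ = _ := by
      rw [mul_pow, ← ENNReal.rpow_two, ← ENNReal.rpow_two, ← ENNReal.rpow_mul, ← ENNReal.rpow_mul]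
      norm_num

/-- `⟨·⟩ˢ F` is square integrable on `Ω`. -/
def SqInt (s : ℝ) (Ω : Set (Phase n)) (F : Phase n → ℝ≥0∞) : Prop :=
  ∫⁻ X in Ω, (wt s X * F X) ^ 2 < ⊤

theorem SqInt.mono_set {s : ℝ} {Ω Ω' : Set (Phase n)} {F : Phase n → ℝ≥0∞} (h : SqInt s Ω F)
    (hs : Ω' ⊆ Ω) : SqInt s Ω' F :=
  (lintegral_mono_set hs).trans_lt h

theorem SqInt.of_le {s t : ℝ} {Ω : Set (Phase n)} {F G : Phase n → ℝ≥0∞} (h : SqInt t Ω G)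
    (hΩ : MeasurableSet Ω) {C : ℝ≥0∞} (hC : C ≠ ⊤)
    (hFG : ∀ X ∈ Ω, wt s X * F X ≤ C * (wt t X * G X)) : SqInt s Ω F := by
  have h1 : ∫⁻ X in Ω, (wt s X * F X) ^ 2 ≤ ∫⁻ X in Ω, C ^ 2 * (wt t X * G X) ^ 2 :=
    setLIntegral_mono' hΩ fun X hX => by
      rw [← mul_pow]
      exact pow_le_pow_left' (hFG X hX) 2
  refine h1.trans_lt ?_
  rw [lintegral_const_mul' _ _ (ENNReal.pow_ne_top hC)]
  exact ENNReal.mul_lt_top (ENNReal.pow_ne_top hC).lt_top h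

theorem SqInt.mono {s t : ℝ} {Ω : Set (Phase n)} {F : Phase n → ℝ≥0∞} (h : SqInt t Ω F)
    (hΩ : MeasurableSet Ω) (hst : s ≤ t) : SqInt s Ω F :=
  h.of_le hΩ ENNReal.one_ne_top fun X _ => by
    rw [one_mul]
    exact mul_le_mul_left (wt_mono hst X) _

theorem SqInt.add {s : ℝ} {Ω : Set (Phase n)} {F G : Phase n → ℝ≥0∞} (hF : SqInt s Ω F)
    (hG : SqInt s Ω G) (hm : Measurable F) : SqInt s Ω fun X => F X + G X := by
  have h1 : ∫⁻ X in Ω, (wt s X * (F X + G X)) ^ 2 ≤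
      ∫⁻ X in Ω, (2 * (wt s X * F X) ^ 2 + 2 * (wt s X * G X) ^ 2) :=
    lintegral_mono fun X => by
      rw [mul_add]
      have h := ENNReal.rpow_add_le_mul_rpow_add_rpow (wt s X * F X) (wt s X * G X)
        (by norm_num : (1 : ℝ) ≤ 2)
      norm_num [mul_add] at h
      exact h
  refine h1.trans_lt ?_
  have hm' : Measurable fun X => 2 * (wt s X * F X) ^ 2 :=
    (((measurable_wt s).mul hm).pow_const 2).const_mul 2
  rw [lintegral_add_left hm', lintegral_const_mul' _ _ (by norm_num), lintegral_const_mul' _ _ (by norm_num)]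
  exact ENNReal.add_lt_top.2 ⟨ENNReal.mul_lt_top (by norm_num) hF,
    ENNReal.mul_lt_top (by norm_num) hG⟩

theorem SqInt.union {s : ℝ} {Ω Ω' : Set (Phase n)} {F : Phase n → ℝ≥0∞} (h : SqInt s Ω F)
    (h' : SqInt s Ω' F) : SqInt s (Ω ∪ Ω') F :=
  (lintegral_union_le _ _ _).trans_lt (ENNReal.add_lt_top.2 ⟨h, h'⟩)

theorem sqInt_of_decay {s : ℝ} {Ω : Set (Phase n)} (hΩ : MeasurableSet Ω) {F : Phase n → ℝ≥0∞}
    {C : ℝ≥0∞} (hC : C ≠ ⊤) (h : ∀ X ∈ Ω, F X ≤ C * wt (-(s + (2 * n + 1))) X) : SqInt s Ω F := by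
  have h1 : SqInt (n := n) 0 Ω (wt (-(2 * n + 1))) := by
    refine (lintegral_mono_set (Set.subset_univ _)).trans_lt ?_
    rw [Measure.restrict_univ]
    refine (lintegral_mono fun X => ?_).trans_lt (lintegral_wt_neg_lt_top n)
    rw [wt_zero, one_mul, sq, ← wt_add]
    exact wt_mono (by have : (0 : ℝ) ≤ n := n.cast_nonneg; linarith) X
  refine h1.of_le hΩ hC fun X hX => ?_
  rw [wt_zero, one_mul]
  calc wt s X * F X ≤ wt s X * (C * wt (-(s + (2 * n + 1))) X) := mul_le_mul_right (h X hX) _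
    _ = C * wt (-(2 * n + 1)) X := by
      rw [mul_left_comm, ← wt_add]
      congr 2
      ring

theorem sqInt_wt_mul {s m : ℝ} {Ω : Set (Phase n)} {F : Phase n → ℝ≥0∞} :
    (SqInt s Ω fun X => wt m X * F X) ↔ SqInt (s + m) Ω F := by
  simp only [SqInt, ← mul_assoc, ← wt_add]

/-- The average of `F` against the kernel `⟨X - Y⟩⁻ᴺ`. -/
def avg (N : ℝ) (F : Phase n → ℝ≥0∞) (X : Phase n) : ℝ≥0∞ := ∫⁻ Y, wt (-N) (X - Y) * F Y

theorem avg_anti {M N : ℝ} (h : M ≤ N) (F : Phase n → ℝ≥0∞) (X : Phase n) : avg N F X ≤ avg M F X :=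
  lintegral_mono fun _ => mul_le_mul_left (wt_mono (by linarith) _) _

theorem measurable_wt_sub (N : ℝ) : Measurable fun p : Phase n × Phase n => wt N (p.1 - p.2) :=
  (measurable_wt N).comp (measurable_fst.sub measurable_snd)

theorem measurable_wt_sub_const (N : ℝ) (Y : Phase n) : Measurable fun X => wt N (X - Y) :=
  (measurable_wt N).comp (measurable_id.sub measurable_const)

theorem measurable_avg (N : ℝ) {F : Phase n → ℝ≥0∞} (hF : Measurable F) : Measurable (avg N F) :=
  ((measurable_wt_sub (-N)).mul (hF.comp measurable_snd)).lintegral_prod_right'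

/-- Young's inequality for L¹ ∗ L²: Cauchy–Schwarz after splitting the kernel into two square roots,
then Tonelli. -/
theorem lintegral_sq_avg_le {F : Phase n → ℝ≥0∞} (hF : Measurable F) :
    ∫⁻ X, avg (2 * n + 1) F X ^ 2 ≤
      (∫⁻ X : Phase n, wt (-(2 * n + 1)) X) ^ 2 * ∫⁻ Y, F Y ^ 2 := by
  set r : ℝ := 2 * n + 1
  have h1 : ∀ X : Phase n, avg r F X ^ 2 ≤
      (∫⁻ X : Phase n, wt (-r) X) * ∫⁻ Y, wt (-r) (X - Y) * F Y ^ 2 := fun X => by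
    have hm : Measurable fun Y => wt (n := n) (-r / 2) (X - Y) :=
      (measurable_wt _).comp (measurable_const.sub measurable_id)
    have h := sq_lintegral_mul_le (μ := volume) hm.aemeasurable (hm.mul hF).aemeasurable
    have e : ∀ Y, wt (-r / 2) (X - Y) ^ 2 = wt (-r) (X - Y) := fun Y => by
      rw [sq, ← wt_add, add_halves]
    simp only [Pi.mul_apply, ← mul_assoc, mul_pow, ← sq, e] at h
    refine h.trans (le_of_eq ?_)
    simp_rw [wt_sub_comm (-r) X]
    rw [lintegral_wt_sub]
  calc ∫⁻ X, avg r F X ^ 2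
      ≤ ∫⁻ X, (∫⁻ X : Phase n, wt (-r) X) * ∫⁻ Y, wt (-r) (X - Y) * F Y ^ 2 := lintegral_mono h1
    _ = (∫⁻ X : Phase n, wt (-r) X) * ∫⁻ X, ∫⁻ Y, wt (-r) (X - Y) * F Y ^ 2 :=
        lintegral_const_mul' _ _ (lintegral_wt_neg_lt_top n).ne
    _ = (∫⁻ X : Phase n, wt (-r) X) * ∫⁻ Y, ∫⁻ X, wt (-r) (X - Y) * F Y ^ 2 := by
        rw [lintegral_lintegral_swap]
        exact ((measurable_wt_sub (-r)).mul ((hF.comp measurable_snd).pow_const 2)).aemeasurable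
    _ = _ := by
        have : ∀ Y, ∫⁻ X, wt (-r) (X - Y) * F Y ^ 2 = (∫⁻ X : Phase n, wt (-r) X) * F Y ^ 2 :=
          fun Y => by
            rw [lintegral_mul_const _ (measurable_wt_sub_const _ _), lintegral_wt_sub]
        simp_rw [this]
        rw [lintegral_const_mul _ (hF.pow_const 2), sq, mul_assoc]

/-- Peetre's inequality: the weight can be taken inside the average at the cost of |s| powers of the
kernel. -/
theorem wt_mul_avg_le (s N : ℝ) {F : Phase n → ℝ≥0∞} (X : Phase n) :
    wt s X * avg (|s| + N) F X ≤ ENNReal.ofReal (2 ^ |s|) * avg N (fun Y => wt s Y * F Y) X := by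
  rw [avg, avg, ← lintegral_const_mul' _ _ (wt_ne_top s X),
    ← lintegral_const_mul' _ _ ENNReal.ofReal_ne_top]
  refine lintegral_mono fun Y => ?_
  calc _ ≤ (ENNReal.ofReal (2 ^ |s|) * (wt s Y * wt |s| (X - Y))) * (wt (-(|s| + N)) (X - Y) * F Y) :=
        mul_le_mul_left (wt_le_mul s X Y) _
    _ = ENNReal.ofReal (2 ^ |s|) * ((wt |s| (X - Y) * wt (-(|s| + N)) (X - Y)) * (wt s Y * F Y)) := by
        ring
    _ = _ := by
        rw [← wt_add]
        ring_nf

theorem SqInt.avg {s : ℝ} {F : Phase n → ℝ≥0∞} (hF : Measurable F) (h : SqInt s Set.univ F) :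
    SqInt s Set.univ (avg (|s| + (2 * n + 1)) F) := by
  rw [SqInt, Measure.restrict_univ] at h ⊢
  have h1 := lintegral_sq_avg_le ((measurable_wt s).mul hF)
  refine (lintegral_mono fun X => pow_le_pow_left' (wt_mul_avg_le s (2 * n + 1) X) 2).trans_lt ?_
  simp_rw [mul_pow]
  rw [lintegral_const_mul' _ _ (ENNReal.pow_ne_top ENNReal.ofReal_ne_top)]
  refine ENNReal.mul_lt_top (ENNReal.pow_ne_top ENNReal.ofReal_ne_top).lt_top (h1.trans_lt ?_)
  exact ENNReal.mul_lt_top (ENNReal.pow_ne_top (lintegral_wt_neg_lt_top n).ne).lt_top h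

/-- Points of `Ω'` stay away from the complement of `Ω` at a distance comparable to their size. -/
def Separated (Ω' Ω : Set (Phase n)) : Prop :=
  ∃ C : ℝ, ∀ X ∈ Ω', ∀ Y ∉ Ω, bracket X ≤ C * bracket (X - Y)

theorem separated_univ (Ω : Set (Phase n)) : Separated Ω Set.univ :=
  ⟨0, fun _ _ _ hY => absurd (Set.mem_univ _) hY⟩

theorem Separated.wt_le {Ω' Ω : Set (Phase n)} (h : Separated Ω' Ω) {K : ℝ} (hK : 0 ≤ K) :
    ∃ C : ℝ≥0∞, C ≠ ⊤ ∧ ∀ X ∈ Ω', ∀ Y ∉ Ω, wt (-K) (X - Y) ≤ C * wt (-K) X := by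
  obtain ⟨C, hC⟩ := h
  refine ⟨ENNReal.ofReal (C ^ K), ENNReal.ofReal_ne_top, fun X hX Y hY => ?_⟩
  have h1 := hC X hX Y hY
  have h2 := bracket_pos X
  have h3 := bracket_pos (X - Y)
  have hC0 : 0 < C := pos_of_mul_pos_left (h2.trans_le h1) h3.le
  rw [wt, wt, ← ENNReal.ofReal_mul (by positivity)]
  refine ENNReal.ofReal_le_ofReal ?_
  rw [Real.rpow_neg h2.le, Real.rpow_neg h3.le, ← div_eq_mul_inv, inv_le_comm₀ (by positivity)
    (by positivity), inv_div, div_le_iff₀ (by positivity), mul_comm, ← Real.mul_rpow hC0.le h3.le]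
  gcongr

/-- What lies outside Ω contributes negligibly on Ω'. In the exponent of the kernel, `M` powers
transfer the growth of F from Y to X, `M + K` become decay in X by separation (the first `M`
cancelling that growth), and `2 * n + 1` keep the kernel integrable. -/
theorem Separated.avg_indicator_le {Ω' Ω : Set (Phase n)} (h : Separated Ω' Ω) {F : Phase n → ℝ≥0∞}
    {M : ℝ} (hM : 0 ≤ M) {D : ℝ≥0∞} (hD : D ≠ ⊤) (hF : ∀ X, F X ≤ D * wt M X) {K : ℝ} (hK : 0 ≤ K) :
    ∃ C : ℝ≥0∞, C ≠ ⊤ ∧ ∀ X ∈ Ω',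
      avg (2 * n + 1 + (2 * M + K)) (Ωᶜ.indicator F) X ≤ C * wt (-K) X := by
  obtain ⟨C, hC, hCw⟩ := h.wt_le (add_nonneg hM hK)
  refine ⟨(D * ENNReal.ofReal (2 ^ |M|) * C) * ∫⁻ X : Phase n, wt (-(2 * n + 1)) X,
    ENNReal.mul_ne_top (ENNReal.mul_ne_top (ENNReal.mul_ne_top hD ENNReal.ofReal_ne_top) hC)
      (lintegral_wt_neg_lt_top n).ne, fun X hX => ?_⟩
  have key : ∀ Y, wt (-(2 * n + 1 + (2 * M + K))) (X - Y) * (Ωᶜ.indicator F) Y ≤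
      (D * ENNReal.ofReal (2 ^ |M|) * C * wt (-K) X) * wt (-(2 * n + 1)) (Y - X) := fun Y => by
    by_cases hY : Y ∈ Ω
    · simp [hY]
    rw [Set.indicator_of_mem hY]
    have h1 : F Y ≤ D * (ENNReal.ofReal (2 ^ |M|) * (wt M X * wt M (X - Y))) := by
      refine (hF Y).trans (mul_le_mul_right ?_ _)
      have := wt_le_mul M Y X
      rw [abs_of_nonneg hM] at this ⊢
      rwa [wt_sub_comm M Y X] at this
    calc _ ≤ wt (-(2 * n + 1 + (2 * M + K))) (X - Y) *
          (D * (ENNReal.ofReal (2 ^ |M|) * (wt M X * wt M (X - Y)))) := mul_le_mul_right h1 _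
      _ = D * ENNReal.ofReal (2 ^ |M|) * wt M X *
          (wt (-(2 * n + 1 + (2 * M + K))) (X - Y) * wt M (X - Y)) := by ring
      _ = D * ENNReal.ofReal (2 ^ |M|) * wt M X * (wt (-(M + K)) (X - Y) *
          wt (-(2 * n + 1)) (X - Y)) := by
          rw [← wt_add, ← wt_add]
          congr 2
          ring
      _ ≤ D * ENNReal.ofReal (2 ^ |M|) * wt M X * ((C * wt (-(M + K)) X) *
          wt (-(2 * n + 1)) (X - Y)) := by
          gcongr
          exact hCw X hX Y hY
      _ = (D * ENNReal.ofReal (2 ^ |M|) * C * (wt M X * wt (-(M + K)) X)) *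
          wt (-(2 * n + 1)) (X - Y) := by ring
      _ = _ := by
          rw [← wt_add, wt_sub_comm _ X Y]
          congr 3
          ring
  refine (lintegral_mono key).trans (le_of_eq ?_)
  rw [lintegral_const_mul _ (measurable_wt_sub_const _ _), lintegral_wt_sub]
  ring

theorem avg_eq_add (N : ℝ) {Ω : Set (Phase n)} (hΩ : MeasurableSet Ω) {F : Phase n → ℝ≥0∞}
    (hF : Measurable F) (X : Phase n) :
    avg N F X = avg N (Ω.indicator F) X + avg N (Ωᶜ.indicator F) X := by
  have hm : Measurable fun Y => wt (-N) (X - Y) * Ω.indicator F Y := by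
    simp_rw [wt_sub_comm _ X]
    exact (measurable_wt_sub_const _ _).mul (hF.indicator hΩ)
  rw [avg, avg, avg, ← lintegral_add_left hm]
  refine lintegral_congr fun Y => ?_
  rw [← mul_add, Set.indicator_self_add_compl_apply]

theorem sqInt_indicator {s : ℝ} {Ω : Set (Phase n)} (hΩ : MeasurableSet Ω) {F : Phase n → ℝ≥0∞}
    (h : SqInt s Ω F) : SqInt s Set.univ (Ω.indicator F) := by
  rw [SqInt, Measure.restrict_univ]
  rw [SqInt, ← lintegral_indicator hΩ] at h
  refine lt_of_eq_of_lt (lintegral_congr fun X => ?_) h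
  by_cases hX : X ∈ Ω <;> simp [hX]

/-- Averaging preserves weighted square integrability, up to shrinking the set. -/
theorem SqInt.avg_of_separated {s : ℝ} {Ω' Ω : Set (Phase n)} (hsep : Separated Ω' Ω)
    (hΩ : MeasurableSet Ω) (hΩ' : MeasurableSet Ω') {F : Phase n → ℝ≥0∞} (hFm : Measurable F)
    {M : ℝ} {D : ℝ≥0∞} (hD : D ≠ ⊤) (hF : ∀ X, F X ≤ D * wt M X) (h : SqInt s Ω F) :
    ∃ N, SqInt s Ω' (IsoGabor.avg N F) := by
  have hF' : ∀ X, F X ≤ D * wt |M| X := fun X =>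
    (hF X).trans (mul_le_mul_right (wt_mono (le_abs_self M) X) _)
  set K : ℝ := |s| + (2 * n + 1)
  have hK : 0 ≤ K := by positivity
  obtain ⟨C, hC, hCa⟩ := hsep.avg_indicator_le (abs_nonneg M) hD hF' hK
  set N₁ : ℝ := |s| + (2 * n + 1)
  set N₂ : ℝ := 2 * n + 1 + (2 * |M| + K)
  -- `N₁` suffices for the part of F in Ω, by the global L² bound; `N₂` for the part outside Ω, by
  -- separation.
  refine ⟨max N₁ N₂, ?_⟩
  have h1 : SqInt s Ω' (IsoGabor.avg (max N₁ N₂) (Ω.indicator F)) :=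
    (SqInt.avg (hFm.indicator hΩ) (sqInt_indicator hΩ h)).mono_set (Set.subset_univ _) |>.of_le
      hΩ' ENNReal.one_ne_top fun X _ => by
        rw [one_mul]
        exact mul_le_mul_right (avg_anti (le_max_left _ _) _ _) _
  have h2 : SqInt s Ω' (IsoGabor.avg (max N₁ N₂) (Ωᶜ.indicator F)) :=
    sqInt_of_decay hΩ' hC fun X hX => (avg_anti (le_max_right _ _) _ _).trans
      ((hCa X hX).trans (mul_le_mul_right (wt_mono (by
        simp only [K]; linarith [le_abs_self s]) X) _))
  refine (h1.add h2 (measurable_avg _ (hFm.indicator hΩ))).of_le hΩ' ENNReal.one_ne_top fun X _ => ?_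
  rw [one_mul, avg_eq_add _ hΩ hFm]

/-- If `⟨·⟩ˢ F` is square integrable on `Ω` for all `s`, then the averages of `F` decay rapidly on
smaller sets. -/
theorem SqInt.avg_rapid_of_separated {Ω' Ω : Set (Phase n)} (hsep : Separated Ω' Ω)
    (hΩ : MeasurableSet Ω) {F : Phase n → ℝ≥0∞} (hFm : Measurable F)
    {M : ℝ} {D : ℝ≥0∞} (hD : D ≠ ⊤) (hF : ∀ X, F X ≤ D * wt M X) (h : ∀ s, SqInt s Ω F) {K : ℝ}
    (hK : 0 ≤ K) : ∃ (N : ℝ) (C : ℝ≥0∞), C ≠ ⊤ ∧ ∀ X ∈ Ω', wt K X * IsoGabor.avg N F X ≤ C := by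
  have hF' : ∀ X, F X ≤ D * wt |M| X := fun X =>
    (hF X).trans (mul_le_mul_right (wt_mono (le_abs_self M) X) _)
  obtain ⟨C, hC, hCa⟩ := hsep.avg_indicator_le (abs_nonneg M) hD hF' hK
  set r : ℝ := 2 * n + 1
  set N₂ : ℝ := r + (2 * |M| + K)
  set B : ℝ≥0∞ := ENNReal.ofReal (2 ^ |K|) * ((∫⁻ X : Phase n, wt (-r) X) *
    ∫⁻ X, (wt K X * Ω.indicator F X) ^ 2) ^ (1 / 2 : ℝ)
  have hfin := sqInt_indicator hΩ (h K)
  rw [SqInt, Measure.restrict_univ] at hfin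
  refine ⟨max (|K| + r) N₂, B + C, ENNReal.add_ne_top.2 ⟨ENNReal.mul_ne_top ENNReal.ofReal_ne_top
    (ENNReal.rpow_ne_top_of_nonneg (by norm_num) (ENNReal.mul_ne_top (lintegral_wt_neg_lt_top n).ne
      hfin.ne)), hC⟩, fun X hX => ?_⟩
  rw [avg_eq_add _ hΩ hFm, mul_add]
  refine add_le_add ?_ ?_
  · refine (mul_le_mul_right (avg_anti (le_max_left _ _) _ _) _).trans
      ((wt_mul_avg_le K r X).trans (mul_le_mul_right ?_ _))
    -- Cauchy–Schwarz rather than Young: the kernel is itself square integrable, which turns square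
    -- integrability into a pointwise bound.
    have h2 := sq_lintegral_mul_le (μ := volume) (f := fun Y : Phase n => wt (-r) (X - Y))
      ((measurable_wt _).comp (measurable_const.sub measurable_id)).aemeasurable
      ((measurable_wt K).mul (hFm.indicator hΩ)).aemeasurable
    have h3 : ∫⁻ Y, wt (-r) (X - Y) ^ 2 ≤ ∫⁻ X : Phase n, wt (-r) X := by
      refine (lintegral_mono fun Y => ?_).trans (lintegral_wt_sub (-r) X).le
      rw [sq, ← wt_add, wt_sub_comm]
      exact wt_mono (by simp only [r]; have : (0 : ℝ) ≤ n := n.cast_nonneg; linarith) _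
    have h4 := h2.trans (mul_le_mul_left h3 _)
    have h5 := ENNReal.rpow_le_rpow h4 (by norm_num : (0 : ℝ) ≤ 1 / 2)
    rw [← ENNReal.rpow_two, ← ENNReal.rpow_mul] at h5
    norm_num at h5
    rw [IsoGabor.avg]
    convert h5 using 2
  · refine (mul_le_mul_right ((avg_anti (le_max_right _ _) _ _).trans (hCa X hX)) _).trans
      (le_of_eq ?_)
    rw [mul_left_comm, wt_mul_wt_neg, mul_one]

/-! ### Phase space estimates for Weyl operators -/

/-- The modulus of the short-time Fourier transform. -/
def stftNorm (ψ : 𝓢(Cfg n, ℂ)) (u : 𝓢'(Cfg n, ℂ)) (X : Phase n) : ℝ≥0∞ := ‖stft ψ u X‖ₑ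

theorem measurable_stftNorm {ψ : 𝓢(Cfg n, ℂ)} (hψ : ψ ≠ 0) (u : 𝓢'(Cfg n, ℂ)) :
    Measurable (stftNorm ψ u) :=
  (stronglyMeasurable_stft hψ ψ u).measurable.enorm

theorem exists_stftNorm_le {ψ : 𝓢(Cfg n, ℂ)} (hψ : ψ ≠ 0) (u : 𝓢'(Cfg n, ℂ)) :
    ∃ (M : ℝ) (D : ℝ≥0∞), D ≠ ⊤ ∧ ∀ X, stftNorm ψ u X ≤ D * wt M X := by
  obtain ⟨M, C, hC0, hC⟩ := exists_norm_stft_le hψ u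
  refine ⟨M, ENNReal.ofReal C, ENNReal.ofReal_ne_top, fun X => ?_⟩
  rw [stftNorm, ← ofReal_norm, wt, ← ENNReal.ofReal_mul hC0, Real.rpow_natCast]
  exact ENNReal.ofReal_le_ofReal (hC X)

/-- Change of window. The reproducing formula expresses the transform with window `ρ i` as an
integral of V_ψ u(Z) against (Π(Z)ψ, Π(X)ρ i), which by covariance decays in X - Z, uniformly in i.
-/
theorem enorm_stft_le_avg {ψ : 𝓢(Cfg n, ℂ)} (hψ : ψ ≠ 0) (u : 𝓢'(Cfg n, ℂ))
    {ρ : ι → 𝓢(Cfg n, ℂ)} (hρ : SBdd ρ) (N : ℝ) :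
    ∃ C : ℝ≥0∞, C ≠ ⊤ ∧ ∀ i X, ‖stft (ρ i) u X‖ₑ ≤ C * avg N (stftNorm ψ u) X := by
  obtain ⟨C, hC0, hC⟩ := norm_ambig_le (sBdd_const (ι := ι) ψ) hρ ⌈N⌉₊
  have hc := inversionConst_ne_zero hψ
  refine ⟨‖(inversionConst ψ)⁻¹‖ₑ * ENNReal.ofReal C, ENNReal.mul_ne_top enorm_ne_top
    ENNReal.ofReal_ne_top, fun i X => ?_⟩
  have e : stft (ρ i) u X =
      (inversionConst ψ)⁻¹ * ∫ Z, stft ψ u Z * ambig (timeFreqShift Z ψ) (ρ i) X := by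
    have h := integral_stft_mul_pairShift hψ u (conjSchwartz (timeFreqShift X (ρ i)))
    simp_rw [pairShift_conj_timeFreqShift] at h
    rw [h, stft]
    field_simp
  rw [e, enorm_mul, mul_assoc]
  refine mul_le_mul_right ((enorm_integral_le_lintegral_enorm _).trans ?_) _
  rw [avg, ← lintegral_const_mul' _ _ ENNReal.ofReal_ne_top]
  refine lintegral_mono fun Z => ?_
  have h1 : ‖ambig (timeFreqShift Z ψ) (ρ i) X‖ₑ ≤ ENNReal.ofReal C * wt (-N) (X - Z) := by
    rw [← ofReal_norm, norm_ambig_timeFreqShift, wt, ← ENNReal.ofReal_mul hC0]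
    refine ENNReal.ofReal_le_ofReal ((hC i (X - Z)).trans ?_)
    gcongr
    · exact one_le_bracket _
    · exact Nat.le_ceil N
  rw [enorm_mul]
  calc _ ≤ ‖stft ψ u Z‖ₑ * (ENNReal.ofReal C * wt (-N) (X - Z)) := mul_le_mul_right h1 _
    _ = _ := by rw [stftNorm]; ring

/-- A family of symbols `b i` of size `⟨p i⟩ᵐ` yields windows `Opʷ(b i)ψ` of the same size. -/
theorem enorm_stft_weyl_family_le {ψ : 𝓢(Cfg n, ℂ)} (hψ : ψ ≠ 0) (u : 𝓢'(Cfg n, ℂ)) {M : ℕ} {m : ℝ}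
    {p : ι → Phase n} {b : ι → Phase n → ℂ}
    (hb : SymFam M fun i Z => ((bracket (p i) ^ (-m) : ℝ) : ℂ) * b i Z) (N : ℝ) :
    ∃ C : ℝ≥0∞, C ≠ ⊤ ∧ ∀ i, ∃ ρ : 𝓢(Cfg n, ℂ), (∀ x, ρ x = weylFormula (b i) ψ x) ∧
      ‖stft ρ u (p i)‖ₑ ≤ C * (wt m (p i) * avg N (stftNorm ψ u) (p i)) := by
  obtain ⟨χ, hχ, hχb⟩ := exists_schwartz_weylFormula hb (sBdd_const ψ)
  obtain ⟨C, hC, h⟩ := enorm_stft_le_avg hψ u hχb N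
  refine ⟨C, hC, fun i => ⟨((bracket (p i) ^ m : ℝ) : ℂ) • χ i, fun x => ?_, ?_⟩⟩
  · have hp := bracket_pos (p i)
    rw [smul_apply, smul_eq_mul, hχ, weylFormula_symbol_const_mul, ← mul_assoc, ← Complex.ofReal_mul,
      ← Real.rpow_add hp]
    simp
  · rw [stft_smul, Complex.conj_ofReal, enorm_mul, enorm_bracket_rpow, mul_left_comm]
    exact mul_le_mul_right (h i _) _

theorem IsShubinSymbol.stftNorm_le {m : ℝ} {a : Phase n → ℂ} (ha : IsShubinSymbol m a)
    {A : 𝓢'(Cfg n, ℂ) →L[ℂ] 𝓢'(Cfg n, ℂ)} (hA : IsWeylQuantization a A) {ψ : 𝓢(Cfg n, ℂ)}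
    (hψ : ψ ≠ 0) (u : 𝓢'(Cfg n, ℂ)) (N : ℝ) :
    ∃ C : ℝ≥0∞, C ≠ ⊤ ∧ ∀ X, stftNorm ψ (A u) X ≤ C * (wt m X * avg N (stftNorm ψ u) X) := by
  obtain ⟨C, hC, h⟩ := enorm_stft_weyl_family_le hψ u (p := id) ha.symFam_shiftConj N
  refine ⟨C, hC, fun X => ?_⟩
  obtain ⟨ρ, hρ, hle⟩ := h X
  rw [stftNorm, stft_weyl hA ψ ρ X hρ]
  exact hle

theorem IsShubinSymbol.stftNorm_le_of_vanish {a : Phase n → ℂ} (ha : IsShubinSymbol 0 a)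
    {A : 𝓢'(Cfg n, ℂ) →L[ℂ] 𝓢'(Cfg n, ℂ)} (hA : IsWeylQuantization a A) {ψ : 𝓢(Cfg n, ℂ)}
    (hψ : ψ ≠ 0) (u : 𝓢'(Cfg n, ℂ)) {Ω : Set (Phase n)} {ε : ℝ} (hε : 0 < ε)
    (hv : ∀ X ∈ Ω, ∀ Z, ‖Z‖ < ε * bracket X → a (X + Z) = 0) (N : ℝ) (K : ℕ) :
    ∃ C : ℝ≥0∞, C ≠ ⊤ ∧ ∀ X ∈ Ω, stftNorm ψ (A u) X ≤
      C * (wt (-(K : ℝ)) X * avg N (stftNorm ψ u) X) := by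
  have hs := ha.symFam_shiftConj_of_vanish hε hv K
  obtain ⟨C, hC, h⟩ := enorm_stft_weyl_family_le hψ u (p := fun X : Ω => (X : Phase n))
    (b := fun X => shiftConj a X) (m := -(K : ℝ)) (M := K)
    (by simpa only [neg_neg, Real.rpow_natCast] using hs) N
  refine ⟨C, hC, fun X hX => ?_⟩
  obtain ⟨ρ, hρ, hle⟩ := h ⟨X, hX⟩
  rw [stftNorm, stft_weyl hA ψ ρ X hρ]
  exact hle

/-- The substitute for a parametrix. The frozen symbol conj a(X) contributes exactly a(X) V_ψ u(X),
and the remaining window has one order less. -/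
theorem IsShubinSymbol.enorm_mul_stftNorm_le {m : ℝ} {a : Phase n → ℂ} (ha : IsShubinSymbol m a)
    {A : 𝓢'(Cfg n, ℂ) →L[ℂ] 𝓢'(Cfg n, ℂ)} (hA : IsWeylQuantization a A) {ψ : 𝓢(Cfg n, ℂ)}
    (hψ : ψ ≠ 0) (u : 𝓢'(Cfg n, ℂ)) (N : ℝ) :
    ∃ C : ℝ≥0∞, C ≠ ⊤ ∧ ∀ X, ‖a X‖ₑ * stftNorm ψ u X ≤
      stftNorm ψ (A u) X + C * (wt (m - 1) X * avg N (stftNorm ψ u) X) := by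
  obtain ⟨C, hC, h⟩ := enorm_stft_weyl_family_le hψ u (p := id) ha.symFam_shiftConj_sub N
  refine ⟨C, hC, fun X => ?_⟩
  obtain ⟨ρ, hρ, hle⟩ := h X
  have hX := bracket_pos X
  -- For the single point X the normalizing weight is removed again; this serves only to justify
  -- additivity of the Weyl formula in the symbol.
  have hb : SymFam ⌈|m - 1| + 1⌉₊ fun (_ : Unit) Z => shiftConj a X Z + -conj (a X) := by
    have hF := ha.symFam_shiftConj_sub
    have h1 : SymFam ⌈|m - 1| + 1⌉₊ fun (_ : Unit) Z =>
        ((bracket X ^ (-(m - 1)) : ℝ) : ℂ) * (shiftConj a X Z + -conj (a X)) :=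
      ⟨fun _ => hF.contDiff X, fun k => (hF.bound k).imp fun D hD _ Z => hD X Z⟩
    have h2 := h1.const_mul ((bracket X ^ (m - 1) : ℝ) : ℂ)
    simpa only [← mul_assoc, ← Complex.ofReal_mul, ← Real.rpow_add hX, add_neg_cancel,
      Real.rpow_zero, Complex.ofReal_one, one_mul] using h2
  have hsum : ∀ x, (ρ + conj (a X) • ψ) x = weylFormula (shiftConj a X) ψ x := fun x => by
    have h2 := weylFormula_symbol_add hb
      (symFam_const (fun _ : Unit => conj (a X)) (fun _ => le_rfl)) () ψ x
    simp only [neg_add_cancel_right] at h2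
    rw [add_apply, smul_apply, smul_eq_mul, hρ, ← weylFormula_const, ← h2]
  have e : a X * stft ψ u X = stft ψ (A u) X - stft ρ u X := by
    rw [stft_weyl hA ψ _ X hsum, stft_add, stft_smul, Complex.conj_conj]
    ring
  rw [stftNorm, ← enorm_mul, e]
  exact enorm_sub_le.trans (add_le_add le_rfl hle)

/-- Weyl operators of order `m` lose `m` orders of phase space regularity. -/
theorem IsShubinSymbol.sqInt {m : ℝ} {a : Phase n → ℂ} (ha : IsShubinSymbol m a)
    {A : 𝓢'(Cfg n, ℂ) →L[ℂ] 𝓢'(Cfg n, ℂ)} (hA : IsWeylQuantization a A) {ψ : 𝓢(Cfg n, ℂ)}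
    (hψ : ψ ≠ 0) {u : 𝓢'(Cfg n, ℂ)} {Ω' Ω : Set (Phase n)} (hsep : Separated Ω' Ω)
    (hΩ : MeasurableSet Ω) (hΩ' : MeasurableSet Ω') {s : ℝ} (h : SqInt s Ω (stftNorm ψ u)) :
    SqInt (s - m) Ω' (stftNorm ψ (A u)) := by
  obtain ⟨M, D, hD, hM⟩ := exists_stftNorm_le hψ u
  obtain ⟨N, hN⟩ := SqInt.avg_of_separated hsep hΩ hΩ' (measurable_stftNorm hψ u) hD hM h
  obtain ⟨C, hC, hle⟩ := ha.stftNorm_le hA hψ u N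
  refine hN.of_le hΩ' hC fun X _ => (mul_le_mul_right (hle X) _).trans (le_of_eq ?_)
  rw [mul_left_comm, ← mul_assoc (wt (s - m) X), ← wt_add, sub_add_cancel]

/-- The a priori order, coming from polynomial growth, from which every bootstrap starts. -/
theorem exists_sqInt {ψ : 𝓢(Cfg n, ℂ)} (hψ : ψ ≠ 0) (u : 𝓢'(Cfg n, ℂ)) :
    ∃ t, SqInt t Set.univ (stftNorm ψ u) := by
  obtain ⟨M, D, hD, hM⟩ := exists_stftNorm_le hψ u
  exact ⟨-(M + (2 * n + 1)), sqInt_of_decay MeasurableSet.univ hD fun X _ =>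
    (hM X).trans (le_of_eq (by congr 2; ring))⟩

theorem IsShubinSymbol.sqInt_of_vanish {a : Phase n → ℂ} (ha : IsShubinSymbol 0 a)
    {A : 𝓢'(Cfg n, ℂ) →L[ℂ] 𝓢'(Cfg n, ℂ)} (hA : IsWeylQuantization a A) {ψ : 𝓢(Cfg n, ℂ)}
    (hψ : ψ ≠ 0) (u : 𝓢'(Cfg n, ℂ)) {Ω : Set (Phase n)} (hΩ : MeasurableSet Ω) {ε : ℝ} (hε : 0 < ε)
    (hv : ∀ X ∈ Ω, ∀ Z, ‖Z‖ < ε * bracket X → a (X + Z) = 0) (s : ℝ) :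
    SqInt s Ω (stftNorm ψ (A u)) := by
  obtain ⟨M, D, hD, hM⟩ := exists_stftNorm_le hψ u
  obtain ⟨t, h1⟩ := exists_sqInt hψ u
  obtain ⟨N, hN⟩ := SqInt.avg_of_separated (separated_univ Ω) MeasurableSet.univ hΩ
    (measurable_stftNorm hψ u) hD hM h1
  -- Enough decay to lift the a priori order t of u to the required order s.
  set K : ℕ := ⌈s - t⌉₊
  obtain ⟨C, hC, hle⟩ := ha.stftNorm_le_of_vanish hA hψ u hε hv N K
  refine hN.of_le hΩ hC fun X hX => (mul_le_mul_right (hle X hX) _).trans ?_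
  rw [mul_left_comm, ← mul_assoc (wt s X), ← wt_add]
  refine mul_le_mul_right (mul_le_mul_left (wt_mono ?_ X) _) _
  have := Nat.le_ceil (s - t)
  linarith

/-- Elliptic regularity: a gain of one order. -/
theorem IsShubinSymbol.sqInt_of_elliptic {m : ℝ} {a : Phase n → ℂ} (ha : IsShubinSymbol m a)
    {A : 𝓢'(Cfg n, ℂ) →L[ℂ] 𝓢'(Cfg n, ℂ)} (hA : IsWeylQuantization a A) {ψ : 𝓢(Cfg n, ℂ)}
    (hψ : ψ ≠ 0) {u : 𝓢'(Cfg n, ℂ)} {Ω' Ω : Set (Phase n)} (hsep : Separated Ω' Ω)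
    (hΩ : MeasurableSet Ω) (hΩ' : MeasurableSet Ω') {c R : ℝ} (hc : 0 < c)
    (hell : ∀ X ∈ Ω', R ≤ bracket X → c * bracket X ^ m ≤ ‖a X‖) {s t : ℝ}
    (hu : SqInt t Ω (stftNorm ψ u)) (hAu : SqInt (s - m) Ω' (stftNorm ψ (A u))) (hst : s ≤ t + 1) :
    SqInt s Ω' (stftNorm ψ u) := by
  obtain ⟨M, D, hD, hM⟩ := exists_stftNorm_le hψ u
  obtain ⟨N, hN⟩ := SqInt.avg_of_separated hsep hΩ hΩ' (measurable_stftNorm hψ u) hD hM hu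
  obtain ⟨C, hC, hle⟩ := ha.enorm_mul_stftNorm_le hA hψ u N
  have hmeas : MeasurableSet {X : Phase n | R ≤ bracket X} :=
    measurableSet_le measurable_const continuous_bracket.measurable
  -- Where ⟨X⟩ ≥ R, division by |a| costs ⟨X⟩⁻ᵐ; the remainder of order m - 1 is admissible because
  -- s ≤ t + 1.
  have hfar : SqInt s (Ω' ∩ {X | R ≤ bracket X}) (stftNorm ψ u) := by
    have h1 : SqInt (s - m) Ω' fun X => stftNorm ψ (A u) X +
        wt (m - 1) X * avg N (stftNorm ψ u) X := by
      refine hAu.add (sqInt_wt_mul.2 ?_) (measurable_stftNorm hψ _)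
      exact hN.mono hΩ' (by linarith)
    refine (h1.mono_set Set.inter_subset_left).of_le (hΩ'.inter hmeas)
      (C := ENNReal.ofReal c⁻¹ * (1 + C)) (ENNReal.mul_ne_top ENNReal.ofReal_ne_top
        (ENNReal.add_ne_top.2 ⟨ENNReal.one_ne_top, hC⟩)) fun X hX => ?_
    have hX := bracket_pos X
    have h2 : wt m X ≤ ENNReal.ofReal c⁻¹ * ‖a X‖ₑ := by
      rw [wt, ← ofReal_norm, ← ENNReal.ofReal_mul (by positivity)]
      refine ENNReal.ofReal_le_ofReal ?_
      rw [← div_eq_inv_mul, le_div_iff₀ hc, mul_comm]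
      exact hell X ‹_ ∧ _›.1 ‹_ ∧ _›.2
    calc wt s X * stftNorm ψ u X = wt (s - m) X * (wt m X * stftNorm ψ u X) := by
          rw [← mul_assoc, ← wt_add, sub_add_cancel]
      _ ≤ wt (s - m) X * ((ENNReal.ofReal c⁻¹ * ‖a X‖ₑ) * stftNorm ψ u X) := by gcongr
      _ = ENNReal.ofReal c⁻¹ * (wt (s - m) X * (‖a X‖ₑ * stftNorm ψ u X)) := by ring
      _ ≤ ENNReal.ofReal c⁻¹ * (wt (s - m) X * (stftNorm ψ (A u) X +
          C * (wt (m - 1) X * avg N (stftNorm ψ u) X))) := by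
          gcongr
          exact hle X
      _ ≤ ENNReal.ofReal c⁻¹ * (wt (s - m) X * ((1 + C) * (stftNorm ψ (A u) X +
          wt (m - 1) X * avg N (stftNorm ψ u) X))) := by
          gcongr
          rw [mul_add]
          refine add_le_add (le_mul_of_one_le_left' le_self_add) ?_
          gcongr
          exact le_add_self
      _ = _ := by ring
  -- Where ⟨X⟩ < R, all weights are comparable and the polynomial bound suffices.
  have hnear : SqInt s (Ω' ∩ {X | R ≤ bracket X}ᶜ) (stftNorm ψ u) := by
    refine sqInt_of_decay (hΩ'.inter hmeas.compl) (C := D * ENNReal.ofReal (R ^ |M + (s + (2 * n + 1))|))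
      (ENNReal.mul_ne_top hD ENNReal.ofReal_ne_top) fun X hX => (hM X).trans ?_
    have h3 : bracket X ≤ R := (not_le.1 (show ¬R ≤ bracket X from hX.2)).le
    rw [mul_assoc]
    refine mul_le_mul_right ?_ _
    have e : wt M X = wt (M + (s + (2 * n + 1))) X * wt (-(s + (2 * n + 1))) X := by
      rw [← wt_add]; congr 1; ring
    rw [e]
    refine mul_le_mul_left ((wt_mono (le_abs_self _) X).trans ?_) _
    have hX := bracket_pos X
    exact ENNReal.ofReal_le_ofReal (by gcongr)
  simpa only [Set.inter_union_compl] using hfar.union hnear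

/-! ### Square integrable and Schwartz functions in phase space -/

theorem lintegral_sq_enorm_eq {α : Type*} [MeasurableSpace α] (μ : Measure α) (f : α → ℂ) :
    ∫⁻ x, ‖f x‖ₑ ^ 2 ∂μ = eLpNorm f 2 μ ^ 2 := by
  have h := eLpNorm_nnreal_pow_eq_lintegral (f := f) (μ := μ) (p := 2) (by norm_num)
  simp only [NNReal.coe_ofNat, ENNReal.coe_ofNat, ENNReal.rpow_ofNat] at h
  exact h.symm

theorem memLp_two_iff_lintegral {α : Type*} [MeasurableSpace α] {μ : Measure α} {f : α → ℂ}
    (hf : AEStronglyMeasurable f μ) : MemLp f 2 μ ↔ ∫⁻ x, ‖f x‖ₑ ^ 2 ∂μ < ⊤ := by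
  rw [lintegral_sq_enorm_eq]
  refine ⟨fun h => ENNReal.pow_lt_top h.2, fun h => ⟨hf, ?_⟩⟩
  by_contra hc
  rw [not_lt, top_le_iff] at hc
  simp [hc] at h

theorem memLp_indicator_iff_sqInt {ψ : 𝓢(Cfg n, ℂ)} (hψ : ψ ≠ 0) (u : 𝓢'(Cfg n, ℂ)) (s : ℝ)
    {Γ : Set (Phase n)} (hΓ : MeasurableSet Γ) :
    MemLp (Γ.indicator fun X => ((bracket X ^ s : ℝ) : ℂ) * stft ψ u X) 2 volume ↔
      SqInt s Γ (stftNorm ψ u) := by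
  rw [memLp_indicator_iff_restrict hΓ, memLp_two_iff_lintegral, SqInt]
  · simp only [enorm_mul, enorm_bracket_rpow, stftNorm]
  · exact ((Complex.continuous_ofReal.comp (continuous_bracket_rpow s)).stronglyMeasurable.mul
      (stronglyMeasurable_stft hψ ψ u)).aestronglyMeasurable

theorem ofReal_integral_sq_norm {α : Type*} [MeasurableSpace α] {μ : Measure α} {f : α → ℂ}
    (hf : MemLp f 2 μ) : ENNReal.ofReal (∫ x, ‖f x‖ ^ 2 ∂μ) = ∫⁻ x, ‖f x‖ₑ ^ 2 ∂μ := by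
  rw [ofReal_integral_eq_lintegral_ofReal (hf.integrable_norm_pow (p := 2) (by norm_num))
    (Filter.Eventually.of_forall fun x => by positivity)]
  refine lintegral_congr fun x => ?_
  rw [ENNReal.ofReal_pow (norm_nonneg _), ofReal_norm]

theorem memLp_ambig (f g : 𝓢(Cfg n, ℂ)) : MemLp (ambig f g) 2 volume := by
  obtain ⟨C, hC0, hC⟩ := norm_ambig_le (sBdd_const (ι := Unit) f) (sBdd_const g) (n + 1)
  exact memLp_of_norm_le_bracket (continuous_ambig f g).aestronglyMeasurable fun X => hC () X

/-- Moyal's identity. -/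
theorem lintegral_sq_ambig (f ψ : 𝓢(Cfg n, ℂ)) :
    ∫⁻ Y, ‖ambig f ψ Y‖ₑ ^ 2 = ‖inversionConst ψ‖ₑ * ∫⁻ t, ‖f t‖ₑ ^ 2 := by
  -- With test function conj f, the weak form of the inversion formula becomes an identity between
  -- squared norms.
  have h := integral_ambig_mul_pairShift f ψ (conjSchwartz f)
  simp only [pairShift_eq_conj, conjSchwartz_conjSchwartz, conjSchwartz_apply, Complex.mul_conj,
    Complex.normSq_eq_norm_sq] at h
  rw [integral_complex_ofReal, integral_complex_ofReal] at h
  have h2 := congrArg (‖·‖ₑ) h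
  simp only [enorm_mul] at h2
  have e : ∀ r : ℝ, 0 ≤ r → ‖(r : ℂ)‖ₑ = ENNReal.ofReal r := fun r hr => by
    rw [← ofReal_norm, Complex.norm_real, Real.norm_of_nonneg hr]
  rwa [e _ (integral_nonneg fun _ => by positivity), e _ (integral_nonneg fun _ => by positivity),
    ofReal_integral_sq_norm (memLp_ambig f ψ), ofReal_integral_sq_norm (f.memLp 2 volume)] at h2

/-- For Schwartz approximations of f in L² the transforms converge pointwise, being inner products
with Π(X)ψ, and Moyal's identity controls their norms; Fatou's lemma passes to the limit. -/
theorem IsL2.sqInt {v : 𝓢'(Cfg n, ℂ)} (hv : IsL2 v) (ψ : 𝓢(Cfg n, ℂ)) :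
    SqInt 0 Set.univ (stftNorm ψ v) := by
  obtain ⟨f, hf, hvf⟩ := hv
  have hd := SchwartzMap.denseRange_toLpCLM (E := Cfg n) (F := ℂ) (p := 2) (μ := volume)
    ENNReal.ofNat_ne_top
  obtain ⟨x, hx, hlim⟩ := mem_closure_iff_seq_limit.1 (hd (hf.toLp f))
  choose g hg using hx
  have hstft : ∀ X, Filter.Tendsto (fun k => ambig (g k) ψ X) Filter.atTop (nhds (stft ψ v X)) := by
    intro X
    have h1 : Filter.Tendsto (fun k => inner ℂ ((timeFreqShift X ψ).toLp 2 volume) (x k))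
        Filter.atTop (nhds (inner ℂ ((timeFreqShift X ψ).toLp 2 volume) (hf.toLp f))) :=
      tendsto_const_nhds.inner hlim
    have e2 : inner ℂ ((timeFreqShift X ψ).toLp 2 volume) (hf.toLp f) = stft ψ v X := by
      rw [stft, hvf, L2.inner_def]
      refine integral_congr_ae ?_
      filter_upwards [(timeFreqShift X ψ).coeFn_toLp 2 volume, hf.coeFn_toLp] with t h1 h2
      rw [h1, h2, RCLike.inner_apply, conjSchwartz_apply]
    have e1 : ∀ k, inner ℂ ((timeFreqShift X ψ).toLp 2 volume) (x k) = ambig (g k) ψ X := fun k => by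
      rw [← hg k, SchwartzMap.toLpCLM_apply, L2.inner_def, ambig]
      refine integral_congr_ae ?_
      filter_upwards [(timeFreqShift X ψ).coeFn_toLp 2 volume, (g k).coeFn_toLp 2 volume]
        with t h1 h2
      rw [h1, h2, RCLike.inner_apply]
    simpa only [e1, e2] using h1
  have hnorm : ∀ k, ∫⁻ Y, ‖ambig (g k) ψ Y‖ₑ ^ 2 = ‖inversionConst ψ‖ₑ * ‖x k‖ₑ ^ 2 := fun k => by
    rw [lintegral_sq_ambig, lintegral_sq_enorm_eq, ← hg k, SchwartzMap.toLpCLM_apply,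
      SchwartzMap.toLp, Lp.enorm_toLp]
  have hnl : Filter.Tendsto (fun k => ∫⁻ Y, ‖ambig (g k) ψ Y‖ₑ ^ 2) Filter.atTop
      (nhds (‖inversionConst ψ‖ₑ * ‖hf.toLp f‖ₑ ^ 2)) := by
    simp_rw [hnorm]
    refine ENNReal.Tendsto.const_mul ?_ (Or.inr enorm_ne_top)
    exact ENNReal.Tendsto.pow (hlim.enorm)
  rw [SqInt, Measure.restrict_univ]
  calc ∫⁻ X, (wt 0 X * stftNorm ψ v X) ^ 2
      = ∫⁻ X, Filter.liminf (fun k => ‖ambig (g k) ψ X‖ₑ ^ 2) Filter.atTop := by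
        refine lintegral_congr fun X => ?_
        rw [wt_zero, one_mul, stftNorm]
        exact (ENNReal.Tendsto.pow (hstft X).enorm).liminf_eq.symm
    _ ≤ Filter.liminf (fun k => ∫⁻ X, ‖ambig (g k) ψ X‖ₑ ^ 2) Filter.atTop :=
        lintegral_liminf_le fun k => (continuous_ambig (g k) ψ).enorm.measurable.pow_const 2
    _ = _ := hnl.liminf_eq
    _ < ⊤ := ENNReal.mul_lt_top enorm_lt_top (ENNReal.pow_lt_top enorm_lt_top)

/-- By the reproducing formula, Cauchy–Schwarz and Moyal's identity for the test function, v is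
bounded in the L² norm of φ, so it is represented by an L² function. -/
theorem isL2_of_sqInt {v : 𝓢'(Cfg n, ℂ)} {ψ : 𝓢(Cfg n, ℂ)} (hψ : ψ ≠ 0)
    (h : SqInt 0 Set.univ (stftNorm ψ v)) : IsL2 v := by
  have hV : MemLp (stft ψ v) 2 volume := by
    refine (memLp_two_iff_lintegral (stronglyMeasurable_stft hψ ψ v).aestronglyMeasurable).2 ?_
    rw [SqInt, Measure.restrict_univ] at h
    simpa only [wt_zero, one_mul, stftNorm] using h
  have hc := inversionConst_ne_zero hψ
  have hP : ∀ φ : 𝓢(Cfg n, ℂ), MemLp (pairShift ψ φ) 2 volume := fun φ => by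
    simpa using memLp_bracket_mul_pairShift ψ φ 0
  have hPn : ∀ φ : 𝓢(Cfg n, ℂ), ‖(hP φ).toLp _‖ ≤
      Real.sqrt ‖inversionConst ψ‖ * ‖φ.toLp 2 volume‖ := fun φ => by
    have h1 : ‖(hP φ).toLp _‖ₑ ^ 2 = ‖inversionConst ψ‖ₑ * ‖φ.toLp 2 volume‖ₑ ^ 2 := by
      rw [Lp.enorm_toLp, ← lintegral_sq_enorm_eq, SchwartzMap.toLp, Lp.enorm_toLp,
        ← lintegral_sq_enorm_eq]
      have h2 := lintegral_sq_ambig (conjSchwartz φ) ψ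
      have e1 : ∀ Y, ‖pairShift ψ φ Y‖ₑ = ‖ambig (conjSchwartz φ) ψ Y‖ₑ := fun Y => by
        rw [← ofReal_norm, norm_pairShift, ofReal_norm]
      have e2 : ∀ t, ‖conjSchwartz φ t‖ₑ = ‖φ t‖ₑ := fun t => by
        rw [conjSchwartz_apply, ← ofReal_norm, Complex.norm_conj, ofReal_norm]
      simp_rw [e1]
      rw [h2]
      simp_rw [e2]
    have h3 := congrArg ENNReal.toReal h1
    simp only [ENNReal.toReal_pow, ENNReal.toReal_mul, toReal_enorm] at h3
    refine abs_le_of_sq_le_sq' ?_ (by positivity) |>.2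
    rw [mul_pow, Real.sq_sqrt (norm_nonneg _), h3]
  have hb : ∀ φ : 𝓢(Cfg n, ℂ), ‖v φ‖ ≤ (‖(inversionConst ψ)⁻¹‖ * (‖hV.toLp _‖ *
      Real.sqrt ‖inversionConst ψ‖)) * ‖(SchwartzMap.toLpCLM ℂ ℂ 2 volume).toLinearMap φ‖ := fun φ => by
    have e : v φ = (inversionConst ψ)⁻¹ * ∫ Z, stft ψ v Z * pairShift ψ φ Z := by
      rw [integral_stft_mul_pairShift hψ v φ]
      field_simp
    rw [e, norm_mul, mul_assoc, mul_assoc]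
    refine mul_le_mul_of_nonneg_left ((norm_integral_le_integral_norm _).trans ?_) (norm_nonneg _)
    simp_rw [norm_mul]
    exact (integral_norm_mul_norm_le hV (hP φ)).trans
      (mul_le_mul_of_nonneg_left (hPn φ) (norm_nonneg _))
  let vL : 𝓢(Cfg n, ℂ) →L[ℂ] ℂ := v
  obtain ⟨w, hw⟩ := exists_inner_representation (SchwartzMap.toLpCLM ℂ ℂ 2 volume).toLinearMap
    vL.toLinearMap _ hb
  refine ⟨fun t => conj (w t), (Lp.memLp w).star, fun φ => (hw φ).trans ?_⟩
  rw [L2.inner_def]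
  refine integral_congr_ae ?_
  filter_upwards [φ.coeFn_toLp 2 volume] with t ht
  change inner ℂ (w t) (φ.toLp 2 volume t) = _
  rw [ht, RCLike.inner_apply]
  ring

theorem IsSchwartz.sqInt {v : 𝓢'(Cfg n, ℂ)} (hv : IsSchwartz v) (ψ : 𝓢(Cfg n, ℂ)) (s : ℝ) :
    SqInt s Set.univ (stftNorm ψ v) := by
  obtain ⟨f, hf⟩ := hv
  set N : ℕ := ⌈s + (2 * n + 1)⌉₊
  obtain ⟨C, hC0, hC⟩ := norm_ambig_le (sBdd_const (ι := Unit) f) (sBdd_const ψ) N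
  refine sqInt_of_decay MeasurableSet.univ (C := ENNReal.ofReal C) ENNReal.ofReal_ne_top
    fun X _ => ?_
  have e : stft ψ v X = ambig f ψ X := by
    rw [stft, hf, ambig]
    simp only [conjSchwartz_apply]
  rw [stftNorm, e, ← ofReal_norm]
  calc _ ≤ ENNReal.ofReal (C * bracket X ^ (-(N : ℝ))) := ENNReal.ofReal_le_ofReal (hC () X)
    _ = ENNReal.ofReal C * wt (-(N : ℝ)) X := by rw [ENNReal.ofReal_mul hC0, wt]
    _ ≤ _ := mul_le_mul_right (wt_mono (neg_le_neg (Nat.le_ceil _)) X) _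

/-- Cauchy–Schwarz makes all moments of V_ψ v integrable, so its superposition of time-frequency
shifts is a Schwartz function, and the reproducing formula identifies this with v up to the
inversion constant. -/
theorem isSchwartz_of_sqInt {v : 𝓢'(Cfg n, ℂ)} {ψ : 𝓢(Cfg n, ℂ)} (hψ : ψ ≠ 0)
    (h : ∀ s, SqInt s Set.univ (stftNorm ψ v)) : IsSchwartz v := by
  have hm := stronglyMeasurable_stft hψ ψ v
  have hF : RapidInt (stft ψ v) := by
    refine ⟨hm.aestronglyMeasurable, fun K => ?_⟩
    have h1 := (memLp_indicator_iff_sqInt hψ v (K + (n + 1)) MeasurableSet.univ).2 (h _)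
    rw [Set.indicator_univ] at h1
    refine ((memLp_bracket_rpow_neg n).integrable_mul h1.norm).congr
      (Filter.Eventually.of_forall fun X => ?_)
    have hX := bracket_pos X
    simp only [Pi.mul_apply]
    rw [norm_mul, Complex.norm_real, Real.norm_of_nonneg (by positivity), ← mul_assoc,
      ← Real.rpow_add hX, ← Real.rpow_natCast]
    congr 2
    push_cast
    ring
  obtain ⟨Φ, hΦ⟩ := exists_schwartz_superpos ψ hF
  have hc := inversionConst_ne_zero hψ
  refine ⟨(inversionConst ψ)⁻¹ • Φ, fun φ => ?_⟩
  have h1 := integral_superposition_mul ψ φ hF.integrable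
  rw [integral_stft_mul_pairShift hψ v φ] at h1
  simp only [smul_apply, smul_eq_mul, mul_assoc, hΦ]
  rw [integral_const_mul]
  simp only [superpos]
  rw [h1]
  field_simp

/-! ### Powers of the bracket and conic cutoffs as Shubin symbols -/

theorem norm_iteratedFDeriv_clm_le {F : Type*} [NormedAddCommGroup F] [NormedSpace ℝ F]
    (L : Phase n →L[ℝ] F) (k : ℕ) (X : Phase n) :
    ‖iteratedFDeriv ℝ k (fun X => L X) X‖ ≤ ‖L‖ * bracket X ^ (1 - k : ℝ) := by
  have h1 := bracket_pos X
  rcases k with _ | _ | k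
  · rw [norm_iteratedFDeriv_zero]
    simpa using (L.le_opNorm X).trans (by gcongr; exact norm_le_bracket X)
  · rw [← norm_iteratedFDeriv_fderiv, norm_iteratedFDeriv_zero]
    simp
  · have h : fderiv ℝ (fun X => L X) = fun _ => L := by ext1 Y; simp
    rw [← norm_iteratedFDeriv_fderiv, h, iteratedFDeriv_const_of_ne (by omega)]
    simp only [Pi.zero_apply, norm_zero]
    positivity

theorem norm_iteratedFDeriv_sq_norm_le (L : Phase n →L[ℝ] Cfg n) (hL : ‖L‖ ≤ 1) (k : ℕ)
    (X : Phase n) :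
    ‖iteratedFDeriv ℝ k (fun X => ‖L X‖ ^ 2) X‖ ≤ 2 ^ k * bracket X ^ (2 - k : ℝ) := by
  have e : (fun X => ‖L X‖ ^ 2) = fun X => innerSL ℝ (L X) (L X) := by
    funext Y
    rw [innerSL_apply_apply, real_inner_self_eq_norm_sq]
  have hX := bracket_pos X
  rw [e]
  refine ((innerSL ℝ).norm_iteratedFDeriv_le_of_bilinear_of_le_one (N := ∞) L.contDiff L.contDiff X
    (by exact_mod_cast le_top) (norm_innerSL_le ℝ)).trans ?_
  have h : ∀ j, ‖iteratedFDeriv ℝ j (fun X => L X) X‖ ≤ bracket X ^ (1 - j : ℝ) := fun j =>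
    (norm_iteratedFDeriv_clm_le L j X).trans (mul_le_of_le_one_left (by positivity) hL)
  calc _ ≤ ∑ i ∈ Finset.range (k + 1), (k.choose i : ℝ) * bracket X ^ (2 - k : ℝ) := by
        refine Finset.sum_le_sum fun i hi => ?_
        rw [mul_assoc]
        refine mul_le_mul_of_nonneg_left ?_ (Nat.cast_nonneg _)
        refine (mul_le_mul (h i) (h (k - i)) (norm_nonneg _) (by positivity)).trans (le_of_eq ?_)
        rw [← Real.rpow_add hX, Nat.cast_sub (Finset.mem_range_succ_iff.1 hi)]
        congr 1
        ring
    _ = _ := by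
        rw [← Finset.sum_mul, ← Nat.cast_sum, Nat.sum_range_choose]
        push_cast
        ring

theorem bracket_rpow_eq (s : ℝ) (X : Phase n) :
    bracket X ^ s = (1 + ‖X.1‖ ^ 2 + ‖X.2‖ ^ 2) ^ (s / 2) := by
  rw [bracket, Real.sqrt_eq_rpow, ← Real.rpow_mul (by positivity)]
  congr 1
  ring

theorem contDiff_one_add_sq : ContDiff ℝ ∞ fun X : Phase n => 1 + ‖X.1‖ ^ 2 + ‖X.2‖ ^ 2 :=
  (contDiff_const.add (contDiff_fst.norm_sq ℝ)).add (contDiff_snd.norm_sq ℝ)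

theorem contDiff_bracket_rpow (s : ℝ) : ContDiff ℝ ∞ fun X : Phase n => bracket X ^ s := by
  simp_rw [bracket_rpow_eq]
  exact contDiff_one_add_sq.rpow_const_of_ne fun X => by positivity

theorem norm_iteratedFDeriv_bracket_rpow_le (s : ℝ) (k : ℕ) :
    ∃ C : ℝ, 0 ≤ C ∧ ∀ X : Phase n,
      ‖iteratedFDeriv ℝ k (fun X : Phase n => bracket X ^ s) X‖ ≤ C * bracket X ^ (s - k) := by
  let g : ℝ → ℝ := fun r => r ^ (s / 2)
  let C : ℝ := ∑ i ∈ Finset.range (k + 1), ‖iteratedFDerivWithin ℝ i g (Set.Ioi 0) 1‖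
  have hC0 : 0 ≤ C := Finset.sum_nonneg fun _ _ => norm_nonneg _
  refine ⟨k.factorial * C * 4 ^ k, by positivity, fun X => ?_⟩
  have hX := bracket_pos X
  -- Rescaling at the frozen point X: since f(X) = 1, the outer power function is differentiated
  -- only at 1, with constants independent of X, while the i-th derivative of f at X is at most
  -- (4/⟨X⟩)ⁱ for i ≥ 1. The chain rule for higher derivatives then gives the factor ⟨X⟩⁻ᵏ.
  let f : Phase n → ℝ := fun Y => bracket X ^ (-2 : ℝ) • (1 + ‖Y.1‖ ^ 2 + ‖Y.2‖ ^ 2)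
  have hf : ContDiff ℝ ∞ f := contDiff_one_add_sq.const_smul _
  have hf1 : f X = 1 := by
    simp only [f, smul_eq_mul]
    rw [← bracket_sq, Real.rpow_neg hX.le, Real.rpow_two]
    field_simp
  have e : (fun Y : Phase n => bracket Y ^ s) = fun Y => bracket X ^ s • (g ∘ f) Y := by
    funext Y
    simp only [g, f, Function.comp, smul_eq_mul]
    rw [Real.mul_rpow (by positivity) (by positivity), ← Real.rpow_mul hX.le, ← mul_assoc,
      ← Real.rpow_add hX, bracket_rpow_eq s Y]
    ring_nf
    simp
  have hgf : ContDiff ℝ ∞ (g ∘ f) := hf.rpow_const_of_ne fun Y => by simp only [f, smul_eq_mul]; positivity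
  have hcomp : ‖iteratedFDeriv ℝ k (g ∘ f) X‖ ≤ k.factorial * C * (4 * (bracket X)⁻¹) ^ k := by
    refine norm_iteratedFDeriv_comp_le' (t := Set.Ioi 0) (N := ∞) ?_ (uniqueDiffOn_Ioi 0) ?_ hf
      (by exact_mod_cast le_top) X ?_ ?_
    · rintro _ ⟨Y, rfl⟩
      simp only [f, smul_eq_mul, Set.mem_Ioi]
      positivity
    · exact contDiffOn_id.rpow_const_of_ne fun x hx => (Set.mem_Ioi.1 hx).ne'
    · intro i hi
      rw [hf1]
      exact Finset.single_le_sum (f := fun i => ‖iteratedFDerivWithin ℝ i g (Set.Ioi 0) 1‖)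
        (fun _ _ => norm_nonneg _) (Finset.mem_range_succ_iff.2 hi)
    · intro i hi _
      have hi' : ((i : ℕ∞) : WithTop ℕ∞) ≤ ((⊤ : ℕ∞) : WithTop ℕ∞) := by exact_mod_cast le_top
      have hp : ContDiff ℝ ∞ fun Y : Phase n => ‖Y.1‖ ^ 2 := contDiff_fst.norm_sq ℝ
      have hq : ContDiff ℝ ∞ fun Y : Phase n => ‖Y.2‖ ^ 2 := contDiff_snd.norm_sq ℝ
      have e1 : iteratedFDeriv ℝ i f X = bracket X ^ (-2 : ℝ) •
          (iteratedFDeriv ℝ i (fun Y : Phase n => ‖Y.1‖ ^ 2) X +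
            iteratedFDeriv ℝ i (fun Y : Phase n => ‖Y.2‖ ^ 2) X) := by
        rw [iteratedFDeriv_const_smul_apply' (contDiff_one_add_sq.contDiffAt.of_le hi'),
          fun_iteratedFDeriv_add_apply ((contDiff_const.add hp).contDiffAt.of_le hi')
            (hq.contDiffAt.of_le hi'), fun_iteratedFDeriv_add_apply contDiffAt_const
            (hp.contDiffAt.of_le hi'), iteratedFDeriv_const_of_ne (by omega)]
        simp
      rw [e1, norm_smul, Real.norm_of_nonneg (by positivity)]
      have h1 := norm_iteratedFDeriv_sq_norm_le (ContinuousLinearMap.fst ℝ (Cfg n) (Cfg n))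
        (ContinuousLinearMap.norm_fst_le ..) i X
      have h2 := norm_iteratedFDeriv_sq_norm_le (ContinuousLinearMap.snd ℝ (Cfg n) (Cfg n))
        (ContinuousLinearMap.norm_snd_le ..) i X
      simp only [ContinuousLinearMap.coe_fst', ContinuousLinearMap.coe_snd'] at h1 h2
      calc _ ≤ bracket X ^ (-2 : ℝ) * (2 ^ i * bracket X ^ (2 - i : ℝ) +
            2 ^ i * bracket X ^ (2 - i : ℝ)) := by
            gcongr
            exact (norm_add_le _ _).trans (add_le_add h1 h2)
        _ = 2 ^ (i + 1) * (bracket X ^ (-2 : ℝ) * bracket X ^ (2 - i : ℝ)) := by ring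
        _ = 2 ^ (i + 1) * (bracket X)⁻¹ ^ i := by
            rw [← Real.rpow_add hX, inv_pow, ← Real.rpow_natCast (bracket X), ← Real.rpow_neg hX.le]
            ring_nf
        _ ≤ 4 ^ i * (bracket X)⁻¹ ^ i := by
            gcongr
            rw [show (4 : ℝ) = 2 ^ 2 by norm_num, ← pow_mul]
            exact pow_le_pow_right₀ (by norm_num) (by omega)
        _ = _ := by rw [mul_pow]
  rw [e, iteratedFDeriv_const_smul_apply' (hgf.contDiffAt.of_le (by exact_mod_cast le_top)),
    norm_smul, Real.norm_of_nonneg (by positivity)]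
  calc _ ≤ bracket X ^ s * (k.factorial * C * (4 * (bracket X)⁻¹) ^ k) := by gcongr
    _ = _ := by
      rw [mul_pow, inv_pow, sub_eq_add_neg, Real.rpow_add hX, Real.rpow_neg hX.le, Real.rpow_natCast]
      ring

theorem IsShubinSymbol.ofReal {m : ℝ} {a : Phase n → ℝ} (hs : ContDiff ℝ ∞ a)
    (hb : ∀ k : ℕ, ∃ C : ℝ, ∀ X : Phase n, ‖iteratedFDeriv ℝ k a X‖ ≤ C * bracket X ^ (m - k)) :
    IsShubinSymbol m fun X => (a X : ℂ) := by
  refine ⟨Complex.ofRealCLM.contDiff.comp hs, fun k => (hb k).imp fun C hC X => ?_⟩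
  have := Complex.ofRealLI.norm_iteratedFDeriv_comp_left (hs.contDiffAt (x := X))
    (i := k) (by exact_mod_cast le_top)
  exact this.le.trans (hC X)

theorem isShubinSymbol_bracket_rpow (s : ℝ) :
    IsShubinSymbol s fun X : Phase n => ((bracket X ^ s : ℝ) : ℂ) :=
  .ofReal (contDiff_bracket_rpow s) fun k => by
    obtain ⟨C, -, hC⟩ := norm_iteratedFDeriv_bracket_rpow_le (n := n) s k
    exact ⟨C, hC⟩

/-- The radial compactification `X ↦ X / ⟨X⟩`. -/
def radial (X : Phase n) : Phase n := bracket X ^ (-1 : ℝ) • X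

theorem contDiff_radial : ContDiff ℝ ∞ (radial (n := n)) :=
  (contDiff_bracket_rpow (-1)).smul contDiff_id

theorem norm_iteratedFDeriv_radial_le (k : ℕ) :
    ∃ C : ℝ, ∀ X : Phase n, ‖iteratedFDeriv ℝ k radial X‖ ≤ C * bracket X ^ (-(k : ℝ)) := by
  choose C hC0 hC using norm_iteratedFDeriv_bracket_rpow_le (n := n) (-1)
  refine ⟨∑ i ∈ Finset.range (k + 1), (k.choose i : ℝ) * C i, fun X => ?_⟩
  have hX := bracket_pos X
  refine (norm_iteratedFDeriv_smul_le (contDiff_bracket_rpow (-1)) contDiff_id X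
    (by exact_mod_cast le_top)).trans ?_
  rw [Finset.sum_mul]
  refine Finset.sum_le_sum fun i hi => ?_
  have h1 := norm_iteratedFDeriv_clm_le (ContinuousLinearMap.id ℝ (Phase n)) (k - i) X
  have h2 : ‖iteratedFDeriv ℝ (k - i) id X‖ ≤ bracket X ^ (1 - (k - i : ℕ) : ℝ) :=
    h1.trans (mul_le_of_le_one_left (by positivity) ContinuousLinearMap.norm_id_le)
  have hi0 := hC0 i
  calc _ ≤ (k.choose i : ℝ) * (C i * bracket X ^ (-1 - i : ℝ)) * bracket X ^ (1 - (k - i : ℕ) : ℝ) := by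
        gcongr
        exact hC i X
    _ = (k.choose i : ℝ) * C i * (bracket X ^ (-1 - i : ℝ) * bracket X ^ (1 - (k - i : ℕ) : ℝ)) := by
        ring
    _ = _ := by
        rw [← Real.rpow_add hX, Nat.cast_sub (Finset.mem_range_succ_iff.1 hi)]
        congr 2
        ring

/-- The derivatives of χ are bounded and each derivative of `radial` gains a power of ⟨X⟩⁻¹, so a
function smooth on the compactification pulls back to a symbol of order zero. -/
theorem isShubinSymbol_comp_radial {χ : Phase n → ℝ} (hχ : ContDiff ℝ ∞ χ)
    (hχc : HasCompactSupport χ) : IsShubinSymbol 0 fun X => (χ (radial X) : ℂ) := by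
  refine .ofReal (hχ.comp contDiff_radial) fun k => ?_
  have hbd : ∀ i : ℕ, ∃ B : ℝ, ∀ Y, ‖iteratedFDeriv ℝ i χ Y‖ ≤ B := fun i =>
    (hχc.iteratedFDeriv i).exists_bound_of_continuous
      (hχ.continuous_iteratedFDeriv (by exact_mod_cast le_top))
  choose B hB using hbd
  choose C hC using norm_iteratedFDeriv_radial_le (n := n)
  let B' : ℝ := ∑ i ∈ Finset.range (k + 1), |B i|
  let C' : ℝ := 1 + ∑ i ∈ Finset.range (k + 1), |C i|
  -- With C' ≥ 1 a single constant can be raised to the power i, as the estimate for compositions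
  -- requires.
  have hC' : 1 ≤ C' := le_add_of_nonneg_right (Finset.sum_nonneg fun _ _ => abs_nonneg _)
  refine ⟨k.factorial * B' * C' ^ k, fun X => ?_⟩
  have hX := bracket_pos X
  have h := norm_iteratedFDeriv_comp_le (n := k) (C := B') (D := C' * (bracket X)⁻¹) hχ contDiff_radial
    (by exact_mod_cast le_top) X (fun i hi => (hB i _).trans ((le_abs_self _).trans
      (Finset.single_le_sum (f := fun i => |B i|) (fun _ _ => abs_nonneg _)
        (Finset.mem_range_succ_iff.2 hi)))) fun i hi1 hik => by
      refine (hC i X).trans ?_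
      rw [mul_pow, inv_pow, Real.rpow_neg hX.le, Real.rpow_natCast]
      refine mul_le_mul_of_nonneg_right ?_ (by positivity)
      have h1 : |C i| ≤ ∑ i ∈ Finset.range (k + 1), |C i| :=
        Finset.single_le_sum (f := fun i => |C i|) (fun _ _ => abs_nonneg _)
          (Finset.mem_range_succ_iff.2 hik)
      calc C i ≤ |C i| := le_abs_self _
        _ ≤ C' := by simp only [C']; linarith
        _ ≤ C' ^ i := le_self_pow₀ hC' (by omega)
  refine h.trans (le_of_eq ?_)
  rw [zero_sub, Real.rpow_neg hX.le, Real.rpow_natCast, mul_pow, inv_pow]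
  ring

/-! ### Conic neighbourhoods -/

theorem euclNorm_eq_norm (X : Phase n) : euclNorm X = ‖WithLp.toLp 2 X‖ := by
  rw [euclNorm, WithLp.prod_norm_eq_of_L2]
  rfl

theorem euclNorm_nonneg (X : Phase n) : 0 ≤ euclNorm X := Real.sqrt_nonneg _

theorem euclNorm_add_le (X Y : Phase n) : euclNorm (X + Y) ≤ euclNorm X + euclNorm Y := by
  simp only [euclNorm_eq_norm, WithLp.toLp_add]
  exact norm_add_le _ _

theorem abs_euclNorm_sub_le (X Y : Phase n) : |euclNorm X - euclNorm Y| ≤ euclNorm (X - Y) := by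
  simp only [euclNorm_eq_norm, WithLp.toLp_sub]
  exact abs_norm_sub_norm_le _ _

theorem euclNorm_smul (t : ℝ) (X : Phase n) : euclNorm (t • X) = |t| * euclNorm X := by
  simp only [euclNorm_eq_norm, WithLp.toLp_smul, norm_smul, Real.norm_eq_abs]

theorem norm_le_euclNorm (X : Phase n) : ‖X‖ ≤ euclNorm X := by
  refine max_le ?_ ?_ <;> refine Real.le_sqrt_of_sq_le ?_ <;>
    nlinarith [sq_nonneg ‖X.1‖, sq_nonneg ‖X.2‖]

theorem euclNorm_le (X : Phase n) : euclNorm X ≤ 2 * ‖X‖ := by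
  have h1 : ‖X.1‖ ≤ ‖X‖ := le_max_left _ _
  have h2 : ‖X.2‖ ≤ ‖X‖ := le_max_right _ _
  refine Real.sqrt_le_iff.2 ⟨by positivity, ?_⟩
  nlinarith [norm_nonneg X.1, norm_nonneg X.2, norm_nonneg X]

theorem euclNorm_pos {X : Phase n} (hX : X ≠ 0) : 0 < euclNorm X :=
  (norm_pos_iff.2 hX).trans_le (norm_le_euclNorm X)

theorem continuous_euclNorm : Continuous (euclNorm (n := n)) := by
  unfold euclNorm
  fun_prop

theorem bracket_sq_eq (X : Phase n) : bracket X ^ 2 = 1 + euclNorm X ^ 2 := by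
  rw [bracket_sq, euclNorm, Real.sq_sqrt (by positivity), add_assoc]

theorem euclNorm_le_bracket (X : Phase n) : euclNorm X ≤ bracket X := by
  have := bracket_sq_eq X
  nlinarith [bracket_pos X, euclNorm_nonneg X]

theorem bracket_le_one_add_euclNorm (X : Phase n) : bracket X ≤ 1 + euclNorm X := by
  have := bracket_sq_eq X
  nlinarith [bracket_pos X, euclNorm_nonneg X]

theorem bracket_add_le_add (X Y : Phase n) : bracket (X + Y) ≤ bracket X + euclNorm Y := by
  refine abs_le_of_sq_le_sq' ?_ (add_nonneg (bracket_pos X).le (euclNorm_nonneg Y)) |>.2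
  have h1 := bracket_sq_eq X
  have h2 := bracket_sq_eq (X + Y)
  have h3 := euclNorm_add_le X Y
  have h4 := euclNorm_le_bracket X
  have h5 : euclNorm (X + Y) ^ 2 ≤ (euclNorm X + euclNorm Y) ^ 2 :=
    pow_le_pow_left₀ (euclNorm_nonneg _) h3 2
  nlinarith [euclNorm_nonneg Y, mul_le_mul_of_nonneg_right h4 (euclNorm_nonneg Y)]

/-- The conic neighbourhood of aperture `δ` of the direction `e`. -/
def conicNhd (e : Phase n) (δ : ℝ) : Set (Phase n) :=
  {X | ‖X - euclNorm X • e‖ < δ * euclNorm X}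

theorem isOpenCone_conicNhd (e : Phase n) (δ : ℝ) : IsOpenCone (conicNhd e δ) where
  isOpen := isOpen_lt (continuous_id.sub (continuous_euclNorm.smul continuous_const)).norm
    (continuous_const.mul continuous_euclNorm)
  zero_notMem := by simp [conicNhd, euclNorm]
  smul_mem X hX t ht := by
    simp only [conicNhd, Set.mem_ofPred_eq] at hX ⊢
    rw [euclNorm_smul, abs_of_pos ht, mul_smul, ← smul_sub, norm_smul, Real.norm_of_nonneg ht.le,
      mul_left_comm]
    exact mul_lt_mul_of_pos_left hX ht

theorem conicNhd_subset {Γ : Set (Phase n)} (hΓ : IsOpenCone Γ) {e : Phase n} (he : e ∈ Γ) :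
    ∃ δ > 0, conicNhd e δ ⊆ Γ := by
  obtain ⟨δ, hδ, hb⟩ := Metric.isOpen_iff.1 hΓ.isOpen e he
  refine ⟨δ, hδ, fun X hX => ?_⟩
  have hX0 : X ≠ 0 := fun h => (isOpenCone_conicNhd e δ).zero_notMem (h ▸ hX)
  have hp := euclNorm_pos hX0
  have h1 : (euclNorm X)⁻¹ • X ∈ Γ := by
    refine hb (mem_ball_iff_norm.2 ?_)
    have e1 : (euclNorm X)⁻¹ • X - e = (euclNorm X)⁻¹ • (X - euclNorm X • e) := by
      rw [smul_sub, smul_smul, inv_mul_cancel₀ hp.ne', one_smul]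
    rw [e1, norm_smul, norm_inv, Real.norm_of_nonneg hp.le, inv_mul_lt_iff₀ hp, mul_comm]
    exact hX
  have h2 := hΓ.smul_mem _ h1 _ hp
  rwa [smul_smul, mul_inv_cancel₀ hp.ne', one_smul] at h2

/-- Moving from X to Y changes ‖X - |X|e‖ by at most 2|X - Y| and δ|X| by at most δ|X - Y|. A gap
between apertures thus forces a distance proportional to |X|. -/
theorem sub_mul_euclNorm_le {e : Phase n} (he : euclNorm e = 1) {δ δ' : ℝ} (hδ : 0 ≤ δ)
    {X Y : Phase n} (hX : X ∈ conicNhd e δ') (hY : Y ∉ conicNhd e δ) :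
    (δ - δ') * euclNorm X ≤ (2 + δ) * euclNorm (X - Y) := by
  simp only [conicNhd, Set.mem_ofPred_eq, not_lt] at hX hY
  have h1 := abs_le.1 (abs_euclNorm_sub_le X Y)
  have h2 : ‖(euclNorm X - euclNorm Y) • e‖ ≤ euclNorm (X - Y) := by
    rw [norm_smul, Real.norm_eq_abs]
    exact (mul_le_of_le_one_right (abs_nonneg _) ((norm_le_euclNorm e).trans he.le)).trans
      (abs_euclNorm_sub_le X Y)
  have h3 : ‖Y - euclNorm Y • e‖ ≤ ‖X - euclNorm X • e‖ + euclNorm (X - Y) + euclNorm (X - Y) := by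
    have e1 : Y - euclNorm Y • e = (X - euclNorm X • e) - (X - Y) +
        (euclNorm X - euclNorm Y) • e := by
      rw [sub_smul]; abel
    rw [e1]
    refine (norm_add_le _ _).trans (add_le_add ((norm_sub_le _ _).trans ?_) h2)
    exact add_le_add le_rfl (norm_le_euclNorm _)
  nlinarith

theorem separated_conicNhd {e : Phase n} (he : euclNorm e = 1) {δ δ' : ℝ} (hδ : 0 ≤ δ)
    (h : δ' < δ) : Separated (conicNhd e δ') (conicNhd e δ) := by
  refine ⟨1 + (2 + δ) / (δ - δ'), fun X hX Y hY => ?_⟩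
  have h1 := sub_mul_euclNorm_le he hδ hX hY
  have h2 := euclNorm_le_bracket (X - Y)
  have hp : 0 < δ - δ' := sub_pos.2 h
  have h3 : euclNorm X ≤ (2 + δ) / (δ - δ') * euclNorm (X - Y) := by
    rw [div_mul_eq_mul_div, le_div_iff₀ hp]
    linarith
  have h4 : (2 + δ) / (δ - δ') * euclNorm (X - Y) ≤ (2 + δ) / (δ - δ') * bracket (X - Y) :=
    mul_le_mul_of_nonneg_left h2 (by positivity)
  have h5 := bracket_le_one_add_euclNorm X
  have h6 := one_le_bracket (X - Y)
  linarith

/-- The error ⟨X⟩⁻¹ arises because `radial X` has Euclidean length |X|/⟨X⟩ instead of 1. -/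
theorem norm_radial_sub_le {e : Phase n} {δ : ℝ} {X : Phase n} (he : euclNorm e = 1)
    (hX : X ∈ conicNhd e δ) : ‖radial X - e‖ ≤ δ + (bracket X)⁻¹ := by
  simp only [conicNhd, Set.mem_ofPred_eq] at hX
  have hb := bracket_pos X
  have h0 := euclNorm_le_bracket X
  have h1 := bracket_le_one_add_euclNorm X
  have hδ : 0 ≤ δ := by
    by_contra hc
    have := (norm_nonneg _).trans_lt hX
    nlinarith [euclNorm_nonneg X]
  have e1 : radial X - e = (bracket X)⁻¹ • ((X - euclNorm X • e) - (bracket X - euclNorm X) • e) := by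
    have e2 : (X - euclNorm X • e) - (bracket X - euclNorm X) • e = X - bracket X • e := by
      rw [sub_smul]; abel
    rw [e2, radial, Real.rpow_neg_one, smul_sub, smul_smul, inv_mul_cancel₀ hb.ne', one_smul]
  rw [e1, norm_smul, norm_inv, Real.norm_of_nonneg hb.le, inv_mul_le_iff₀ hb, mul_add,
    mul_inv_cancel₀ hb.ne']
  refine (norm_sub_le _ _).trans (add_le_add ?_ ?_)
  · rw [mul_comm]
    exact hX.le.trans (mul_le_mul_of_nonneg_left h0 hδ)
  · rw [norm_smul, Real.norm_of_nonneg (sub_nonneg.2 h0)]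
    have := (norm_le_euclNorm e).trans he.le
    nlinarith [norm_nonneg e]

/-- With ⟨W⟩ - |W| ≤ 2η⟨W⟩, the distance of W from |W|e is at most 3η⟨W⟩ ≤ 6η|W|, where ⟨W⟩ ≤ 2|W|
uses η ≤ 1/4; the constant 7 makes the inequality strict. -/
theorem mem_conicNhd_of_radial {e : Phase n} (he : euclNorm e = 1) {η : ℝ} (hη : 0 < η)
    (hη4 : η ≤ 1 / 4) {W : Phase n} (h : ‖radial W - e‖ < η) :
    W ∈ conicNhd e (7 * η) ∧ bracket W ≤ 2 * euclNorm W := by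
  have hb := bracket_pos W
  have h0 := euclNorm_le_bracket W
  have e1 : W - bracket W • e = bracket W • (radial W - e) := by
    rw [radial, Real.rpow_neg_one, smul_sub, smul_smul, mul_inv_cancel₀ hb.ne', one_smul]
  have h1 : ‖W - bracket W • e‖ ≤ η * bracket W := by
    rw [e1, norm_smul, Real.norm_of_nonneg hb.le, mul_comm]
    exact mul_le_mul_of_nonneg_right h.le hb.le
  have h2 : bracket W - euclNorm W ≤ 2 * (η * bracket W) := by
    have h3 := abs_le.1 (abs_euclNorm_sub_le W (bracket W • e))
    have h4 := euclNorm_le (W - bracket W • e)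
    rw [euclNorm_smul, he, mul_one, abs_of_pos hb] at h3
    linarith [h3.1]
  have h5 : bracket W ≤ 2 * euclNorm W := by nlinarith
  refine ⟨?_, h5⟩
  have e2 : W - euclNorm W • e = (W - bracket W • e) + (bracket W - euclNorm W) • e := by
    rw [sub_smul]; abel
  have h6 : ‖W - euclNorm W • e‖ ≤ 3 * (η * bracket W) := by
    rw [e2]
    refine (norm_add_le _ _).trans ?_
    rw [norm_smul, Real.norm_of_nonneg (sub_nonneg.2 h0)]
    have h7 := (norm_le_euclNorm e).trans he.le
    have h8 : (bracket W - euclNorm W) * ‖e‖ ≤ bracket W - euclNorm W :=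
      mul_le_of_le_one_right (sub_nonneg.2 h0) h7
    linarith
  have h9 : 0 < euclNorm W := by linarith
  simp only [conicNhd, Set.mem_ofPred_eq]
  nlinarith

/-- A conic cutoff: a symbol of order zero, equal to one at infinity near the direction `e` and
supported in a small conic neighbourhood of it. -/
theorem exists_conic_cutoff {e : Phase n} (he : euclNorm e = 1) {δ : ℝ} (hδ : 0 < δ) :
    ∃ a : Phase n → ℂ, IsShubinSymbol 0 a ∧
      (∃ δ' > 0, ∃ R > 0, ∀ X ∈ conicNhd e δ', R ≤ euclNorm X → a X = 1) ∧
      ∃ ε > 0, ∀ X ∉ conicNhd e δ, ∀ Z, ‖Z‖ < ε * bracket X → a (X + Z) = 0 := by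
  -- Chosen so that 7η ≤ δ/2: the support of the cutoff lies in the cone of half the aperture,
  -- leaving room for the balls of radius ε⟨X⟩.
  set η : ℝ := min (1 / 4) (δ / 14)
  have hη : 0 < η := by positivity
  have hη4 : η ≤ 1 / 4 := min_le_left _ _
  have hηδ : 7 * η ≤ δ / 2 := by have := min_le_right (1 / 4) (δ / 14); simp only [η]; linarith
  let χ : ContDiffBump e := ⟨η / 2, η, by positivity, by linarith⟩
  refine ⟨fun X => (χ (radial X) : ℂ), isShubinSymbol_comp_radial χ.contDiff χ.hasCompactSupport,
    ⟨η / 4, by positivity, 4 / η, by positivity, fun X hX hR => ?_⟩, ?_⟩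
  · have h1 := norm_radial_sub_le he hX
    have hb := bracket_pos X
    have h2 : (bracket X)⁻¹ ≤ η / 4 := by
      rw [inv_le_comm₀ hb (by positivity), inv_div]
      exact hR.trans (euclNorm_le_bracket X)
    beta_reduce
    rw [χ.one_of_mem_closedBall, Complex.ofReal_one]
    rw [mem_closedBall_iff_norm]
    change _ ≤ η / 2
    linarith
  · set C : ℝ := 2 * ((2 + δ) / (δ / 2))
    have hC : 0 < C := by positivity
    -- The bound 1/4 gives ⟨X⟩ ≤ 2⟨X + Z⟩. If X + Z were in the support, separation of the cones
    -- would give ⟨X + Z⟩ ≤ C|Z|, and 1/(8C) makes this less than ⟨X⟩/4, a contradiction.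
    refine ⟨min (1 / 4) (1 / (8 * C)), by positivity, fun X hX Z hZ => ?_⟩
    by_contra hne
    have hlt : ‖radial (X + Z) - e‖ < η := by
      by_contra hc
      refine hne ?_
      beta_reduce
      rw [χ.zero_of_le_dist (by rw [dist_eq_norm]; exact not_lt.1 hc), Complex.ofReal_zero]
    obtain ⟨hW, hW2⟩ := mem_conicNhd_of_radial he hη hη4 hlt
    have h1 := sub_mul_euclNorm_le he hδ.le hW hX
    rw [add_sub_cancel_left] at h1
    have hbX := bracket_pos X
    have hZe := euclNorm_le Z
    have hbW := bracket_pos (X + Z)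
    have hz1 : ‖Z‖ < 1 / 4 * bracket X := hZ.trans_le
      (mul_le_mul_of_nonneg_right (min_le_left _ _) hbX.le)
    have hz2 : ‖Z‖ < 1 / (8 * C) * bracket X := hZ.trans_le
      (mul_le_mul_of_nonneg_right (min_le_right _ _) hbX.le)
    have h2 : bracket X ≤ 2 * bracket (X + Z) := by
      have h3 := bracket_add_le_add (X + Z) (-Z)
      have h4 : euclNorm (-Z) = euclNorm Z := by simp [euclNorm]
      rw [add_neg_cancel_right, h4] at h3
      linarith
    have h5 : bracket (X + Z) ≤ C * euclNorm Z := by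
      have h6 : euclNorm (X + Z) ≤ (2 + δ) / (δ / 2) * euclNorm Z := by
        rw [div_mul_eq_mul_div, le_div_iff₀ (by positivity)]
        nlinarith [euclNorm_nonneg (X + Z)]
      simp only [C]
      linarith
    have h7 : C * euclNorm Z < C * (2 * (1 / (8 * C) * bracket X)) :=
      mul_lt_mul_of_pos_left (by linarith) hC
    have h8 : C * (2 * (1 / (8 * C) * bracket X)) = bracket X / 4 := by
      field_simp
      norm_num
    linarith

/-! ### Comparison of the wave front sets -/

theorem exists_le_add_natCast (s t : ℝ) : ∃ k : ℕ, s ≤ t + k := by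
  obtain ⟨k, hk⟩ := exists_nat_ge (s - t)
  exact ⟨k, by linarith⟩

/-- The symbol ⟨X⟩ˢ is elliptic everywhere, so no set has to be shrunk and regularity of order s for
v amounts to regularity of order zero for its image, that is, to L². -/
theorem mem_shubinSobolev_iff {ψ : 𝓢(Cfg n, ℂ)} (hψ : ψ ≠ 0) (s : ℝ) (v : 𝓢'(Cfg n, ℂ)) :
    v ∈ ShubinSobolev n s ↔ SqInt s Set.univ (stftNorm ψ v) := by
  have ha := isShubinSymbol_bracket_rpow (n := n) s
  constructor
  · rintro ⟨Λ, hΛ, hL2⟩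
    have h0 := hL2.sqInt ψ
    obtain ⟨t, ht⟩ := exists_sqInt hψ v
    -- Bootstrap from the a priori order t in unit steps, capped at s.
    have key : ∀ k : ℕ, SqInt (min s (t + k)) Set.univ (stftNorm ψ v) := by
      intro k
      induction k with
      | zero => exact ht.mono MeasurableSet.univ (by simp)
      | succ k ih =>
        refine ha.sqInt_of_elliptic hΛ hψ (separated_univ _) MeasurableSet.univ MeasurableSet.univ
          (c := 1) (R := 0) one_pos (fun X _ _ => ?_) ih
          (h0.mono MeasurableSet.univ (sub_nonpos.2 (min_le_left _ _))) ?_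
        · have hX := bracket_pos X
          rw [one_mul, Complex.norm_real, Real.norm_of_nonneg (by positivity)]
        · rw [← min_add_add_right]
          push_cast
          exact min_le_min (by linarith) (by linarith)
    obtain ⟨k, hk⟩ := exists_le_add_natCast s t
    simpa only [min_eq_left hk] using key k
  · intro h
    obtain ⟨Λ, hΛ⟩ := exists_isWeylQuantization ha
    refine ⟨Λ, hΛ, isL2_of_sqInt hψ ?_⟩
    simpa using ha.sqInt hΛ hψ (separated_univ _) MeasurableSet.univ MeasurableSet.univ h

theorem isSchwartz_iff {ψ : 𝓢(Cfg n, ℂ)} (hψ : ψ ≠ 0) (v : 𝓢'(Cfg n, ℂ)) :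
    IsSchwartz v ↔ ∀ s, SqInt s Set.univ (stftNorm ψ v) :=
  ⟨fun h s => h.sqInt ψ s, isSchwartz_of_sqInt hψ⟩

/-- The Euclidean direction of a phase space point. -/
def direction (X : Phase n) : Phase n := (euclNorm X)⁻¹ • X

theorem euclNorm_direction {X : Phase n} (hX : X ≠ 0) : euclNorm (direction X) = 1 := by
  have := euclNorm_pos hX
  rw [direction, euclNorm_smul, abs_of_pos (by positivity), inv_mul_cancel₀ this.ne']

theorem mem_conicNhd_direction {X : Phase n} (hX : X ≠ 0) {δ : ℝ} (hδ : 0 < δ) :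
    X ∈ conicNhd (direction X) δ := by
  have := euclNorm_pos hX
  simp only [conicNhd, Set.mem_ofPred_eq, direction]
  rw [smul_smul, mul_inv_cancel₀ this.ne', one_smul, sub_self, norm_zero]
  positivity

theorem exists_conicNhd_subset {Γ : Set (Phase n)} (hΓ : IsOpenCone Γ) {X₀ : Phase n}
    (hX₀ : X₀ ∈ Γ) : ∃ δ > 0, conicNhd (direction X₀) δ ⊆ Γ := by
  have h0 : X₀ ≠ 0 := fun h => hΓ.zero_notMem (h ▸ hX₀)
  exact conicNhd_subset hΓ (hΓ.smul_mem _ hX₀ _ (inv_pos.2 (euclNorm_pos h0)))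

theorem measurableSet_conicNhd (e : Phase n) (δ : ℝ) : MeasurableSet (conicNhd e δ) :=
  (isOpenCone_conicNhd e δ).isOpen.measurableSet

/-- Microlocal elliptic regularity. -/
theorem sqInt_conicNhd_of_elliptic {ψ : 𝓢(Cfg n, ℂ)} (hψ : ψ ≠ 0) (u : 𝓢'(Cfg n, ℂ))
    {a : Phase n → ℂ} (ha : IsShubinSymbol 0 a) {A : 𝓢'(Cfg n, ℂ) →L[ℂ] 𝓢'(Cfg n, ℂ)}
    (hA : IsWeylQuantization a A) {e : Phase n} (he : euclNorm e = 1) {δ₀ c R : ℝ} (hc : 0 < c)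
    (hell : ∀ X ∈ conicNhd e δ₀, R ≤ bracket X → c ≤ ‖a X‖) {s : ℝ}
    (hAu : SqInt s Set.univ (stftNorm ψ (A u))) {δ : ℝ} (hδ : 0 < δ) (hδ₀ : δ < δ₀) :
    SqInt s (conicNhd e δ) (stftNorm ψ u) := by
  obtain ⟨t, ht⟩ := exists_sqInt hψ u
  -- Each step needs the preceding order on a slightly larger cone, here of aperture (δ + δ₀)/2.
  -- Therefore the induction carries all δ < δ₀, and the final cone does not depend on the number of
  -- steps.
  have key : ∀ k : ℕ, ∀ δ, 0 < δ → δ < δ₀ →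
      SqInt (min s (t + k)) (conicNhd e δ) (stftNorm ψ u) := by
    intro k
    induction k with
    | zero =>
      exact fun δ _ _ => (ht.mono MeasurableSet.univ (by simp)).mono_set (Set.subset_univ _)
    | succ k ih =>
      intro δ hδ hδ₀
      have hsub : conicNhd e δ ⊆ conicNhd e δ₀ := fun X hX =>
        lt_of_lt_of_le (b := δ * euclNorm X) hX
          (mul_le_mul_of_nonneg_right hδ₀.le (euclNorm_nonneg X))
      refine ha.sqInt_of_elliptic hA hψ
        (separated_conicNhd he (δ := (δ + δ₀) / 2) (δ' := δ) (by linarith) (by linarith))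
        (measurableSet_conicNhd _ _) (measurableSet_conicNhd _ _) hc (R := R)
        (fun X hX hR => ?_) (ih ((δ + δ₀) / 2) (by linarith) (by linarith)) ?_ ?_
      · rw [Real.rpow_zero, mul_one]
        exact hell X (hsub hX) hR
      · rw [sub_zero]
        exact (hAu.mono MeasurableSet.univ (min_le_left _ _)).mono_set (Set.subset_univ _)
      · rw [← min_add_add_right]
        push_cast
        exact min_le_min (by linarith) (by linarith)
  obtain ⟨k, hk⟩ := exists_le_add_natCast s t
  simpa only [min_eq_left hk] using key k δ hδ hδ₀

theorem isShubinSymbol_zero : IsShubinSymbol 0 fun _ : Phase n => (0 : ℂ) :=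
  ⟨contDiff_const, fun k => ⟨0, fun X => by simp⟩⟩

/-- The zero operator qualifies. It makes the intersection defining the isotropic wave front set
nonvacuous, so that the origin is excluded from it. -/
theorem exists_psi_sqInt {ψ : 𝓢(Cfg n, ℂ)} (hψ : ψ ≠ 0) (u : 𝓢'(Cfg n, ℂ)) :
    ∃ A ∈ Psi n 0, ∀ s, SqInt s Set.univ (stftNorm ψ (A u)) := by
  obtain ⟨A, hA⟩ := exists_isWeylQuantization (isShubinSymbol_zero (n := n))
  exact ⟨A, ⟨_, isShubinSymbol_zero, hA⟩, fun s => isShubinSymbol_zero.sqInt_of_vanish hA hψ u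
    MeasurableSet.univ one_pos (fun _ _ _ _ => rfl) s⟩

/-- Microlocal regularity measured by elliptic operators agrees with phase space regularity on
conic neighbourhoods, for any set `S` of orders. -/
theorem exists_elliptic_sqInt_iff {ψ : 𝓢(Cfg n, ℂ)} (hψ : ψ ≠ 0) (u : 𝓢'(Cfg n, ℂ)) (S : Set ℝ)
    {X₀ : Phase n} (hX₀ : X₀ ≠ 0) :
    (∃ A ∈ Psi n 0, (∀ s ∈ S, SqInt s Set.univ (stftNorm ψ (A u))) ∧ IsEllipticAt 0 A X₀) ↔
      ∃ Γ, IsOpenCone Γ ∧ X₀ ∈ Γ ∧ ∀ s ∈ S, SqInt s Γ (stftNorm ψ u) := by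
  have he := euclNorm_direction hX₀
  constructor
  · rintro ⟨A, -, hS, a, ha, hA, Γ, hΓ, hX, c, R, hc, -, hell⟩
    obtain ⟨δ₀, hδ₀, hsub⟩ := exists_conicNhd_subset hΓ hX
    -- One cone serves all orders s ∈ S simultaneously, as the smooth case requires.
    refine ⟨conicNhd (direction X₀) (δ₀ / 2), isOpenCone_conicNhd _ _,
      mem_conicNhd_direction hX₀ (by positivity), fun s hs => ?_⟩
    refine sqInt_conicNhd_of_elliptic hψ u ha hA he (δ₀ := δ₀) (R := R + 1) hc
      (fun X hX hR => ?_) (hS s hs) (by positivity) (by linarith)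
    have h1 := bracket_le_one_add_euclNorm X
    simpa using hell X (hsub hX) (by linarith)
  · rintro ⟨Γ, hΓ, hX, hS⟩
    obtain ⟨δ, hδ, hsub⟩ := exists_conicNhd_subset hΓ hX
    obtain ⟨a, ha, ⟨δ', hδ', R, hR, hone⟩, ε, hε, hvan⟩ :=
      exists_conic_cutoff he (half_pos hδ)
    obtain ⟨A, hA⟩ := exists_isWeylQuantization ha
    refine ⟨A, ⟨a, ha, hA⟩, fun s hs => ?_, a, ha, hA, conicNhd (direction X₀) δ',
      isOpenCone_conicNhd _ _, mem_conicNhd_direction hX₀ hδ', 1, R, one_pos, hR, fun X hX hXR => ?_⟩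
    · have h1 : SqInt s (conicNhd (direction X₀) (δ / 2)) (stftNorm ψ (A u)) := by
        simpa using ha.sqInt hA hψ (separated_conicNhd he hδ.le (half_lt_self hδ))
          (measurableSet_conicNhd _ _) (measurableSet_conicNhd _ _) ((hS s hs).mono_set hsub)
      have h2 := ha.sqInt_of_vanish hA hψ u (measurableSet_conicNhd _ (δ / 2)).compl hε hvan s
      simpa only [Set.union_compl_self] using h1.union h2
    · rw [hone X hX hXR]
      simp

/-- Rapid decay on a conic neighbourhood, in the uniform and in the square integrable sense. -/
theorem exists_rapidDecay_iff {ψ : 𝓢(Cfg n, ℂ)} (hψ : ψ ≠ 0) (u : 𝓢'(Cfg n, ℂ)) (X₀ : Phase n) :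
    (∃ Γ, IsOpenCone Γ ∧ X₀ ∈ Γ ∧ ∀ N : ℕ, ∃ C : ℝ, ∀ X ∈ Γ, bracket X ^ N * ‖stft ψ u X‖ ≤ C) ↔
      ∃ Γ, IsOpenCone Γ ∧ X₀ ∈ Γ ∧ ∀ s, SqInt s Γ (stftNorm ψ u) := by
  constructor
  · rintro ⟨Γ, hΓ, hX, h⟩
    refine ⟨Γ, hΓ, hX, fun s => ?_⟩
    set N : ℕ := ⌈s + (2 * n + 1)⌉₊
    obtain ⟨C, hC⟩ := h N
    refine sqInt_of_decay hΓ.isOpen.measurableSet (C := ENNReal.ofReal C) ENNReal.ofReal_ne_top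
      fun X hX => ?_
    refine le_trans ?_ (mul_le_mul_right (wt_mono (neg_le_neg (Nat.le_ceil _)) X) _)
    have hb := bracket_pos X
    have h1 : 0 ≤ C := le_trans (by positivity) (hC X hX)
    rw [stftNorm, ← ofReal_norm, wt, ← ENNReal.ofReal_mul h1]
    refine ENNReal.ofReal_le_ofReal ?_
    rw [Real.rpow_neg hb.le, Real.rpow_natCast, ← div_eq_mul_inv, le_div_iff₀ (by positivity),
      mul_comm]
    exact hC X hX
  · rintro ⟨Γ, hΓ, hX, h⟩
    have h0 : X₀ ≠ 0 := fun h => hΓ.zero_notMem (h ▸ hX)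
    obtain ⟨δ, hδ, hsub⟩ := exists_conicNhd_subset hΓ hX
    refine ⟨conicNhd (direction X₀) (δ / 2), isOpenCone_conicNhd _ _,
      mem_conicNhd_direction h0 (by positivity), fun N => ?_⟩
    obtain ⟨M, D, hD, hM⟩ := exists_stftNorm_le hψ u
    obtain ⟨N', C, hC, hle⟩ := SqInt.avg_rapid_of_separated
      (separated_conicNhd (euclNorm_direction h0) hδ.le (half_lt_self hδ))
      (measurableSet_conicNhd _ _) (measurable_stftNorm hψ u) hD hM
      (fun s => (h s).mono_set hsub) (Nat.cast_nonneg N)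
    -- The change of window is applied with ψ itself: V_ψ u is dominated by its own average, for
    -- which square integrability yields pointwise bounds.
    obtain ⟨B, hB, hBle⟩ := enorm_stft_le_avg hψ u (sBdd_const (ι := Unit) ψ) N'
    refine ⟨(B * C).toReal, fun X hX => ?_⟩
    have hb := bracket_pos X
    rw [← ENNReal.ofReal_le_iff_le_toReal (ENNReal.mul_ne_top hB hC),
      ENNReal.ofReal_mul (by positivity), ofReal_norm, ← Real.rpow_natCast]
    calc wt (N : ℝ) X * ‖stft ψ u X‖ₑ ≤ wt (N : ℝ) X * (B * avg N' (stftNorm ψ u) X) :=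
          mul_le_mul_right (hBle () X) _
      _ = B * (wt (N : ℝ) X * avg N' (stftNorm ψ u) X) := by ring
      _ ≤ B * C := mul_le_mul_right (hle X hX) _

/-- Treats both isotropic wave front sets at once: a regularity condition P enters only through the
set S of orders by which it is characterized. -/
theorem iInter_charIso_eq {ψ : 𝓢(Cfg n, ℂ)} (hψ : ψ ≠ 0) (u : 𝓢'(Cfg n, ℂ)) (S : Set ℝ)
    {P : 𝓢'(Cfg n, ℂ) → Prop} (hP : ∀ v, P v ↔ ∀ s ∈ S, SqInt s Set.univ (stftNorm ψ v)) :
    ⋂ A ∈ {A | A ∈ Psi n 0 ∧ P (A u)}, CharIso 0 A =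
      {X₀ | X₀ ≠ 0 ∧ ¬∃ Γ, IsOpenCone Γ ∧ X₀ ∈ Γ ∧ ∀ s ∈ S, SqInt s Γ (stftNorm ψ u)} := by
  ext X₀
  simp only [Set.mem_iInter, Set.mem_ofPred_eq, CharIso, hP]
  constructor
  · intro h
    obtain ⟨A, hA, hAs⟩ := exists_psi_sqInt hψ u
    have h0 := (h A ⟨hA, fun s _ => hAs s⟩).1
    refine ⟨h0, fun hc => ?_⟩
    obtain ⟨A, hA, hS, hell⟩ := (exists_elliptic_sqInt_iff hψ u S h0).2 hc
    exact (h A ⟨hA, hS⟩).2 hell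
  · rintro ⟨h0, hc⟩ A ⟨hA, hS⟩
    exact ⟨h0, fun hell => hc ((exists_elliptic_sqInt_iff hψ u S h0).1 ⟨A, hA, hS, hell⟩)⟩

theorem wFisoOrder_eq {ψ : 𝓢(Cfg n, ℂ)} (hψ : ψ ≠ 0) (u : 𝓢'(Cfg n, ℂ)) (s : ℝ) :
    WFisoOrder s u = WFGOrder s ψ u := by
  rw [WFisoOrder, iInter_charIso_eq hψ u {s} (P := fun v => v ∈ ShubinSobolev n s) fun v => by
    simpa using mem_shubinSobolev_iff hψ s v]
  ext X₀
  simp only [WFGOrder, Set.mem_ofPred_eq, Set.mem_singleton_iff, forall_eq]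
  refine and_congr_right fun _ => not_congr (exists_congr fun Γ => and_congr_right fun hΓ => ?_)
  rw [memLp_indicator_iff_sqInt hψ u s hΓ.isOpen.measurableSet]

theorem wFG_eq {ψ : 𝓢(Cfg n, ℂ)} (hψ : ψ ≠ 0) (u : 𝓢'(Cfg n, ℂ)) : WFG ψ u = WFiso u := by
  rw [WFiso, iInter_charIso_eq hψ u Set.univ (P := IsSchwartz) fun v => by
    simpa using isSchwartz_iff hψ v]
  ext X₀
  simp only [WFG, Set.mem_ofPred_eq, exists_rapidDecay_iff hψ u X₀, Set.mem_univ, true_imp_iff]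

end IsoGabor

end

theorem mainTheorem4 (n : ℕ) (ψ : SchwartzMap (IsoGabor.Cfg n) ℂ) (hψ : ψ ≠ 0)
    (u : TemperedDistribution (IsoGabor.Cfg n) ℂ) :
    (∀ s : ℝ, IsoGabor.WFisoOrder s u = IsoGabor.WFGOrder s ψ u) ∧
      IsoGabor.WFG ψ u = IsoGabor.WFiso u :=
  ⟨IsoGabor.wFisoOrder_eq hψ u, IsoGabor.wFG_eq hψ u⟩
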